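/- **Setting.** Finitely many asynchronous processes, which may crash, share a collection of *Data-records*. Each Data-record has finitely many mutable fields (one word each) and finitely many immutable fields, all given values when the record is created; field values may contain pointers to existing Data-records. Initially there are finitely many Data-records. Processes may create further ones, and records are always allocated at fresh addresses. In addition each Data-record $r$ has a pointer $r.\mathit{info}$ to an *SCX-record*, initially to a dummy SCX-record whose state is Aborted, and a bit $r.\mathit{marked}$, initially false. An SCX-record stores $V,R,\mathit{fld},\mathit{new},\mathit{old}$, a $\mathit{state}\in\{\text{InProgress},\text{Committed},\text{Aborted}\}$, a bit $\mathit{allFrozen}$, and for each $r\in V$ a pointer $\mathit{infoFields}(r)$. Each read, write or CAS of a word is one atomic step. The operations are atomic reads of mutable and immutable fields and the following. * $\mathrm{LLX}(r)$: read $m_1:=r.\mathit{marked}$, $u:=r.\mathit{info}$, $s:=u.\mathit{state}$, $m_2:=r.\mathit{marked}$, in this order. If $s=$ Aborted, or $s=$ Committed and not $m_2$, then read the mutable fields of $r$ one by one and, if still $r.\mathit{info}=u$, store $u$ and the values read in a local table and return the values (a *snapshot*). If nothing has been returned: if ($u.\mathit{state}=$ Committed, or $u.\mathit{state}=$ InProgress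 and $\mathrm{Help}(u)$ returns True) and $m_1$, return Finalized. Otherwise, if $r.\mathit{info}.\mathit{state}=$ InProgress, call $\mathrm{Help}(r.\mathit{info})$; then return Fail. * $\mathrm{SCX}(V,R,\mathit{fld},\mathit{new})$, where $V$ is a sequence of Data-records, $R$ a subsequence of $V$, and $\mathit{fld}$ a mutable field of a Data-record in $V$: create a new SCX-record $u$ with these arguments, state InProgress, $\mathit{allFrozen}$ false, and the info pointers and the old value of $\mathit{fld}$ taken from the local table; return $\mathrm{Help}(u)$. * $\mathrm{Help}(u)$: for each $r$ in $u.V$ in order, perform $\mathrm{CAS}(r.\mathit{info},u.\mathit{infoFields}(r),u)$; if it fails and then $r.\mathit{info}\ne u$, return True if $u.\mathit{allFrozen}$, and otherwise set $u.\mathit{state}:=$ Aborted and return False. After the loop set $u.\mathit{allFrozen}:=$ True, set $r.\mathit{marked}:=$ True for each $r$ in $u.R$, perform the *update CAS* $\mathrm{CAS}(u.\mathit{fld},u.\mathit{old},u.\mathit{new})$, set $u.\mathit{state}:=$ Committed, and return True. * $\mathrm{VLX}(V)$: for each $r$ in $V$ in order, return False if $r.\mathit{info}$ differs from the info pointer for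 $r$ in the local table; at the end return True. An LLX is *successful* if it returns a snapshot or Finalized; an SCX or VLX is *successful* if it returns True. An $\mathrm{LLX}(r)$ by process $p$ is *linked* to a later $\mathrm{SCX}(V,\dots)$ or $\mathrm{VLX}(V)$ by $p$ with $r\in V$ if it returns a snapshot and between the two $p$ invokes no $\mathrm{LLX}(r)$, no SCX whose sequence contains $r$, and no unsuccessful VLX whose sequence contains $r$. Every SCX and VLX must be set up: for each $r\in V$ there is a linked $\mathrm{LLX}(r)$. The *linearization point* of an SCX is the first update CAS performed by any process for its SCX-record (the SCX is linearized if and only if there is one); that of an LLX returning a snapshot is its second read of $r.\mathit{info}$. **Constraint A.** For every linearized $\mathrm{SCX}(V,R,\mathit{fld},\mathit{new})$, $\mathit{new}$ is not the initial value of $\mathit{fld}$, and no $\mathrm{SCX}(V',R',\mathit{fld},\mathit{new})$ is linearized before the linked $\mathrm{LLX}(r)$ is, where $r$ is the Data-record containing $\mathit{fld}$. **Constraint B.** For every configuration $C$ after which no mutable or immutable field of any Data-record changes, there is a total order $<$ on the Data-records such that if $r_1$ appears before $r_2$ in the sequence $V$ of an SCX all of whose linked LLXs begin after $C$, then $r_1<r_2$.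 **Access assumption.** $\mathrm{LLX}(r)$ is invoked by $p$ only if $p$ created $r$ or $r$ has become visible, i.e. $r$ existed initially or a pointer to $r$ has been in a field of a visible Data-record. **Theorem.** In every execution in which every SCX and VLX is set up and Constraint A holds, there is a linearization of all successful LLXs, SCXs and VLXs, some non-terminating SCXs, and all terminating reads (each operation being linearized at a step between its start and its end, different operations at different steps, and SCXs and LLXs returning snapshots at the points above) such that: * **C1.** Each read of a field returns the last value stored in the field by an SCX linearized before the read, or the initial value if there is none. * **C2.** Each linearized $\mathrm{LLX}(r)$ that does not return Finalized returns, for each mutable field of $r$, the last value stored in it by an SCX linearized before the LLX, or the initial value if there is none. * **C3.** Each linearized $\mathrm{LLX}(r)$ returns Finalized if and only if it is linearized after an $\mathrm{SCX}(V,R,\mathit{fld},\mathit{new})$ with $r\in R$. * **C4.** For each linearized SCX or VLX $I$ with sequence $V$ and each $r\in V$, no SCX whose sequence contains $r$ is linearized between the $\mathrm{LLX}(r)$ linked to $I$ and $I$. Moreover: * **P1.** Each terminating $\mathrm{LLX}(r)$ that begins after the end of a successful $\mathrm{SCX}(V,R,\mathit{fld},\mathit{new})$ with $r\in R$, or after another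 $\mathrm{LLX}(r)$ has returned Finalized, returns Finalized. If in addition Constraint B and the access assumption hold, then: * **P2.** If infinitely many LLX, SCX or VLX operations are performed, then infinitely many LLX, SCX or VLX operations succeed. * **P3.** If infinitely many SCX or VLX operations are performed, then infinitely many SCX or VLX operations succeed. * **P4.** If infinitely many SCX operations are performed, then infinitely many SCX operations succeed. -/

import Mathlib

/-!
Asynchronous shared-memory model of the CAS-based implementation of LLX, SCX and VLX.
Every access to shared memory (read, write or CAS of one word) is one atomic step.
-/

namespace LLXSCX

/-- Addresses of Data-records; allocation always uses the next fresh address. -/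
abbrev RecId := ℕ

/-- Addresses of SCX-records; address `0` is the dummy SCX-record, and allocation always uses
the next fresh address. -/
abbrev ScxPtr := ℕ

/-- A Data-record: its mutable fields, its immutable fields, and the two fields used by the
algorithm.  `initVals` is a ghost copy of the values that the mutable fields were given at
creation; no step of the algorithm reads or writes it. -/
structure DataRec (Val : Type*) where
  initVals : List Val
  vals : List Val
  consts : List Val
  info : ScxPtr
  marked : Bool

inductive ScxState
  | inProgress
  | committed
  | aborted
  deriving DecidableEq

/-- An SCX-record.  The pair `fld = (r, i)` is the address of the `i`-th mutable field of the
Data-record `r`; `infoFields` is the table of info pointers, indexed by the elements of `V`. -/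
structure ScxRec (Val : Type*) where
  V : List RecId
  R : List RecId
  fld : RecId × ℕ
  new : Val
  old : Val
  state : ScxState
  allFrozen : Bool
  infoFields : RecId → ScxPtr

/-- A user-defined field of a Data-record: its `i`-th mutable or its `i`-th immutable field. -/
inductive Field
  | mutable (i : ℕ)
  | immutable (i : ℕ)

/-- The operations that a process can invoke. -/
inductive Op (Val : Type*)
  | llx (r : RecId)
  | scx (V R : List RecId) (fld : RecId × ℕ) (new : Val)
  | vlx (V : List RecId)
  | read (r : RecId) (f : Field)

/-- The responses of operations. -/
inductive Resp (Val : Type*)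
  | snapshot (vals : List Val)
  | finalized
  | fail
  | bool (b : Bool)
  | value (v : Val)

/-- An operation that terminates is successful unless it returns `FAIL` or `FALSE`. -/
def Resp.Success {Val : Type*} : Resp Val → Prop
  | fail => False
  | bool false => False
  | _ => True

/-- The place from which `Help` was called. -/
inductive Cont
  /-- `SCX`, which returns the result of `Help` -/
  | scx
  /-- the test `(… or (rinfo.state = InProgress and Help(rinfo))) and marked₁` of `LLX(r)` -/
  | llxTest (r : RecId) (marked₁ : Bool)
  /-- the call `Help(r.info)` of an `LLX(r)` that is about to return `FAIL` -/
  | llxFail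

/-- Program counter and local variables of a process. -/
inductive PC (Val : Type*)
  /-- no operation is being performed -/
  | idle
  /-- `LLX(r)`: `marked₁ := r.marked` -/
  | llxMarked₁ (r : RecId)
  /-- `rinfo := r.info` -/
  | llxInfo (r : RecId) (marked₁ : Bool)
  /-- `state := rinfo.state` -/
  | llxState (r : RecId) (marked₁ : Bool) (rinfo : ScxPtr)
  /-- `marked₂ := r.marked`, and the (local) test whether `r` was not frozen -/
  | llxMarked₂ (r : RecId) (marked₁ : Bool) (rinfo : ScxPtr) (state : ScxState)
  /-- read `r.m₁, …, r.m_y` one after the other; `ms` are the values read so far -/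
  | llxCollect (r : RecId) (marked₁ : Bool) (rinfo : ScxPtr) (ms : List Val)
  /-- `if r.info = rinfo` then store the result in the local table and return the snapshot -/
  | llxReread (r : RecId) (marked₁ : Bool) (rinfo : ScxPtr) (ms : List Val)
  /-- the test `rinfo.state = Committed` -/
  | llxTest₁ (r : RecId) (marked₁ : Bool) (rinfo : ScxPtr)
  /-- the test `rinfo.state = InProgress`, followed by `Help(rinfo)` if it holds -/
  | llxTest₂ (r : RecId) (marked₁ : Bool) (rinfo : ScxPtr)
  /-- `if r.info.state = InProgress then Help(r.info)`: first read of `r.info` -/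
  | llxFail₁ (r : RecId)
  /-- the read of the `state` field -/
  | llxFail₂ (r : RecId) (q : ScxPtr)
  /-- second read of `r.info`, followed by the call of `Help` -/
  | llxFail₃ (r : RecId)
  /-- `Help(u)`: freezing CAS on the first of the remaining elements `rs` of `u.V` -/
  | helpFreeze (u : ScxPtr) (rs : List RecId) (k : Cont)
  /-- the freezing CAS on `r` has failed: test `r.info ≠ u` -/
  | helpCheck (u : ScxPtr) (r : RecId) (rs : List RecId) (k : Cont)
  /-- frozen check step -/
  | helpFrozenCheck (u : ScxPtr) (k : Cont)
  /-- abort step -/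
  | helpAbort (u : ScxPtr) (k : Cont)
  /-- frozen step -/
  | helpFrozen (u : ScxPtr) (k : Cont)
  /-- mark step on the first of the remaining elements `rs` of `u.R` -/
  | helpMark (u : ScxPtr) (rs : List RecId) (k : Cont)
  /-- update CAS -/
  | helpUpdate (u : ScxPtr) (k : Cont)
  /-- commit step -/
  | helpCommit (u : ScxPtr) (k : Cont)
  /-- `VLX`: test of the first of the remaining elements `rs` of `V` -/
  | vlx (rs : List RecId)
  /-- read of a field -/
  | read (r : RecId) (f : Field)
  /-- return statement of the operation -/
  | ret (resp : Resp Val)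

/-- State of a process.  `table r` is the entry for `r` in the local table of LLX results: the
info pointer and the values of the mutable fields. -/
structure Proc (Val : Type*) where
  pc : PC Val
  table : RecId → ScxPtr × List Val

/-- A configuration.  The Data-records that have been created are those with address `< nRec`, and
the SCX-records that have been created (including the dummy) those with address `< nScx`. -/
structure Config (P Val : Type*) where
  recs : RecId → DataRec Val
  nRec : ℕ
  scxs : ScxPtr → ScxRec Val
  nScx : ℕ
  procs : P → Proc Val

/-- What may happen at one instant of an execution.  (A finite execution is represented as an
infinite sequence that ends with infinitely many actions `none`.) -/
inductive Action (P Val : Type*)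
  /-- nothing happens -/
  | none
  /-- `p` creates a Data-record with the given initial values of its (im)mutable fields -/
  | create (p : P) (vals consts : List Val)
  /-- `p` invokes an operation -/
  | invoke (p : P) (op : Op Val)
  /-- `p` performs the next step of the operation that it is executing -/
  | run (p : P)

namespace Config

variable {P Val : Type*} [DecidableEq P]

def setPC (c : Config P Val) (p : P) (pc : PC Val) : Config P Val :=
  { c with procs := Function.update c.procs p { c.procs p with pc := pc } }

def setTable (c : Config P Val) (p : P) (r : RecId) (e : ScxPtr × List Val) : Config P Val :=
  { c with
    procs := Function.update c.procs p
      { c.procs p with table := Function.update (c.procs p).table r e } }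

def setRec (c : Config P Val) (r : RecId) (d : DataRec Val) : Config P Val :=
  { c with recs := Function.update c.recs r d }

def setScx (c : Config P Val) (u : ScxPtr) (s : ScxRec Val) : Config P Val :=
  { c with scxs := Function.update c.scxs u s }

/-- Process `p` calls `Help(u)`. -/
def callHelp (c : Config P Val) (p : P) (u : ScxPtr) (k : Cont) : Config P Val :=
  c.setPC p (.helpFreeze u (c.scxs u).V k)

/-- The invocation of `Help` by process `p` returns `b`. -/
def helpReturn (c : Config P Val) (p : P) (k : Cont) (b : Bool) : Config P Val :=
  match k with
  | .scx => c.setPC p (.ret (.bool b))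
  | .llxTest r marked₁ =>
      if b && marked₁ then c.setPC p (.ret .finalized) else c.setPC p (.llxFail₁ r)
  | .llxFail => c.setPC p (.ret .fail)

/-- `CAS(r.info, old, new)`: the new configuration. -/
def casInfo (c : Config P Val) (r : RecId) (old new : ScxPtr) : Config P Val :=
  if (c.recs r).info = old then c.setRec r { c.recs r with info := new } else c

/-- `CAS(fld, old, new)` on a mutable field: the new configuration. -/
def casField [DecidableEq Val] (c : Config P Val) (fld : RecId × ℕ) (old new : Val) :
    Config P Val :=
  if (c.recs fld.1).vals[fld.2]? = some old then
    c.setRec fld.1 { c.recs fld.1 with vals := (c.recs fld.1).vals.set fld.2 new }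
  else c

/-- The value stored in a user-defined field of a Data-record. -/
def fieldValue? (c : Config P Val) (r : RecId) : Field → Option Val
  | .mutable i => (c.recs r).vals[i]?
  | .immutable i => (c.recs r).consts[i]?

/-- The next step of the operation that process `p` is executing. -/
def runStep [DecidableEq Val] [Inhabited Val] (c : Config P Val) (p : P) : Config P Val :=
  match (c.procs p).pc with
  | .idle => c
  | .llxMarked₁ r => c.setPC p (.llxInfo r (c.recs r).marked)
  | .llxInfo r m₁ => c.setPC p (.llxState r m₁ (c.recs r).info)
  | .llxState r m₁ rinfo => c.setPC p (.llxMarked₂ r m₁ rinfo (c.scxs rinfo).state)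
  | .llxMarked₂ r m₁ rinfo state =>
      if state = .aborted ∨ (state = .committed ∧ (c.recs r).marked = false) then
        c.setPC p (.llxCollect r m₁ rinfo [])
      else c.setPC p (.llxTest₁ r m₁ rinfo)
  | .llxCollect r m₁ rinfo ms =>
      match (c.recs r).vals[ms.length]? with
      | some v => c.setPC p (.llxCollect r m₁ rinfo (ms ++ [v]))
      | none => c.setPC p (.llxReread r m₁ rinfo ms)
  | .llxReread r m₁ rinfo ms =>
      if (c.recs r).info = rinfo then
        (c.setTable p r (rinfo, ms)).setPC p (.ret (.snapshot ms))
      else c.setPC p (.llxTest₁ r m₁ rinfo)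
  | .llxTest₁ r m₁ rinfo =>
      if (c.scxs rinfo).state = .committed then
        if m₁ then c.setPC p (.ret .finalized) else c.setPC p (.llxFail₁ r)
      else c.setPC p (.llxTest₂ r m₁ rinfo)
  | .llxTest₂ r m₁ rinfo =>
      if (c.scxs rinfo).state = .inProgress then c.callHelp p rinfo (.llxTest r m₁)
      else c.setPC p (.llxFail₁ r)
  | .llxFail₁ r => c.setPC p (.llxFail₂ r (c.recs r).info)
  | .llxFail₂ r q =>
      if (c.scxs q).state = .inProgress then c.setPC p (.llxFail₃ r)
      else c.setPC p (.ret .fail)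
  | .llxFail₃ r => c.callHelp p (c.recs r).info .llxFail
  | .helpFreeze u [] k => c.setPC p (.helpFrozen u k)
  | .helpFreeze u (r :: rs) k =>
      if (c.recs r).info = (c.scxs u).infoFields r then
        (c.casInfo r ((c.scxs u).infoFields r) u).setPC p (.helpFreeze u rs k)
      else c.setPC p (.helpCheck u r rs k)
  | .helpCheck u r rs k =>
      if (c.recs r).info = u then c.setPC p (.helpFreeze u rs k)
      else c.setPC p (.helpFrozenCheck u k)
  | .helpFrozenCheck u k =>
      if (c.scxs u).allFrozen then c.helpReturn p k true
      else c.setPC p (.helpAbort u k)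
  | .helpAbort u k =>
      (c.setScx u { c.scxs u with state := .aborted }).helpReturn p k false
  | .helpFrozen u k =>
      (c.setScx u { c.scxs u with allFrozen := true }).setPC p (.helpMark u (c.scxs u).R k)
  | .helpMark u [] k => c.setPC p (.helpUpdate u k)
  | .helpMark u (r :: rs) k =>
      (c.setRec r { c.recs r with marked := true }).setPC p (.helpMark u rs k)
  | .helpUpdate u k =>
      (c.casField (c.scxs u).fld (c.scxs u).old (c.scxs u).new).setPC p (.helpCommit u k)
  | .helpCommit u k =>
      (c.setScx u { c.scxs u with state := .committed }).helpReturn p k true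
  | .vlx [] => c.setPC p (.ret (.bool true))
  | .vlx (r :: rs) =>
      if ((c.procs p).table r).1 = (c.recs r).info then c.setPC p (.vlx rs)
      else c.setPC p (.ret (.bool false))
  | .read r f => c.setPC p (.ret (.value ((c.fieldValue? r f).getD default)))
  | .ret _ => c.setPC p .idle

/-- The start of an operation by process `p`.  An `SCX` creates a new SCX-record from its arguments
and from the local table of LLX results, and calls `Help` on it. -/
def start [Inhabited Val] (c : Config P Val) (p : P) : Op Val → Config P Val
  | .llx r => c.setPC p (.llxMarked₁ r)
  | .scx V R fld new =>
      Config.callHelp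
        { c with
          nScx := c.nScx + 1
          scxs := Function.update c.scxs c.nScx
            { V := V, R := R, fld := fld, new := new
              old := ((c.procs p).table fld.1).2.getD fld.2 default
              state := .inProgress, allFrozen := false
              infoFields := fun r => ((c.procs p).table r).1 } }
        p c.nScx .scx
  | .vlx V => c.setPC p (.vlx V)
  | .read r f => c.setPC p (.read r f)

/-- The configuration that results from an action. -/
def next [DecidableEq Val] [Inhabited Val] (c : Config P Val) : Action P Val → Config P Val
  | .none => c
  | .create _ vals consts =>
      { c with
        nRec := c.nRec + 1
        recs := Function.update c.recs c.nRec
          { initVals := vals, vals := vals, consts := consts, info := 0, marked := false } }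
  | .invoke p op => c.start p op
  | .run p => c.runStep p

/-- The arguments of an operation make sense: they refer to Data-records and fields that exist, `R`
is a subsequence of `V`, and `fld` is a mutable field of a Data-record in `V`.  Here `refs v` is the
set of Data-records to which the value `v` contains pointers. -/
def OpOK (refs : Val → Set RecId) (c : Config P Val) : Op Val → Prop
  | .llx r => r < c.nRec
  | .scx V R fld new =>
      R.Sublist V ∧ fld.1 ∈ V ∧ fld.2 < (c.recs fld.1).vals.length ∧ ∀ r ∈ refs new, r < c.nRec
  | .vlx _ => True
  | .read r f => r < c.nRec ∧ (c.fieldValue? r f).isSome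

/-- The actions that are possible in a configuration: a process executes one operation at a time,
and values only contain pointers to Data-records that exist (a new one may point to itself). -/
def Enabled (refs : Val → Set RecId) (c : Config P Val) : Action P Val → Prop
  | .none => True
  | .create p vals consts =>
      (c.procs p).pc = .idle ∧ ∀ v ∈ vals ++ consts, ∀ r ∈ refs v, r ≤ c.nRec
  | .invoke p op => (c.procs p).pc = .idle ∧ OpOK refs c op
  | .run p => (c.procs p).pc ≠ .idle

/-- Initial configurations: there are finitely many Data-records, none of them marked, with their
info fields pointing to the dummy SCX-record, whose state is `Aborted`; no process is executing an
operation. -/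
structure IsInitial (refs : Val → Set RecId) (c : Config P Val) : Prop where
  nScx : c.nScx = 1
  dummy_state : (c.scxs 0).state = .aborted
  idle : ∀ p, (c.procs p).pc = .idle
  info : ∀ r < c.nRec, (c.recs r).info = 0
  unmarked : ∀ r < c.nRec, (c.recs r).marked = false
  vals : ∀ r < c.nRec, (c.recs r).vals = (c.recs r).initVals
  refs_lt : ∀ r < c.nRec, ∀ v ∈ (c.recs r).vals ++ (c.recs r).consts, ∀ r' ∈ refs v, r' < c.nRec

end Config

/-- An execution: `cfg 0, act 0, cfg 1, act 1, …`. -/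
structure Execution (P : Type*) {Val : Type*} [DecidableEq P] [DecidableEq Val] [Inhabited Val]
    (refs : Val → Set RecId) where
  cfg : ℕ → Config P Val
  act : ℕ → Action P Val
  initial : (cfg 0).IsInitial refs
  enabled : ∀ t, (cfg t).Enabled refs (act t)
  next : ∀ t, cfg (t + 1) = (cfg t).next (act t)

/-- The sequence `V` of an `SCX` or `VLX` (empty for the other operations). -/
def Op.deps {Val : Type*} : Op Val → List RecId
  | scx V _ _ _ => V
  | vlx V => V
  | _ => []

namespace Execution

variable {P Val : Type*} [DecidableEq P] [DecidableEq Val] [Inhabited Val]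
  {refs : Val → Set RecId} (e : Execution P refs)

/-! An invocation is identified with the time `t` at which it occurs, `e.act t = .invoke p op`. -/

/-- Process `p` returns `resp` from an operation at time `t`. -/
def ReturnsAt (p : P) (t : ℕ) (resp : Resp Val) : Prop :=
  e.act t = .run p ∧ ((e.cfg t).procs p).pc = .ret resp

/-- The operation invoked at time `t` returns `resp` at time `t'`. -/
def Returns (t t' : ℕ) (resp : Resp Val) : Prop :=
  ∃ p op, e.act t = .invoke p op ∧ t < t' ∧ e.ReturnsAt p t' resp ∧
    ∀ s, t < s → s < t' → ∀ resp', ¬ e.ReturnsAt p s resp'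

def Terminates (t : ℕ) : Prop := ∃ t' resp, e.Returns t t' resp

def Succeeds (t : ℕ) : Prop := ∃ t' resp, e.Returns t t' resp ∧ resp.Success

/-- The `LLX(r)` invoked at time `l` is linked to the `SCX` or `VLX` invoked at time `t`. -/
def Linked (l t : ℕ) (r : RecId) : Prop :=
  l < t ∧ ∃ p op, e.act l = .invoke p (.llx r) ∧ e.act t = .invoke p op ∧ r ∈ op.deps ∧
    (∃ t' vals, e.Returns l t' (.snapshot vals)) ∧
    ∀ s, l < s → s < t →
      e.act s ≠ .invoke p (.llx r) ∧
      (∀ V R fld new, r ∈ V → e.act s ≠ .invoke p (.scx V R fld new)) ∧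
      (∀ V, r ∈ V → e.act s = .invoke p (.vlx V) → ∀ t', ¬ e.Returns s t' (.bool false))

/-- Every `SCX` and `VLX` is set up: for each `r` in `V` there is an `LLX(r)` linked to it. -/
def SetUp : Prop :=
  ∀ t p op, e.act t = .invoke p op → ∀ r ∈ op.deps, ∃ l, e.Linked l t r

/-- At time `s`, an update CAS is performed that belongs to the SCX-record created by the `SCX`
invoked at time `t`. -/
def UpdateCAS (t s : ℕ) : Prop :=
  ∃ q k, e.act s = .run q ∧ ((e.cfg s).procs q).pc = .helpUpdate (e.cfg t).nScx k

/-- Linearization point of the `SCX` invoked at time `t`: the first update CAS performed by one of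
its helpers. -/
def ScxPoint (t s : ℕ) : Prop :=
  (∃ p V R fld new, e.act t = .invoke p (.scx V R fld new)) ∧
    e.UpdateCAS t s ∧ ∀ s' < s, ¬ e.UpdateCAS t s'

/-- Linearization point of an `LLX`, invoked at time `t`, that returns a snapshot: the step at which
it rereads the info field. -/
def SnapshotPoint (t s : ℕ) : Prop :=
  ∃ p r t' vals, e.act t = .invoke p (.llx r) ∧ e.Returns t t' (.snapshot vals) ∧
    t < s ∧ s < t' ∧ e.act s = .run p ∧
    ∃ m₁ rinfo ms, ((e.cfg s).procs p).pc = .llxReread r m₁ rinfo ms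

/-- First constraint on the use of the primitives: if an `SCX(V, R, fld, new)` is linearized, then
`new` is not the initial value of `fld`, and no `SCX(V', R', fld, new)` is linearized before the
linked `LLX(r)` is linearized, where `r` is the Data-record that contains `fld`. -/
def NoABA : Prop :=
  ∀ t s p V R fld new, e.act t = .invoke p (.scx V R fld new) → e.ScxPoint t s →
    ((e.cfg t).recs fld.1).initVals[fld.2]? ≠ some new ∧
    ∀ l sl, e.Linked l t fld.1 → e.SnapshotPoint l sl →
      ∀ t' p' V' R' s', e.act t' = .invoke p' (.scx V' R' fld new) → e.ScxPoint t' s' → ¬ s' < sl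

/-- No user-defined field of any Data-record changes after configuration `C`. -/
def NoChangeAfter (C : ℕ) : Prop :=
  ∀ t ≥ C, ∀ r < (e.cfg t).nRec,
    ((e.cfg (t + 1)).recs r).vals = ((e.cfg t).recs r).vals ∧
    ((e.cfg (t + 1)).recs r).consts = ((e.cfg t).recs r).consts

/-- Second constraint on the use of the primitives: if no field changes after configuration `C`,
then the sequences `V` of all `SCX`s whose linked `LLX`s begin after `C` are consistent with one
total order on the Data-records. -/
def EventuallyOrdered : Prop :=
  ∀ C, e.NoChangeAfter C →
    ∃ lt : RecId → RecId → Prop, IsStrictTotalOrder RecId lt ∧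
      ∀ t p V R fld new, e.act t = .invoke p (.scx V R fld new) →
        (∀ r ∈ V, ∀ l, e.Linked l t r → C ≤ l) → V.Pairwise lt

/-- `e.Visible t r`: by time `t`, the Data-record `r` has become visible to all processes, because
it existed initially or because a pointer to it has been in a field of a visible Data-record. -/
inductive Visible : ℕ → RecId → Prop
  | initial (t : ℕ) (r : RecId) : r < (e.cfg 0).nRec → Visible t r
  | step (s t : ℕ) (r r' : RecId) (v : Val) : s ≤ t → Visible s r' →
      v ∈ ((e.cfg s).recs r').vals ++ ((e.cfg s).recs r').consts → r ∈ refs v → Visible t r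

/-- `LLX` is only invoked on Data-records that the process can have access to: those that it has
created itself and those that have become visible. -/
def LlxAccessible : Prop :=
  ∀ t p r, e.act t = .invoke p (.llx r) →
    e.Visible t r ∨ ∃ s < t, ∃ vals consts, e.act s = .create p vals consts ∧ (e.cfg s).nRec = r

/-! ### Linearizations.  `lin t = some s` means that the operation invoked at time `t` is linearized
at step `s`. -/

/-- A linearization of all successful `LLX`s, `SCX`s and `VLX`s, some non-terminating `SCX`s, and
all reads. -/
structure IsLinearization (lin : ℕ → Option ℕ) : Prop where
  /-- the linearized operation has been invoked, and is linearized between its start and its end -/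
  invoked : ∀ t s, lin t = some s → ∃ p op, e.act t = .invoke p op
  after_start : ∀ t s, lin t = some s → t ≤ s
  before_end : ∀ t s, lin t = some s → ∀ t' resp, e.Returns t t' resp → s ≤ t'
  /-- different operations are linearized at different steps -/
  inj : ∀ t t' s, lin t = some s → lin t' = some s → t = t'
  /-- all successful operations are linearized (reads that terminate count as successful) -/
  complete : ∀ t, e.Succeeds t → (lin t).isSome
  /-- nothing else is linearized, except some non-terminating `SCX`s -/
  sound : ∀ t, (lin t).isSome → e.Succeeds t ∨
    (¬ e.Terminates t ∧ ∃ p V R fld new, e.act t = .invoke p (.scx V R fld new))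
  /-- agreement with the linearization points that the constraint on the use of `SCX` refers to -/
  scx : ∀ t p V R fld new, e.act t = .invoke p (.scx V R fld new) →
    ∀ s, lin t = some s ↔ e.ScxPoint t s
  snapshot : ∀ t s, e.SnapshotPoint t s → lin t = some s

/-- An `SCX` on the mutable field `fld` with new value `new`, invoked at time `t`, is linearized at
step `s`. -/
def LinWrite (lin : ℕ → Option ℕ) (fld : RecId × ℕ) (new : Val) (t s : ℕ) : Prop :=
  lin t = some s ∧ ∃ p V R, e.act t = .invoke p (.scx V R fld new)

/-- `v` is the last value stored in the mutable field `fld` by an `SCX` linearized before step `s`,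
or its initial value if there is no such `SCX`. -/
def LastValue (lin : ℕ → Option ℕ) (fld : RecId × ℕ) (s : ℕ) (v : Val) : Prop :=
  (∃ t' s', s' < s ∧ e.LinWrite lin fld v t' s' ∧
    ∀ t'' s'' v', s' < s'' → s'' < s → ¬ e.LinWrite lin fld v' t'' s'') ∨
  ((∀ t' s' v', s' < s → ¬ e.LinWrite lin fld v' t' s') ∧
    ((e.cfg s).recs fld.1).initVals[fld.2]? = some v)

/-- Each read of a field returns the last value stored in it by an `SCX` linearized before the read,
or its initial value (immutable fields always have their initial values). -/
def C1 (lin : ℕ → Option ℕ) : Prop :=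
  ∀ t p r f s t' v, e.act t = .invoke p (.read r f) → lin t = some s →
    e.Returns t t' (.value v) →
      match f with
      | .mutable i => e.LastValue lin (r, i) s v
      | .immutable i => ((e.cfg t).recs r).consts[i]? = some v

/-- Each linearized `LLX(r)` that does not return `FINALIZED` returns the last value stored in each
mutable field of `r` by an `SCX` linearized before the `LLX`, or its initial value. -/
def C2 (lin : ℕ → Option ℕ) : Prop :=
  ∀ t p r s t' resp, e.act t = .invoke p (.llx r) → lin t = some s → e.Returns t t' resp →
    resp ≠ .finalized →
      ∃ vals, resp = .snapshot vals ∧ vals.length = ((e.cfg t).recs r).vals.length ∧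
        ∀ i v, vals[i]? = some v → e.LastValue lin (r, i) s v

/-- Each linearized `LLX(r)` returns `FINALIZED` if and only if it is linearized after an
`SCX(V, R, fld, new)` with `r` in `R`. -/
def C3 (lin : ℕ → Option ℕ) : Prop :=
  ∀ t p r s t' resp, e.act t = .invoke p (.llx r) → lin t = some s → e.Returns t t' resp →
    (resp = .finalized ↔ ∃ u s' q V R fld new, e.act u = .invoke q (.scx V R fld new) ∧ r ∈ R ∧
      lin u = some s' ∧ s' < s)

/-- For each linearized `SCX` or `VLX` with sequence `V` and each `r` in `V`, no `SCX` with `r` in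
its sequence is linearized between the linked `LLX(r)` and it. -/
def C4 (lin : ℕ → Option ℕ) : Prop :=
  ∀ t p op s, e.act t = .invoke p op → lin t = some s → ∀ r ∈ op.deps, ∀ l, e.Linked l t r →
    ∃ sl, lin l = some sl ∧ sl < s ∧
      ∀ u q V R fld new s', e.act u = .invoke q (.scx V R fld new) → r ∈ V → lin u = some s' →
        ¬ (sl < s' ∧ s' < s)

/-- Each terminating `LLX(r)` returns `FINALIZED` if it begins after the end of a successful
`SCX(V, R, fld, new)` with `r` in `R`, or after another `LLX(r)` has returned `FINALIZED`. -/
def P1 : Prop :=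
  ∀ t p r t' resp, e.act t = .invoke p (.llx r) → e.Returns t t' resp →
    ((∃ u u' q V R fld new, e.act u = .invoke q (.scx V R fld new) ∧ r ∈ R ∧
        e.Returns u u' (.bool true) ∧ u' < t) ∨
      (∃ u u' q, e.act u = .invoke q (.llx r) ∧ e.Returns u u' .finalized ∧ u' < t)) →
    resp = .finalized

/-- If infinitely many of the invocations satisfying `K` are performed, then infinitely many of them
succeed. -/
def Progress (K : Op Val → Prop) : Prop :=
  {t | ∃ p op, e.act t = .invoke p op ∧ K op}.Infinite →
    {t | (∃ p op, e.act t = .invoke p op ∧ K op) ∧ e.Succeeds t}.Infinite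

end Execution

/-- The operation is an `SCX`. -/
def Op.IsScx {Val : Type*} : Op Val → Prop
  | scx _ _ _ _ => True
  | _ => False

/-- The operation is an `SCX` or a `VLX`. -/
def Op.IsScxOrVlx {Val : Type*} : Op Val → Prop
  | scx _ _ _ _ => True
  | vlx _ => True
  | _ => False

/-- The operation is an `LLX`, an `SCX` or a `VLX`. -/
def Op.IsPrimitive {Val : Type*} : Op Val → Prop
  | read _ _ => False
  | _ => True

namespace Execution

variable {P Val : Type*} [DecidableEq P] [DecidableEq Val] [Inhabited Val]
  {refs : Val → Set RecId} (e : Execution P refs)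

/-- If operations (`LLX`, `SCX`, `VLX`) are performed infinitely often, then operations succeed
infinitely often. -/
def P2 : Prop := e.Progress Op.IsPrimitive

/-- If `SCX` and `VLX` operations are performed infinitely often, then `SCX` or `VLX` operations
succeed infinitely often. -/
def P3 : Prop := e.Progress Op.IsScxOrVlx

/-- If `SCX` operations are performed infinitely often, then `SCX` operations succeed infinitely
often. -/
def P4 : Prop := e.Progress Op.IsScx

end Execution

end LLXSCX

open LLXSCX

set_option linter.unusedSectionVars false
set_option linter.unusedSimpArgs false
set_option linter.unnecessarySeqFocus false
set_option linter.unreachableTactic false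
set_option linter.unusedTactic false
set_option linter.unusedVariables false

/-! ### Program counters as a transition relation. -/

namespace LLXSCX

/-! The info field of a record acts as a lock that helpers can complete. An SCX-record `u` enters
`r.info` only by a freezing CAS that expects `infoFields r`, and that pointer was read by a snapshot
taken before `u` was allocated. Since addresses are allocated in increasing order, every change of
an info field strictly increases it (`info_lt_of_change`, `info_mono`). Hence there is no ABA
problem: an info field that is equal at two times is constant in between. Moreover the expected
pointer belongs to an SCX-record that was already committed or aborted, so a record frozen for `u`
cannot be taken away while `u` is in progress (`Reached.done`).

The fate of `u` is governed by two permanent and incompatible facts. Either every record of `V` has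
at some time been frozen for `u` (`Reached`), or some record was changed before `u` could reach it
(`Passed`, `Blocked`). One simultaneous induction over time (`safety`) shows that `allFrozen`
implies the first and `aborted` the second, and that a committed record has been marked and updated.
So at the first update CAS of `u` all records of `V` still point to `u` (`FirstUpdate.info`), and no
other `SCX` on such a record is linearized between the linked snapshot and this CAS
(`no_firstUpdate_between`). This is C4. Together with Constraint A it yields, by induction over
time, that each mutable field holds the last value written by a linearized `SCX` (`lastWritten`):
the first update CAS finds the old value and succeeds, and a later one for the same `SCX` could
succeed only if the old value had been stored again. C1 and C2 follow.

A record is marked only after its finalizing `SCX` has frozen everything, and a snapshot that sees a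
committed SCX-record requires the record to be unmarked afterwards. Thus no snapshot can be based on
a finalizing SCX-record, and the info field of a finalized record never changes again
(`info_eq_of_allFrozen`). This gives C3 and P1.

For progress, an `LLX` is linked to at most one `SCX` or failing `VLX` (`infinite_of_linked`), and
each process has at most one operation that never ends. If there are finitely many `SCX`s, then info
fields, marks and states eventually stand still, so no `LLX` that starts later fails and no `VLX`
with later linked `LLX`s fails. This settles P2, and P3 unless there are infinitely many `SCX`s. If
infinitely many `SCX`s are performed but finitely many succeed, the fields stop changing and
Constraint B supplies an order in which almost all `SCX`s freeze their records. A record that blocks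
infinitely many `SCX`s has an info field that changes infinitely often. So infinitely many `SCX`s
freeze it and then fail at a larger record, and infinitely many of them at the same one, since only
records that exist when the fields stop changing can block (`BlockedAt.lt_nRec`). Climbing forever
in a finite set is impossible, which proves P4 and the rest of P3. -/

/-- Program counter of a process after its call of `Help` with continuation `k` has returned `b`. -/
def Cont.retPC {Val : Type*} : Cont → Bool → PC Val
  | .scx, b => .ret (.bool b)
  | .llxTest r m₁, b => if b && m₁ then .ret .finalized else .llxFail₁ r
  | .llxFail, _ => .ret .fail

theorem Cont.retPC_cases {Val : Type*} (k : Cont) (b : Bool) :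
    (k = .scx ∧ k.retPC b = (.ret (.bool b) : PC Val)) ∨
      (∃ r, k = .llxTest r true ∧ b = true ∧ k.retPC b = (.ret .finalized : PC Val)) ∨
      (∃ r m₁, k = .llxTest r m₁ ∧ (b && m₁) = false ∧ k.retPC b = (.llxFail₁ r : PC Val)) ∨
      (k = .llxFail ∧ k.retPC b = (.ret .fail : PC Val)) := by
  rcases k with _ | ⟨r, m⟩ | _
  · simp [Cont.retPC]
  · cases b <;> cases m <;> simp [Cont.retPC]
  · simp [Cont.retPC]

/-- Transitions of the program counter of a process with local table `tab`. -/
inductive PCStep {P Val : Type*} [Inhabited Val] (c : Config P Val) (tab : RecId → ScxPtr × List Val) :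
    PC Val → PC Val → Prop
  | llxMarked₁ (r) : PCStep c tab (.llxMarked₁ r) (.llxInfo r (c.recs r).marked)
  | llxInfo (r m) : PCStep c tab (.llxInfo r m) (.llxState r m (c.recs r).info)
  | llxState (r m u) : PCStep c tab (.llxState r m u) (.llxMarked₂ r m u (c.scxs u).state)
  | unfrozen (r m u st) (h : st = .aborted ∨ (st = .committed ∧ (c.recs r).marked = false)) :
      PCStep c tab (.llxMarked₂ r m u st) (.llxCollect r m u [])
  | frozen (r m u st) (h : ¬ (st = .aborted ∨ (st = .committed ∧ (c.recs r).marked = false))) :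
      PCStep c tab (.llxMarked₂ r m u st) (.llxTest₁ r m u)
  | collect (r m u ms v) (h : (c.recs r).vals[ms.length]? = some v) :
      PCStep c tab (.llxCollect r m u ms) (.llxCollect r m u (ms ++ [v]))
  | collected (r m u ms) (h : (c.recs r).vals[ms.length]? = none) :
      PCStep c tab (.llxCollect r m u ms) (.llxReread r m u ms)
  | snapshot (r m u ms) (h : (c.recs r).info = u) :
      PCStep c tab (.llxReread r m u ms) (.ret (.snapshot ms))
  | changed (r m u ms) (h : (c.recs r).info ≠ u) :
      PCStep c tab (.llxReread r m u ms) (.llxTest₁ r m u)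
  | finalized (r u) (h : (c.scxs u).state = .committed) :
      PCStep c tab (.llxTest₁ r true u) (.ret .finalized)
  | unmarked (r u) (h : (c.scxs u).state = .committed) :
      PCStep c tab (.llxTest₁ r false u) (.llxFail₁ r)
  | uncommitted (r m u) (h : (c.scxs u).state ≠ .committed) :
      PCStep c tab (.llxTest₁ r m u) (.llxTest₂ r m u)
  | testHelp (r m u) (h : (c.scxs u).state = .inProgress) :
      PCStep c tab (.llxTest₂ r m u) (.helpFreeze u (c.scxs u).V (.llxTest r m))
  | aborted (r m u) (h : (c.scxs u).state ≠ .inProgress) :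
      PCStep c tab (.llxTest₂ r m u) (.llxFail₁ r)
  | llxFail₁ (r) : PCStep c tab (.llxFail₁ r) (.llxFail₂ r (c.recs r).info)
  | inProgress (r q) (h : (c.scxs q).state = .inProgress) :
      PCStep c tab (.llxFail₂ r q) (.llxFail₃ r)
  | llxFail (r q) (h : (c.scxs q).state ≠ .inProgress) :
      PCStep c tab (.llxFail₂ r q) (.ret .fail)
  | failHelp (r) :
      PCStep c tab (.llxFail₃ r) (.helpFreeze (c.recs r).info (c.scxs (c.recs r).info).V .llxFail)
  | allFrozen (u k) : PCStep c tab (.helpFreeze u [] k) (.helpFrozen u k)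
  | freeze (u r rs k) (h : (c.recs r).info = (c.scxs u).infoFields r) :
      PCStep c tab (.helpFreeze u (r :: rs) k) (.helpFreeze u rs k)
  | freezeFail (u r rs k) (h : (c.recs r).info ≠ (c.scxs u).infoFields r) :
      PCStep c tab (.helpFreeze u (r :: rs) k) (.helpCheck u r rs k)
  | checkOK (u r rs k) (h : (c.recs r).info = u) :
      PCStep c tab (.helpCheck u r rs k) (.helpFreeze u rs k)
  | checkFail (u r rs k) (h : (c.recs r).info ≠ u) :
      PCStep c tab (.helpCheck u r rs k) (.helpFrozenCheck u k)
  | frozenCheck (u k) (h : (c.scxs u).allFrozen = true) :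
      PCStep c tab (.helpFrozenCheck u k) (k.retPC true)
  | toAbort (u k) (h : (c.scxs u).allFrozen = false) :
      PCStep c tab (.helpFrozenCheck u k) (.helpAbort u k)
  | helpAbort (u k) : PCStep c tab (.helpAbort u k) (k.retPC false)
  | helpFrozen (u k) : PCStep c tab (.helpFrozen u k) (.helpMark u (c.scxs u).R k)
  | marked (u k) : PCStep c tab (.helpMark u [] k) (.helpUpdate u k)
  | helpMark (u r rs k) : PCStep c tab (.helpMark u (r :: rs) k) (.helpMark u rs k)
  | helpUpdate (u k) : PCStep c tab (.helpUpdate u k) (.helpCommit u k)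
  | helpCommit (u k) : PCStep c tab (.helpCommit u k) (k.retPC true)
  | vlxTrue : PCStep c tab (.vlx []) (.ret (.bool true))
  | vlx (r rs) (h : (tab r).1 = (c.recs r).info) : PCStep c tab (.vlx (r :: rs)) (.vlx rs)
  | vlxFalse (r rs) (h : (tab r).1 ≠ (c.recs r).info) :
      PCStep c tab (.vlx (r :: rs)) (.ret (.bool false))
  | read (r f) :
      PCStep c tab (.read r f) (.ret (.value ((c.fieldValue? r f).getD default)))
  | ret (x) : PCStep c tab (.ret x) .idle

/-- Program counter of a process that has just invoked an operation. -/
def Op.startPC {P Val : Type*} (c : Config P Val) : Op Val → PC Val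
  | .llx r => .llxMarked₁ r
  | .scx V _ _ _ => .helpFreeze c.nScx V .scx
  | .vlx V => .vlx V
  | .read r f => .read r f

theorem PCStep.to_idle {P Val : Type*} [Inhabited Val] {c : Config P Val} {tab pc pc'}
    (h : PCStep c tab pc pc') (h' : pc' = .idle) : ∃ x, pc = .ret x := by
  cases h
  case ret x => exact ⟨x, rfl⟩
  case frozenCheck u k h => rcases k.retPC_cases (Val := Val) true with ⟨_, h⟩ | ⟨_, _, _, h⟩ | ⟨_, _, _, _, h⟩ | ⟨_, h⟩ <;> simp_all
  case helpCommit u k => rcases k.retPC_cases (Val := Val) true with ⟨_, h⟩ | ⟨_, _, _, h⟩ | ⟨_, _, _, _, h⟩ | ⟨_, h⟩ <;> simp_all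
  case helpAbort u k => rcases k.retPC_cases (Val := Val) false with ⟨_, h⟩ | ⟨_, _, _, h⟩ | ⟨_, _, _, _, h⟩ | ⟨_, h⟩ <;> simp_all
  all_goals cases h'

theorem PCStep.of_ret {P Val : Type*} [Inhabited Val] {c : Config P Val} {tab pc pc' x}
    (h : PCStep c tab pc pc') (h' : pc = .ret x) : pc' = .idle := by
  cases h <;> first | rfl | cases h'

/-! ### Effect of one process step on the shared memory. -/

namespace Config

variable {P Val : Type*} [DecidableEq P]

@[simp] theorem helpReturn_scxs (c : Config P Val) (p k b) : (c.helpReturn p k b).scxs = c.scxs := by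
  cases k <;> simp only [helpReturn, setPC] <;> split <;> rfl

theorem helpReturn_eq (c : Config P Val) (p k b) : c.helpReturn p k b = c.setPC p (k.retPC b) := by
  cases k <;> simp only [helpReturn, Cont.retPC] <;> split <;> rfl

@[simp] theorem casInfo_procs (c : Config P Val) (r a b) : (c.casInfo r a b).procs = c.procs := by
  unfold casInfo; split <;> rfl

@[simp] theorem casInfo_nRec (c : Config P Val) (r a b) : (c.casInfo r a b).nRec = c.nRec := by
  unfold casInfo; split <;> rfl

@[simp] theorem casInfo_scxs (c : Config P Val) (r a b) : (c.casInfo r a b).scxs = c.scxs := by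
  unfold casInfo; split <;> rfl

@[simp] theorem casInfo_nScx (c : Config P Val) (r a b) : (c.casInfo r a b).nScx = c.nScx := by
  unfold casInfo; split <;> rfl

variable [DecidableEq Val]

@[simp] theorem casField_procs (c : Config P Val) (f a b) : (c.casField f a b).procs = c.procs := by
  unfold casField; split <;> rfl

@[simp] theorem casField_nRec (c : Config P Val) (f a b) : (c.casField f a b).nRec = c.nRec := by
  unfold casField; split <;> rfl

@[simp] theorem casField_scxs (c : Config P Val) (f a b) : (c.casField f a b).scxs = c.scxs := by
  unfold casField; split <;> rfl

@[simp] theorem casField_nScx (c : Config P Val) (f a b) : (c.casField f a b).nScx = c.nScx := by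
  unfold casField; split <;> rfl

variable [Inhabited Val]

/-- Turns the step function into the relation `PCStep`, so that invariants about program counters
can be proved by cases on named transitions. -/
theorem runStep_pcStep (c : Config P Val) (p : P) (h : (c.procs p).pc ≠ .idle) :
    PCStep c (c.procs p).table (c.procs p).pc ((c.runStep p).procs p).pc := by
  unfold runStep
  split <;> rename_i hpc
  all_goals (try split) <;> (try split)
  all_goals
    simp only [setPC, setTable, setRec, setScx, callHelp, helpReturn_eq, hpc, Function.update_self]
  all_goals first
    | exact absurd hpc h
    | (simp_all; constructor; done)
    | (simp_all; constructor <;> simp_all; done)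
    | skip

theorem runStep_procs_of_ne (c : Config P Val) {p q : P} (h : q ≠ p) :
    (c.runStep p).procs q = c.procs q := by
  unfold runStep
  split
  all_goals (try split) <;> (try split)
  all_goals
    simp [setPC, setTable, setRec, setScx, callHelp, helpReturn_eq, h]

@[simp] theorem runStep_nRec (c : Config P Val) (p : P) : (c.runStep p).nRec = c.nRec := by
  unfold runStep
  split
  all_goals (try split) <;> (try split)
  all_goals
    simp [setPC, setTable, setRec, setScx, callHelp, helpReturn_eq]

@[simp] theorem runStep_nScx (c : Config P Val) (p : P) : (c.runStep p).nScx = c.nScx := by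
  unfold runStep
  split
  all_goals (try split) <;> (try split)
  all_goals
    simp [setPC, setTable, setRec, setScx, callHelp, helpReturn_eq]

theorem runStep_initVals (c : Config P Val) (p : P) (r) :
    ((c.runStep p).recs r).initVals = (c.recs r).initVals := by
  unfold runStep
  split
  all_goals (try split) <;> (try split)
  all_goals
    simp [setPC, setTable, setRec, setScx, callHelp, helpReturn_eq, casInfo, casField]
  all_goals (try split_ifs) <;> simp [Function.update_apply] <;> grind

theorem runStep_consts (c : Config P Val) (p : P) (r) :
    ((c.runStep p).recs r).consts = (c.recs r).consts := by
  unfold runStep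
  split
  all_goals (try split) <;> (try split)
  all_goals
    simp [setPC, setTable, setRec, setScx, callHelp, helpReturn_eq, casInfo, casField]
  all_goals (try split_ifs) <;> simp [Function.update_apply] <;> grind

/-- This and the analogous lemmas for `marked`, `vals`, `state` and `allFrozen` trace a change of a
shared word back to the only kinds of step that can cause it. All later invariants of the memory
rest on these inversions. -/
theorem runStep_info (c : Config P Val) (p : P) (r) :
    ((c.runStep p).recs r).info = (c.recs r).info ∨
      ∃ u rs k, (c.procs p).pc = .helpFreeze u (r :: rs) k ∧
        (c.recs r).info = (c.scxs u).infoFields r ∧ ((c.runStep p).recs r).info = u := by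
  unfold runStep
  split <;> rename_i hpc
  all_goals (try split) <;> (try split)
  all_goals
    simp [setPC, setTable, setRec, setScx, callHelp, helpReturn_eq, casInfo, casField]
  all_goals (try split_ifs) <;> simp [Function.update_apply] <;> grind

theorem runStep_marked (c : Config P Val) (p : P) (r) :
    ((c.runStep p).recs r).marked = (c.recs r).marked ∨
      ∃ u rs k, (c.procs p).pc = .helpMark u (r :: rs) k ∧
        ((c.runStep p).recs r).marked = true := by
  unfold runStep
  split <;> rename_i hpc
  all_goals (try split) <;> (try split)
  all_goals
    simp [setPC, setTable, setRec, setScx, callHelp, helpReturn_eq, casInfo, casField]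
  all_goals (try split_ifs) <;> simp [Function.update_apply] <;> grind

theorem runStep_marked_of_helpMark (c : Config P Val) {p : P} {u r rs k}
    (h : (c.procs p).pc = .helpMark u (r :: rs) k) :
    ((c.runStep p).recs r).marked = true := by
  simp [runStep, h, setPC, setRec]

theorem runStep_vals (c : Config P Val) (p : P) (r) :
    ((c.runStep p).recs r).vals = (c.recs r).vals ∨
      ∃ u k, (c.procs p).pc = .helpUpdate u k ∧ (c.scxs u).fld.1 = r ∧
        (c.recs r).vals[(c.scxs u).fld.2]? = some (c.scxs u).old ∧
        ((c.runStep p).recs r).vals = (c.recs r).vals.set (c.scxs u).fld.2 (c.scxs u).new := by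
  unfold runStep
  split <;> rename_i hpc
  all_goals (try split) <;> (try split)
  all_goals
    simp [setPC, setTable, setRec, setScx, callHelp, helpReturn_eq, casInfo, casField]
  all_goals (try split_ifs) <;> simp [Function.update_apply] <;> grind

theorem runStep_vals_of_helpUpdate (c : Config P Val) {p : P} {u k}
    (h : (c.procs p).pc = .helpUpdate u k)
    (h' : (c.recs (c.scxs u).fld.1).vals[(c.scxs u).fld.2]? = some (c.scxs u).old) :
    ((c.runStep p).recs (c.scxs u).fld.1).vals =
      (c.recs (c.scxs u).fld.1).vals.set (c.scxs u).fld.2 (c.scxs u).new := by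
  simp [runStep, h, setPC, setRec, casField, h']

/-- The contents of an SCX-record that never change. -/
structure SameData (x y : ScxRec Val) : Prop where
  V : x.V = y.V
  R : x.R = y.R
  fld : x.fld = y.fld
  new : x.new = y.new
  old : x.old = y.old
  infoFields : x.infoFields = y.infoFields

theorem runStep_sameData (c : Config P Val) (p : P) (u) :
    SameData ((c.runStep p).scxs u) (c.scxs u) := by
  unfold runStep
  split <;> rename_i hpc
  all_goals (try split) <;> (try split)
  all_goals
    try simp [setPC, setTable, setRec, setScx, callHelp, helpReturn_eq, Function.update_apply]
  all_goals (try split_ifs) <;> constructor <;> simp_all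

theorem runStep_state (c : Config P Val) (p : P) (u) :
    ((c.runStep p).scxs u).state = (c.scxs u).state ∨
      (∃ k, (c.procs p).pc = .helpAbort u k ∧ ((c.runStep p).scxs u).state = .aborted) ∨
      (∃ k, (c.procs p).pc = .helpCommit u k ∧ ((c.runStep p).scxs u).state = .committed) := by
  unfold runStep
  split <;> rename_i hpc
  all_goals (try split) <;> (try split)
  all_goals
    simp [setPC, setTable, setRec, setScx, callHelp, helpReturn_eq, Function.update_apply]
  all_goals (try split_ifs) <;> simp [Function.update_apply] <;> grind

theorem runStep_state_of_helpAbort (c : Config P Val) {p : P} {u k}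
    (h : (c.procs p).pc = .helpAbort u k) : ((c.runStep p).scxs u).state = .aborted := by
  simp [runStep, h, setScx]

theorem runStep_state_of_helpCommit (c : Config P Val) {p : P} {u k}
    (h : (c.procs p).pc = .helpCommit u k) : ((c.runStep p).scxs u).state = .committed := by
  simp [runStep, h, setScx]

theorem runStep_allFrozen (c : Config P Val) (p : P) (u) :
    ((c.runStep p).scxs u).allFrozen = (c.scxs u).allFrozen ∨
      (∃ k, (c.procs p).pc = .helpFrozen u k ∧ ((c.runStep p).scxs u).allFrozen = true) := by
  unfold runStep
  split <;> rename_i hpc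
  all_goals (try split) <;> (try split)
  all_goals
    simp [setPC, setTable, setRec, setScx, callHelp, helpReturn_eq, Function.update_apply]
  all_goals (try split_ifs) <;> simp [Function.update_apply] <;> grind

theorem runStep_allFrozen_of_helpFrozen (c : Config P Val) {p : P} {u k}
    (h : (c.procs p).pc = .helpFrozen u k) : ((c.runStep p).scxs u).allFrozen = true := by
  simp [runStep, h, setScx, setPC]

theorem runStep_info_of_helpFreeze (c : Config P Val) {p : P} {u r rs k}
    (h : (c.procs p).pc = .helpFreeze u (r :: rs) k)
    (h' : (c.recs r).info = (c.scxs u).infoFields r) : ((c.runStep p).recs r).info = u := by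
  simp [runStep, h, h', setRec, setPC, casInfo]

theorem runStep_table (c : Config P Val) (p : P) :
    ((c.runStep p).procs p).table = (c.procs p).table ∨
      (∃ r m u ms, (c.procs p).pc = .llxReread r m u ms ∧
        ((c.runStep p).procs p).table = Function.update (c.procs p).table r (u, ms)) := by
  unfold runStep
  split <;> rename_i hpc
  all_goals (try split) <;> (try split)
  all_goals
    simp [setPC, setTable, setRec, setScx, callHelp, helpReturn_eq, Function.update_apply, -Bool.exists_bool]
  all_goals grind

theorem runStep_table_of_llxReread (c : Config P Val) {p : P} {r m u ms}
    (h : (c.procs p).pc = .llxReread r m u ms) (h' : (c.recs r).info = u) :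
    ((c.runStep p).procs p).table = Function.update (c.procs p).table r (u, ms) := by
  simp [runStep, h, setTable, setPC, h']

end Config

/-! ### Executions: change in one step, monotone quantities, operations in progress. -/

namespace Execution

variable {P Val : Type*} [DecidableEq P] [DecidableEq Val] [Inhabited Val]
  {refs : Val → Set RecId} (e : Execution P refs)

theorem next_invoke {t p op} (h : e.act t = .invoke p op) :
    e.cfg (t + 1) = (e.cfg t).start p op := by rw [e.next, h]; rfl

theorem next_run {t p} (h : e.act t = .run p) :
    e.cfg (t + 1) = (e.cfg t).runStep p := by rw [e.next, h]; rfl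

theorem next_create {t p vals consts} (h : e.act t = .create p vals consts) :
    e.cfg (t + 1) = { e.cfg t with
        nRec := (e.cfg t).nRec + 1
        recs := Function.update (e.cfg t).recs (e.cfg t).nRec
          { initVals := vals, vals := vals, consts := consts, info := 0, marked := false } } := by
  rw [e.next, h]; rfl

theorem next_none {t} (h : e.act t = .none) : e.cfg (t + 1) = e.cfg t := by rw [e.next, h]; rfl

theorem start_recs (c : Config P Val) (p) (op : Op Val) : (c.start p op).recs = c.recs := by
  cases op <;> rfl

theorem start_nRec (c : Config P Val) (p) (op : Op Val) : (c.start p op).nRec = c.nRec := by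
  cases op <;> rfl

theorem recs_succ {t r} (hr : r < (e.cfg t).nRec) :
    (∃ p, e.act t = .run p ∧ (e.cfg (t + 1)).recs r = ((e.cfg t).runStep p).recs r) ∨
      (e.cfg (t + 1)).recs r = (e.cfg t).recs r := by
  rcases ha : e.act t with _ | ⟨p, vals, consts⟩ | ⟨p, op⟩ | p
  · right; rw [e.next_none ha]
  · right; rw [e.next_create ha]; simp [hr.ne]
  · right; rw [e.next_invoke ha, start_recs]
  · left; exact ⟨p, rfl, by rw [e.next_run ha]⟩

theorem info_succ {t r} (hr : r < (e.cfg t).nRec) :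
    ((e.cfg (t + 1)).recs r).info = ((e.cfg t).recs r).info ∨
      ∃ p u rs k, e.act t = .run p ∧ ((e.cfg t).procs p).pc = .helpFreeze u (r :: rs) k ∧
        ((e.cfg t).recs r).info = ((e.cfg t).scxs u).infoFields r ∧
        ((e.cfg (t + 1)).recs r).info = u := by
  rcases e.recs_succ hr with ⟨p, ha, h⟩ | h
  · rw [h]
    rcases (e.cfg t).runStep_info p r with h1 | ⟨u, rs, k, h1⟩
    · exact .inl h1
    · exact .inr ⟨p, u, rs, k, ha, h1⟩
  · rw [h]; exact .inl rfl

theorem marked_succ {t r} (hr : r < (e.cfg t).nRec) :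
    ((e.cfg (t + 1)).recs r).marked = ((e.cfg t).recs r).marked ∨
      ∃ p u rs k, e.act t = .run p ∧ ((e.cfg t).procs p).pc = .helpMark u (r :: rs) k ∧
        ((e.cfg (t + 1)).recs r).marked = true := by
  rcases e.recs_succ hr with ⟨p, ha, h⟩ | h
  · rw [h]
    rcases (e.cfg t).runStep_marked p r with h1 | ⟨u, rs, k, h1⟩
    · exact .inl h1
    · exact .inr ⟨p, u, rs, k, ha, h1⟩
  · rw [h]; exact .inl rfl

theorem vals_succ {t r} (hr : r < (e.cfg t).nRec) :
    ((e.cfg (t + 1)).recs r).vals = ((e.cfg t).recs r).vals ∨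
      ∃ p u k, e.act t = .run p ∧ ((e.cfg t).procs p).pc = .helpUpdate u k ∧
        ((e.cfg t).scxs u).fld.1 = r ∧
        ((e.cfg t).recs r).vals[((e.cfg t).scxs u).fld.2]? = some ((e.cfg t).scxs u).old ∧
        ((e.cfg (t + 1)).recs r).vals =
          ((e.cfg t).recs r).vals.set ((e.cfg t).scxs u).fld.2 ((e.cfg t).scxs u).new := by
  rcases e.recs_succ hr with ⟨p, ha, h⟩ | h
  · rw [h]
    rcases (e.cfg t).runStep_vals p r with h1 | ⟨u, k, h1⟩
    · exact .inl h1
    · exact .inr ⟨p, u, k, ha, h1⟩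
  · rw [h]; exact .inl rfl

theorem initVals_succ {t r} (hr : r < (e.cfg t).nRec) :
    ((e.cfg (t + 1)).recs r).initVals = ((e.cfg t).recs r).initVals := by
  rcases e.recs_succ hr with ⟨p, ha, h⟩ | h <;> rw [h]
  exact Config.runStep_initVals ..

theorem consts_succ {t r} (hr : r < (e.cfg t).nRec) :
    ((e.cfg (t + 1)).recs r).consts = ((e.cfg t).recs r).consts := by
  rcases e.recs_succ hr with ⟨p, ha, h⟩ | h <;> rw [h]
  exact Config.runStep_consts ..

theorem nRec_succ (t) : (e.cfg (t + 1)).nRec = (e.cfg t).nRec ∨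
    ∃ p vals consts, e.act t = .create p vals consts ∧ (e.cfg (t + 1)).nRec = (e.cfg t).nRec + 1 ∧
      (e.cfg (t + 1)).recs (e.cfg t).nRec =
        { initVals := vals, vals := vals, consts := consts, info := 0, marked := false } := by
  rcases ha : e.act t with _ | ⟨p, vals, consts⟩ | ⟨p, op⟩ | p
  · left; rw [e.next_none ha]
  · right; refine ⟨p, vals, consts, rfl, ?_⟩; rw [e.next_create ha]; simp
  · left; rw [e.next_invoke ha, start_nRec]
  · left; rw [e.next_run ha]; simp

theorem nRec_mono : Monotone fun t => (e.cfg t).nRec :=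
  monotone_nat_of_le_succ fun t => by
    rcases e.nRec_succ t with h | ⟨_, _, _, _, h, _⟩ <;> simp only [h] <;> omega

theorem nScx_succ (t) : (e.cfg (t + 1)).nScx = (e.cfg t).nScx ∨
    ∃ p V R fld new, e.act t = .invoke p (.scx V R fld new) ∧
      (e.cfg (t + 1)).nScx = (e.cfg t).nScx + 1 ∧
      (e.cfg (t + 1)).scxs (e.cfg t).nScx =
        { V := V, R := R, fld := fld, new := new
          old := (((e.cfg t).procs p).table fld.1).2.getD fld.2 default
          state := .inProgress, allFrozen := false
          infoFields := fun r => (((e.cfg t).procs p).table r).1 } := by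
  rcases ha : e.act t with _ | ⟨p, vals, consts⟩ | ⟨p, op⟩ | p
  · left; rw [e.next_none ha]
  · left; rw [e.next_create ha]
  · rw [e.next_invoke ha]
    rcases op with r | ⟨V, R, fld, new⟩ | V | ⟨r, f⟩
    · left; rfl
    · right; exact ⟨p, V, R, fld, new, rfl, rfl, by simp [Config.start, Config.callHelp, Config.setPC]⟩
    · left; rfl
    · left; rfl
  · left; rw [e.next_run ha]; simp

theorem nScx_invoke_scx {t p V R fld new} (h : e.act t = .invoke p (.scx V R fld new)) :
    (e.cfg (t + 1)).nScx = (e.cfg t).nScx + 1 := by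
  rw [e.next_invoke h]; rfl

theorem nScx_mono : Monotone fun t => (e.cfg t).nScx :=
  monotone_nat_of_le_succ fun t => by
    rcases e.nScx_succ t with h | ⟨_, _, _, _, _, _, h, _⟩ <;> simp only [h] <;> omega

theorem nScx_pos (t) : 0 < (e.cfg t).nScx := by
  have := e.nScx_mono (Nat.zero_le t)
  simp only [e.initial.nScx] at this
  exact this

theorem scxs_succ {t u} (hu : u < (e.cfg t).nScx) :
    (∃ p, e.act t = .run p ∧ (e.cfg (t + 1)).scxs u = ((e.cfg t).runStep p).scxs u) ∨
      (e.cfg (t + 1)).scxs u = (e.cfg t).scxs u := by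
  rcases ha : e.act t with _ | ⟨p, vals, consts⟩ | ⟨p, op⟩ | p
  · right; rw [e.next_none ha]
  · right; rw [e.next_create ha]
  · right; rw [e.next_invoke ha]
    rcases op with r | ⟨V, R, fld, new⟩ | V | ⟨r, f⟩ <;> try rfl
    simp [Config.start, Config.callHelp, Config.setPC, hu.ne]
  · left; exact ⟨p, rfl, by rw [e.next_run ha]⟩

theorem sameData_succ {t u} (hu : u < (e.cfg t).nScx) :
    Config.SameData ((e.cfg (t + 1)).scxs u) ((e.cfg t).scxs u) := by
  rcases e.scxs_succ hu with ⟨p, ha, h⟩ | h <;> rw [h]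
  · exact Config.runStep_sameData ..
  · constructor <;> rfl

theorem state_succ {t u} (hu : u < (e.cfg t).nScx) :
    ((e.cfg (t + 1)).scxs u).state = ((e.cfg t).scxs u).state ∨
      (∃ p k, e.act t = .run p ∧ ((e.cfg t).procs p).pc = .helpAbort u k ∧
        ((e.cfg (t + 1)).scxs u).state = .aborted) ∨
      (∃ p k, e.act t = .run p ∧ ((e.cfg t).procs p).pc = .helpCommit u k ∧
        ((e.cfg (t + 1)).scxs u).state = .committed) := by
  rcases e.scxs_succ hu with ⟨p, ha, h⟩ | h <;> rw [h]
  · rcases (e.cfg t).runStep_state p u with h1 | ⟨k, h1⟩ | ⟨k, h1⟩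
    · exact .inl h1
    · exact .inr (.inl ⟨p, k, ha, h1⟩)
    · exact .inr (.inr ⟨p, k, ha, h1⟩)
  · exact .inl rfl

theorem allFrozen_succ {t u} (hu : u < (e.cfg t).nScx) :
    ((e.cfg (t + 1)).scxs u).allFrozen = ((e.cfg t).scxs u).allFrozen ∨
      (∃ p k, e.act t = .run p ∧ ((e.cfg t).procs p).pc = .helpFrozen u k ∧
        ((e.cfg (t + 1)).scxs u).allFrozen = true) := by
  rcases e.scxs_succ hu with ⟨p, ha, h⟩ | h <;> rw [h]
  · rcases (e.cfg t).runStep_allFrozen p u with h1 | ⟨k, h1⟩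
    · exact .inl h1
    · exact .inr ⟨p, k, ha, h1⟩
  · exact .inl rfl

theorem start_procs_of_ne (c : Config P Val) {p q} (h : q ≠ p) (op : Op Val) :
    (c.start p op).procs q = c.procs q := by
  cases op <;> simp [Config.start, Config.callHelp, Config.setPC, h]

theorem start_table (c : Config P Val) (p q) (op : Op Val) :
    ((c.start p op).procs q).table = (c.procs q).table := by
  by_cases h : q = p
  · subst h
    cases op <;> simp [Config.start, Config.callHelp, Config.setPC]
  · rw [start_procs_of_ne c h]

theorem start_pc (c : Config P Val) (p) (op : Op Val) :
    ((c.start p op).procs p).pc = op.startPC c := by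
  cases op <;> simp [Config.start, Config.callHelp, Config.setPC, Op.startPC]

/-- The three ways in which the program counter of `p` can evolve in one step. -/
theorem pc_succ (t p) :
    (((e.cfg (t + 1)).procs p = (e.cfg t).procs p) ∧ e.act t ≠ .run p ∧
        ∀ op, e.act t ≠ .invoke p op) ∨
      (e.act t = .run p ∧ ((e.cfg t).procs p).pc ≠ .idle ∧
        PCStep (e.cfg t) ((e.cfg t).procs p).table ((e.cfg t).procs p).pc
          ((e.cfg (t + 1)).procs p).pc) ∨
      (∃ op, e.act t = .invoke p op ∧ ((e.cfg t).procs p).pc = .idle ∧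
        ((e.cfg (t + 1)).procs p).pc = op.startPC (e.cfg t) ∧ (e.cfg t).OpOK refs op) := by
  have hen := e.enabled t
  rcases ha : e.act t with _ | ⟨q, vals, consts⟩ | ⟨q, op⟩ | q <;> rw [ha] at hen
  · left; rw [e.next_none ha]; simp
  · left; rw [e.next_create ha]; simp
  · by_cases hq : q = p
    · subst hq
      right; right
      refine ⟨op, rfl, hen.1, ?_, hen.2⟩
      rw [e.next_invoke ha, start_pc]
    · left
      rw [e.next_invoke ha, start_procs_of_ne _ (Ne.symm hq)]
      simp [hq]
  · by_cases hq : q = p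
    · subst hq
      right; left
      refine ⟨rfl, hen, ?_⟩
      rw [e.next_run ha]
      exact (e.cfg t).runStep_pcStep q hen
    · left
      rw [e.next_run ha, Config.runStep_procs_of_ne _ (Ne.symm hq)]
      simp [hq]

theorem table_succ (t p) :
    ((e.cfg (t + 1)).procs p).table = ((e.cfg t).procs p).table ∨
      ∃ r m u ms, e.act t = .run p ∧ ((e.cfg t).procs p).pc = .llxReread r m u ms ∧
        ((e.cfg (t + 1)).procs p).table =
          Function.update ((e.cfg t).procs p).table r (u, ms) := by
  rcases ha : e.act t with _ | ⟨q, vals, consts⟩ | ⟨q, op⟩ | q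
  · left; rw [e.next_none ha]
  · left; rw [e.next_create ha]
  · left; rw [e.next_invoke ha, start_table]
  · by_cases hq : q = p
    · subst hq
      rw [e.next_run ha]
      rcases (e.cfg t).runStep_table q with h | ⟨r, m, u, ms, h⟩
      · exact .inl h
      · exact .inr ⟨r, m, u, ms, rfl, h⟩
    · left
      rw [e.next_run ha, Config.runStep_procs_of_ne _ (Ne.symm hq)]

theorem invoke_pc {t p op} (h : e.act t = .invoke p op) :
    ((e.cfg (t + 1)).procs p).pc = op.startPC (e.cfg t) := by
  rw [e.next_invoke h, start_pc]

theorem invoke_idle {t p op} (h : e.act t = .invoke p op) :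
    ((e.cfg t).procs p).pc = .idle := by
  have := e.enabled t; rw [h] at this; exact this.1

theorem invoke_ok {t p op} (h : e.act t = .invoke p op) : (e.cfg t).OpOK refs op := by
  have := e.enabled t; rw [h] at this; exact this.2

/-! ### Monotone quantities -/

/-- The immutable contents of SCX-record `u`, as given at its creation. -/
noncomputable def data (u : ScxPtr) : ScxRec Val :=
  (e.cfg (sInf {t | u < (e.cfg t).nScx})).scxs u

theorem sameData_of_le {t t' u} (hu : u < (e.cfg t).nScx) (h : t ≤ t') :
    Config.SameData ((e.cfg t').scxs u) ((e.cfg t).scxs u) := by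
  induction t', h using Nat.le_induction with
  | base => constructor <;> rfl
  | succ s hs ih =>
    have := e.sameData_succ (hu.trans_le (e.nScx_mono hs))
    exact ⟨this.V.trans ih.V, this.R.trans ih.R, this.fld.trans ih.fld, this.new.trans ih.new,
      this.old.trans ih.old, this.infoFields.trans ih.infoFields⟩

theorem sameData {t u} (hu : u < (e.cfg t).nScx) :
    Config.SameData ((e.cfg t).scxs u) (e.data u) :=
  e.sameData_of_le (Nat.sInf_mem (s := {t | u < (e.cfg t).nScx}) ⟨t, hu⟩) (Nat.sInf_le hu)

theorem data_of_invoke {t p V R fld new} (h : e.act t = .invoke p (.scx V R fld new)) :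
    Config.SameData
      { V := V, R := R, fld := fld, new := new
        old := (((e.cfg t).procs p).table fld.1).2.getD fld.2 default
        state := .inProgress, allFrozen := false
        infoFields := fun r => (((e.cfg t).procs p).table r).1 } (e.data (e.cfg t).nScx) := by
  have h1 := e.nScx_invoke_scx h
  have h2 := e.sameData (t := t + 1) (u := (e.cfg t).nScx) (by omega)
  rcases e.nScx_succ t with h3 | ⟨p', V', R', fld', new', h3, _, h4⟩
  · omega
  · rw [h] at h3; cases h3; rwa [h4] at h2

/-- Addresses come from a counter, so a nonzero address of an SCX-record stands for exactly one
invocation of `SCX`; see also `invoke_scx_unique`. Everything known when `u` was created is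
recovered in this way. -/
theorem exists_invoke {t u} (h0 : u ≠ 0) (hu : u < (e.cfg t).nScx) :
    ∃ s < t, ∃ p V R fld new, e.act s = .invoke p (.scx V R fld new) ∧ (e.cfg s).nScx = u := by
  induction t with
  | zero => rw [e.initial.nScx] at hu; omega
  | succ t ih =>
    rcases e.nScx_succ t with h | ⟨p, V, R, fld, new, ha, h, _⟩
    · obtain ⟨s, hs, hh⟩ := ih (h ▸ hu)
      exact ⟨s, by omega, hh⟩
    · by_cases hlt : u < (e.cfg t).nScx
      · obtain ⟨s, hs, hh⟩ := ih hlt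
        exact ⟨s, by omega, hh⟩
      · exact ⟨t, by omega, p, V, R, fld, new, ha, by omega⟩

theorem nScx_lt_of_invoke {s t p V R fld new} (h : e.act s = .invoke p (.scx V R fld new))
    (hst : s < t) : (e.cfg s).nScx < (e.cfg t).nScx := by
  have h1 := e.nScx_invoke_scx h
  have h2 : (e.cfg (s+1)).nScx ≤ (e.cfg t).nScx := e.nScx_mono hst
  omega

theorem invoke_scx_unique {s t p V R fld new p' V' R' fld' new'}
    (h : e.act s = .invoke p (.scx V R fld new)) (h' : e.act t = .invoke p' (.scx V' R' fld' new'))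
    (hst : (e.cfg s).nScx = (e.cfg t).nScx) : s = t := by
  rcases lt_trichotomy s t with hlt | rfl | hlt
  · have := e.nScx_lt_of_invoke h hlt; omega
  · rfl
  · have := e.nScx_lt_of_invoke h' hlt; omega

theorem marked_mono {t t' r} (h : t ≤ t') (hr : r < (e.cfg t).nRec)
    (hm : ((e.cfg t).recs r).marked = true) : ((e.cfg t').recs r).marked = true := by
  induction t', h using Nat.le_induction with
  | base => exact hm
  | succ s hs ih =>
    rcases e.marked_succ (hr.trans_le (e.nRec_mono hs)) with h1 | ⟨_, _, _, _, _, _, h1⟩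
    · rw [h1, ih]
    · exact h1

theorem allFrozen_mono {t t' u} (h : t ≤ t') (hu : u < (e.cfg t).nScx)
    (hm : ((e.cfg t).scxs u).allFrozen = true) : ((e.cfg t').scxs u).allFrozen = true := by
  induction t', h using Nat.le_induction with
  | base => exact hm
  | succ s hs ih =>
    rcases e.allFrozen_succ (hu.trans_le (e.nScx_mono hs)) with h1 | ⟨_, _, _, _, h1⟩
    · rw [h1, ih]
    · exact h1

theorem done_mono {t t' u} (h : t ≤ t') (hu : u < (e.cfg t).nScx)
    (hm : ((e.cfg t).scxs u).state ≠ .inProgress) : ((e.cfg t').scxs u).state ≠ .inProgress := by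
  induction t', h using Nat.le_induction with
  | base => exact hm
  | succ s hs ih =>
    rcases e.state_succ (hu.trans_le (e.nScx_mono hs)) with h1 | ⟨_, _, _, _, h1⟩ | ⟨_, _, _, _, h1⟩
    · rw [h1]; exact ih
    · rw [h1]; simp
    · rw [h1]; simp

theorem initVals_eq {t t' r} (h : t ≤ t') (hr : r < (e.cfg t).nRec) :
    ((e.cfg t').recs r).initVals = ((e.cfg t).recs r).initVals := by
  induction t', h using Nat.le_induction with
  | base => rfl
  | succ s hs ih => rw [e.initVals_succ (hr.trans_le (e.nRec_mono hs)), ih]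

theorem consts_eq {t t' r} (h : t ≤ t') (hr : r < (e.cfg t).nRec) :
    ((e.cfg t').recs r).consts = ((e.cfg t).recs r).consts := by
  induction t', h using Nat.le_induction with
  | base => rfl
  | succ s hs ih => rw [e.consts_succ (hr.trans_le (e.nRec_mono hs)), ih]

theorem length_vals_eq {t t' r} (h : t ≤ t') (hr : r < (e.cfg t).nRec) :
    ((e.cfg t').recs r).vals.length = ((e.cfg t).recs r).vals.length := by
  induction t', h using Nat.le_induction with
  | base => rfl
  | succ s hs ih =>
    rw [← ih]
    rcases e.vals_succ (hr.trans_le (e.nRec_mono hs)) with h1 | ⟨_, _, _, _, _, _, _, h1⟩ <;> simp [h1]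

/-! ### Operations in progress -/

/-- No operation of `p` returns between `l` and `t`. -/
def Running (p : P) (l t : ℕ) : Prop :=
  l < t ∧ ∀ s, l < s → s < t → ∀ resp, ¬ e.ReturnsAt p s resp

theorem Running.mono {p l t t'} (h : e.Running p l t) (h1 : l < t') (h2 : t' ≤ t) :
    e.Running p l t' := ⟨h1, fun s hs hs' => h.2 s hs (by omega)⟩

/-- Induction principle for the history of a single operation. `Q` depends on the time because the
invariants mention values read at earlier steps, and it must also survive the steps of other
processes. Return steps are excluded, since they end the operation. -/
theorem running_induction {p op l} (hl : e.act l = .invoke p op) (Q : ℕ → PC Val → Prop)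
    (h0 : Q (l + 1) (op.startPC (e.cfg l)))
    (hstay : ∀ s, l < s → e.Running p l s → e.act s ≠ .run p →
      Q s ((e.cfg s).procs p).pc → Q (s + 1) ((e.cfg s).procs p).pc)
    (hstep : ∀ s, l < s → e.Running p l s → e.act s = .run p → Q s ((e.cfg s).procs p).pc →
      PCStep (e.cfg s) ((e.cfg s).procs p).table ((e.cfg s).procs p).pc
        ((e.cfg (s + 1)).procs p).pc →
      (∀ resp, ((e.cfg s).procs p).pc ≠ .ret resp) → Q (s + 1) ((e.cfg (s + 1)).procs p).pc) :
    ∀ t, e.Running p l t → Q t ((e.cfg t).procs p).pc ∧ ((e.cfg t).procs p).pc ≠ .idle := by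
  intro t ht
  have hlt : l + 1 ≤ t := ht.1
  induction t, hlt using Nat.le_induction with
  | base =>
    rw [e.invoke_pc hl]
    exact ⟨h0, by cases op <;> simp [Op.startPC]⟩
  | succ s hs ih =>
    have hr : e.Running p l s := ht.mono e hs (by omega)
    obtain ⟨ih1, ih2⟩ := ih hr
    rcases e.pc_succ s p with ⟨h1, h2, _⟩ | ⟨h1, _, h2⟩ | ⟨op', h1, h2, _⟩
    · rw [h1]; exact ⟨hstay s hs hr h2 ih1, ih2⟩
    · have hret : ∀ resp, ((e.cfg s).procs p).pc ≠ .ret resp := fun resp hh =>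
        ht.2 s hs (by omega) resp ⟨h1, hh⟩
      refine ⟨hstep s hs hr h1 ih1 h2 hret, fun hi => ?_⟩
      obtain ⟨x, hx⟩ := h2.to_idle hi
      exact hret x hx
    · exact absurd h2 ih2

theorem Running.not_idle {p op l t} (ht : e.Running p l t) (hl : e.act l = .invoke p op) :
    ((e.cfg t).procs p).pc ≠ .idle :=
  (e.running_induction hl (fun _ _ => True) trivial (fun _ _ _ _ _ => trivial)
    (fun _ _ _ _ _ _ _ => trivial) t ht).2

theorem returns_running {p op l t resp} (hl : e.act l = .invoke p op) (h : e.Returns l t resp) :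
    e.Running p l t ∧ e.act t = .run p ∧ ((e.cfg t).procs p).pc = .ret resp := by
  obtain ⟨p', op', h1, h2, h3, h4⟩ := h
  rw [hl] at h1; cases h1
  exact ⟨⟨h2, h4⟩, h3⟩

theorem returns_unique {l t t' resp resp'} (h : e.Returns l t resp) (h' : e.Returns l t' resp') :
    t = t' ∧ resp = resp' := by
  obtain ⟨p, op, h1, h2, h3, h4⟩ := h
  obtain ⟨p', op', h1', h2', h3', h4'⟩ := h'
  rw [h1] at h1'; cases h1'
  have : t = t' := by
    rcases lt_trichotomy t t' with hlt | heq | hlt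
    · exact absurd h3 (h4' t h2 hlt resp)
    · exact heq
    · exact absurd h3' (h4 t' h2' hlt resp')
  subst this
  have := h3.2.symm.trans h3'.2
  cases this
  exact ⟨rfl, rfl⟩

/-- If `p` invokes an operation at `l` and is not executing it anymore at `t`, then the operation
has returned. -/
theorem exists_returns {p op l t} (hl : e.act l = .invoke p op) (hlt : l < t)
    (h : ¬ e.Running p l t) : ∃ t' < t, ∃ resp, e.Returns l t' resp := by
  classical
  have : ∃ s, l < s ∧ s < t ∧ ∃ resp, e.ReturnsAt p s resp := by
    by_contra hne
    push Not at hne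
    exact h ⟨hlt, hne⟩
  have hs := Nat.find_spec this
  have hmin := fun m => Nat.find_min this (m := m)
  generalize Nat.find this = s at hs hmin
  obtain ⟨h1, h2, resp, h3⟩ := hs
  refine ⟨s, h2, resp, p, op, hl, h1, h3, fun m hm hm' resp' hh => hmin m hm' ⟨hm, by omega, _, hh⟩⟩

theorem exists_returns_of_invoke {p op op' l t} (hl : e.act l = .invoke p op) (hlt : l < t)
    (ht : e.act t = .invoke p op') : ∃ t' < t, ∃ resp, e.Returns l t' resp :=
  e.exists_returns hl hlt fun h => h.not_idle e hl (e.invoke_idle ht)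

/-- A process that is not idle is executing some operation. -/
theorem exists_running {p t} (h : ((e.cfg t).procs p).pc ≠ .idle) :
    ∃ l op, e.act l = .invoke p op ∧ e.Running p l t := by
  induction t with
  | zero => exact absurd (e.initial.idle p) h
  | succ t ih =>
    rcases e.pc_succ t p with ⟨h1, h2, _⟩ | ⟨h1, h3, h2⟩ | ⟨op', h1, h2, _⟩
    · rw [h1] at h
      obtain ⟨l, op, hl, hr⟩ := ih h
      refine ⟨l, op, hl, by have := hr.1; omega, fun s hs hs' resp hh => ?_⟩
      rcases Nat.lt_succ_iff_lt_or_eq.1 hs' with h4 | rfl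
      · exact hr.2 s hs h4 resp hh
      · exact h2 hh.1
    · obtain ⟨l, op, hl, hr⟩ := ih h3
      refine ⟨l, op, hl, by have := hr.1; omega, fun s hs hs' resp hh => ?_⟩
      rcases Nat.lt_succ_iff_lt_or_eq.1 hs' with h4 | rfl
      · exact hr.2 s hs h4 resp hh
      · exact h (h2.of_ret hh.2)
    · exact ⟨t, op', h1, by omega, fun s hs hs' => by omega⟩

end Execution

/-! ### What an operation in progress has seen, and the snapshot behind a link. -/

namespace Execution

variable {P Val : Type*} [DecidableEq P] [DecidableEq Val] [Inhabited Val]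
  {refs : Val → Set RecId} (e : Execution P refs)

/-- The SCX-record that is being helped and the continuation of the call of `Help`. -/
def _root_.LLXSCX.PC.helping : PC Val → Option (ScxPtr × Cont)
  | .helpFreeze u _ k | .helpCheck u _ _ k | .helpFrozenCheck u k | .helpAbort u k
  | .helpFrozen u k | .helpMark u _ k | .helpUpdate u k | .helpCommit u k => some (u, k)
  | _ => none

/-- The transitions inside `Help` do not change its arguments. -/
theorem _root_.LLXSCX.PCStep.helping {c : Config P Val} {tab pc pc' u k}
    (h : PCStep c tab pc pc') (hk : pc.helping = some (u, k)) :
    pc'.helping = some (u, k) ∨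
      (pc = .helpFrozenCheck u k ∧ (c.scxs u).allFrozen = true ∧ pc' = k.retPC true) ∨
      (pc = .helpCommit u k ∧ pc' = k.retPC true) ∨ (pc = .helpAbort u k ∧ pc' = k.retPC false) := by
  cases h <;> simp [PC.helping] at hk ⊢ <;> try simp [hk]
  all_goals obtain ⟨rfl, rfl⟩ := hk; simp [*]

theorem running_unique {p l l' op op' t} (hl : e.act l = .invoke p op) (hl' : e.act l' = .invoke p op')
    (h : e.Running p l t) (h' : e.Running p l' t) : l = l' := by
  rcases lt_trichotomy l l' with hlt | heq | hlt
  · exact absurd (e.invoke_idle hl') ((h.mono e hlt h'.1.le).not_idle e hl)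
  · exact heq
  · exact absurd (e.invoke_idle hl) ((h'.mono e hlt h.1.le).not_idle e hl')

/-! ### History of an `LLX` -/

/-- In an `LLX(r)` invoked at `l`, `r.marked = m` and `r.info = u` have been read before `t`. -/
def InfoRead (l t : ℕ) (r : RecId) (m : Bool) (u : ScxPtr) : Prop :=
  ∃ a₀ a, l < a₀ ∧ a₀ < a ∧ a < t ∧ ((e.cfg a₀).recs r).marked = m ∧ ((e.cfg a).recs r).info = u

/-- In an `LLX(r)` invoked at `l`, the test that `r` is not frozen was passed, and the values
`ms` have been read before `t`. -/
def Collecting (l t : ℕ) (r : RecId) (m : Bool) (u : ScxPtr) (ms : List Val) : Prop :=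
  ∃ b c, e.InfoRead l b r m u ∧ b < c ∧ c < t ∧
    (((e.cfg b).scxs u).state = .aborted ∨
      ((e.cfg b).scxs u).state = .committed ∧ ((e.cfg c).recs r).marked = false) ∧
    ∀ (i : ℕ) (v : Val), ms[i]? = some v → ∃ a, c < a ∧ a < t ∧ ((e.cfg a).recs r).vals[i]? = some v

/-- `Collecting`, and all mutable fields have been read. -/
def Collected (l t : ℕ) (r : RecId) (m : Bool) (u : ScxPtr) (ms : List Val) : Prop :=
  e.Collecting l t r m u ms ∧ ∃ a, l < a ∧ a < t ∧ ((e.cfg a).recs r).vals[ms.length]? = none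

/-- Ensures that an `LLX` has at most one rereading step, hence that the linearization point of a
snapshot is unique. -/
def NoReread (p : P) (l t : ℕ) : Prop :=
  ∀ s, l < s → s < t → e.act s = .run p → ∀ r m u ms, ((e.cfg s).procs p).pc ≠ .llxReread r m u ms

variable {e}

theorem InfoRead.mono {l t t' r m u} (h : e.InfoRead l t r m u) (ht : t ≤ t') :
    e.InfoRead l t' r m u := by
  obtain ⟨a, b, h1, h2, h3, h4⟩ := h
  exact ⟨a, b, h1, h2, by omega, h4⟩

theorem Collecting.mono {l t t' r m u ms} (h : e.Collecting l t r m u ms) (ht : t ≤ t') :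
    e.Collecting l t' r m u ms := by
  obtain ⟨a, b, h1, h2, h3, h4, h5⟩ := h
  refine ⟨a, b, h1, h2, by omega, h4, fun i v hv => ?_⟩
  obtain ⟨x, hx⟩ := h5 i v hv
  exact ⟨x, hx.1, by omega, hx.2.2⟩

theorem Collected.mono {l t t' r m u ms} (h : e.Collected l t r m u ms) (ht : t ≤ t') :
    e.Collected l t' r m u ms := by
  obtain ⟨h, a, h1, h2, h3⟩ := h
  exact ⟨h.mono ht, a, h1, by omega, h3⟩

theorem Collecting.infoRead {l t r m u ms} (h : e.Collecting l t r m u ms) :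
    e.InfoRead l t r m u := by
  obtain ⟨b, c, h1, h2, h3, -⟩ := h
  exact h1.mono (by omega)

theorem NoReread.succ {p l t} (h : e.NoReread p l t)
    (h' : e.act t = .run p → ∀ r m u ms, ((e.cfg t).procs p).pc ≠ .llxReread r m u ms) :
    e.NoReread p l (t + 1) := by
  intro s hs hs' ha
  rcases Nat.lt_succ_iff_lt_or_eq.1 hs' with h1 | rfl
  · exact h s hs h1 ha
  · exact h' ha

variable (e)

/-- The possible states of an `LLX(r)` that was invoked by `p` at `l`. -/
def LlxInv (p : P) (r : RecId) (l t : ℕ) : PC Val → Prop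
  | .llxMarked₁ r' => r' = r ∧ e.NoReread p l t
  | .llxInfo r' m => r' = r ∧ e.NoReread p l t ∧
      ∃ a, l < a ∧ a < t ∧ ((e.cfg a).recs r).marked = m
  | .llxState r' m u => r' = r ∧ e.NoReread p l t ∧ e.InfoRead l t r m u
  | .llxMarked₂ r' m u st => r' = r ∧ e.NoReread p l t ∧
      ∃ b, e.InfoRead l b r m u ∧ b < t ∧ ((e.cfg b).scxs u).state = st
  | .llxCollect r' m u ms => r' = r ∧ e.NoReread p l t ∧ e.Collecting l t r m u ms
  | .llxReread r' m u ms => r' = r ∧ e.NoReread p l t ∧ e.Collected l t r m u ms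
  | .llxTest₁ r' m u | .llxTest₂ r' m u => r' = r ∧ e.InfoRead l t r m u
  | .llxFail₁ r' | .llxFail₂ r' _ | .llxFail₃ r' => r' = r
  | .ret (.snapshot ms) => ∃ d m u, l < d ∧ d < t ∧ e.act d = .run p ∧
      ((e.cfg d).procs p).pc = .llxReread r m u ms ∧ ((e.cfg d).recs r).info = u ∧
      e.Collected l d r m u ms ∧ e.NoReread p l d ∧
      ∀ s, d < s → s < t → ((e.cfg s).procs p).pc = .ret (.snapshot ms)
  | .ret .finalized | .ret .fail => True
  | pc => ∃ u k, pc.helping = some (u, k) ∧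
      (k = .llxFail ∨ ∃ m, k = .llxTest r m ∧ e.InfoRead l t r m u)

/-- Treats all states inside `Help` alike: what the `LLX` remembers there is contained in the
continuation. -/
theorem llxInv_of_helping {p : P} {r l t} {pc : PC Val} {u k} (h : pc.helping = some (u, k)) :
    e.LlxInv p r l t pc ↔ (k = .llxFail ∨ ∃ m, k = .llxTest r m ∧ e.InfoRead l t r m u) := by
  cases pc <;> simp [PC.helping] at h <;> obtain ⟨rfl, rfl⟩ := h <;> simp [LlxInv, PC.helping]

theorem llxInv_retPC {p : P} {r l t u} {k : Cont} {b : Bool}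
    (h : k = .llxFail ∨ ∃ m, k = .llxTest r m ∧ e.InfoRead l t r m u) :
    e.LlxInv p r l t (k.retPC b) := by
  rcases h with rfl | ⟨m, rfl, h⟩
  · simp [Cont.retPC, LlxInv]
  · simp only [Cont.retPC]; split <;> simp [LlxInv]

theorem llxInv {p l r} (hl : e.act l = .invoke p (.llx r)) :
    ∀ t, e.Running p l t → e.LlxInv p r l t ((e.cfg t).procs p).pc := by
  intro t ht
  refine (e.running_induction hl (e.LlxInv p r l) ?_ ?_ ?_ t ht).1
  · simp only [Op.startPC, LlxInv, true_and]
    intro s; omega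
  · intro s hs hrun ha h
    have hnr : e.NoReread p l s → e.NoReread p l (s + 1) := fun h => h.succ fun ha' => absurd ha' ha
    generalize hpc : ((e.cfg s).procs p).pc = pc at h
    cases hh : pc.helping with
    | some x =>
      rw [e.llxInv_of_helping hh] at h ⊢
      exact h.imp_right fun ⟨m, h1, h2⟩ => ⟨m, h1, h2.mono (by omega)⟩
    | none =>
      cases pc <;> simp only [PC.helping, reduceCtorEq] at hh <;> simp only [LlxInv] at h ⊢
      case llxMarked₁ => exact ⟨h.1, hnr h.2⟩
      case llxInfo =>
        obtain ⟨h1, h2, a, h3, h4, h5⟩ := h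
        exact ⟨h1, hnr h2, a, h3, by omega, h5⟩
      case llxState => exact ⟨h.1, hnr h.2.1, h.2.2.mono (by omega)⟩
      case llxMarked₂ =>
        obtain ⟨h1, h2, a, h3, h4, h5⟩ := h
        exact ⟨h1, hnr h2, a, h3, by omega, h5⟩
      case llxCollect => exact ⟨h.1, hnr h.2.1, h.2.2.mono (by omega)⟩
      case llxReread => exact ⟨h.1, hnr h.2.1, h.2.2.mono (by omega)⟩
      case llxTest₁ => exact ⟨h.1, h.2.mono (by omega)⟩
      case llxTest₂ => exact ⟨h.1, h.2.mono (by omega)⟩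
      case llxFail₁ => exact h
      case llxFail₂ => exact h
      case llxFail₃ => exact h
      case ret resp =>
        cases resp <;> simp only [LlxInv] at h ⊢
        case snapshot =>
          obtain ⟨d, m, u, h1, h2, h3, h4, h5, h6, h7, h8⟩ := h
          refine ⟨d, m, u, h1, by omega, h3, h4, h5, h6, h7, fun x hx hx' => ?_⟩
          rcases Nat.lt_succ_iff_lt_or_eq.1 hx' with h9 | rfl
          · exact h8 x hx h9
          · exact hpc
        all_goals simp_all [PC.helping]
      all_goals simp_all [PC.helping]
  · intro s hs hrun ha h hstep hret
    generalize hpc : ((e.cfg s).procs p).pc = pc at h hstep hret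
    have hnr : (∀ r m u ms, pc ≠ .llxReread r m u ms) → e.NoReread p l s →
      e.NoReread p l (s + 1) := fun h' h => h.succ fun _ => hpc ▸ h'
    generalize ((e.cfg (s + 1)).procs p).pc = pc' at hstep
    cases hh : pc.helping with
    | some x =>
      obtain ⟨u, k⟩ := x
      rw [e.llxInv_of_helping hh] at h
      have h' : (k = .llxFail ∨ ∃ m, k = .llxTest r m ∧ e.InfoRead l (s + 1) r m u) :=
        h.imp_right fun ⟨m, h1, h2⟩ => ⟨m, h1, h2.mono (by omega)⟩
      rcases hstep.helping hh with h1 | ⟨_, _, h1⟩ | ⟨_, h1⟩ | ⟨_, h1⟩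
      · rw [e.llxInv_of_helping h1]; exact h'
      all_goals rw [h1]; exact e.llxInv_retPC h'
    | none =>
      cases hstep <;> simp only [PC.helping, reduceCtorEq] at hh <;> simp only [LlxInv] at h ⊢
      case llxMarked₁ =>
        obtain ⟨rfl, h⟩ := h
        exact ⟨rfl, hnr (by simp) h, s, hs, by omega, rfl⟩
      case llxInfo =>
        obtain ⟨rfl, h, a, h1, h2, h3⟩ := h
        exact ⟨rfl, hnr (by simp) h, a, s, h1, h2, by omega, h3, rfl⟩
      case llxState =>
        obtain ⟨rfl, h, h1⟩ := h
        exact ⟨rfl, hnr (by simp) h, s, h1, by omega, rfl⟩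
      case unfrozen hst =>
        obtain ⟨rfl, h, b, h1, h2, rfl⟩ := h
        exact ⟨rfl, hnr (by simp) h, b, s, h1, h2, by omega, hst, by simp⟩
      case frozen =>
        obtain ⟨rfl, h, b, h1, h2, rfl⟩ := h
        exact ⟨rfl, h1.mono (by omega)⟩
      case collect m u ms v hv =>
        obtain ⟨rfl, h, b, c, h1, h2, h3, h4, h5⟩ := h
        refine ⟨rfl, hnr (by simp) h, b, c, h1, h2, by omega, h4, fun i w hw => ?_⟩
        rw [List.getElem?_append] at hw
        split at hw
        · obtain ⟨a, h6, h7, h8⟩ := h5 i w hw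
          exact ⟨a, h6, by omega, h8⟩
        · have : i = ms.length := by
            by_contra hne
            have : 1 ≤ i - ms.length := by omega
            rw [List.getElem?_eq_none (by simpa using this)] at hw
            simp at hw
          subst this
          simp at hw
          exact ⟨s, h3, by omega, hw ▸ hv⟩
      case collected hv =>
        obtain ⟨rfl, h, h1⟩ := h
        exact ⟨rfl, hnr (by simp) h, h1.mono (by omega), s, hs, by omega, hv⟩
      case snapshot r' m u ms hu =>
        obtain ⟨rfl, h, h1⟩ := h
        exact ⟨s, m, u, hs, by omega, ha, hpc, hu, h1, h, fun x => by omega⟩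
      case changed =>
        obtain ⟨rfl, h, h1⟩ := h
        exact ⟨rfl, h1.1.infoRead.mono (t := s) (by omega)⟩
      case unmarked => exact h.1
      case uncommitted => exact ⟨h.1, h.2.mono (by omega)⟩
      case testHelp =>
        obtain ⟨rfl, h⟩ := h
        exact ⟨_, _, rfl, .inr ⟨_, rfl, h.mono (by omega)⟩⟩
      case aborted => exact h.1
      case llxFail₁ => exact h
      case inProgress => exact h
      case failHelp => simp [PC.helping]
      all_goals simp_all [PC.helping]

/-! ### History of the other operations -/

/-- The possible states of a `VLX(V)` that was invoked by `p` at `l`. -/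
def VlxInv (p : P) (V : List RecId) (l t : ℕ) : PC Val → Prop
  | .vlx rs => ∃ d, V = d ++ rs ∧ ∀ r ∈ d, ∃ s, l < s ∧ s < t ∧
      (((e.cfg l).procs p).table r).1 = ((e.cfg s).recs r).info
  | .ret (.bool true) => ∀ r ∈ V, ∃ s, l < s ∧ s < t ∧
      (((e.cfg l).procs p).table r).1 = ((e.cfg s).recs r).info
  | .ret (.bool false) => ∃ r ∈ V, ∃ s, l < s ∧ s < t ∧
      (((e.cfg l).procs p).table r).1 ≠ ((e.cfg s).recs r).info
  | _ => False

theorem vlxInv {p l V} (hl : e.act l = .invoke p (.vlx V)) :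
    ∀ t, e.Running p l t → e.VlxInv p V l t ((e.cfg t).procs p).pc := by
  intro t ht
  -- The comparisons use the current local table whereas the invariant speaks of the table at the
  -- invocation, so the invariant also records that the table has not changed.
  refine (e.running_induction hl (fun t pc => e.VlxInv p V l t pc ∧
    ((e.cfg t).procs p).table = ((e.cfg l).procs p).table) ?_ ?_ ?_ t ht).1.1
  · refine ⟨⟨[], rfl, by simp⟩, ?_⟩
    rw [e.next_invoke hl, start_table]
  · intro s hs hrun ha ⟨h, htab⟩
    refine ⟨?_, ?_⟩
    · generalize ((e.cfg s).procs p).pc = pc at h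
      unfold VlxInv at h ⊢
      split <;> simp only at h
      · obtain ⟨d, h1, h2⟩ := h
        refine ⟨d, h1, fun r hr => ?_⟩
        obtain ⟨x, h3, h4, h5⟩ := h2 r hr
        exact ⟨x, h3, by omega, h5⟩
      · intro r hr
        obtain ⟨x, h3, h4, h5⟩ := h r hr
        exact ⟨x, h3, by omega, h5⟩
      · obtain ⟨r, hr, x, h3, h4, h5⟩ := h
        exact ⟨r, hr, x, h3, by omega, h5⟩
    · rcases e.table_succ s p with h1 | ⟨_, _, _, _, h1, _⟩
      · rw [h1, htab]
      · exact absurd h1 ha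
  · intro s hs hrun ha ⟨h, htab⟩ hstep hret
    refine ⟨?_, ?_⟩
    · generalize hpc : ((e.cfg s).procs p).pc = pc at h hstep hret
      generalize ((e.cfg (s + 1)).procs p).pc = pc' at hstep
      rw [htab] at hstep
      cases hstep <;> simp only [VlxInv] at h ⊢
      case vlxTrue =>
        obtain ⟨d, h1, h2⟩ := h
        intro r hr
        obtain ⟨x, h3, h4, h5⟩ := h2 r (by rw [h1] at hr; simpa using hr)
        exact ⟨x, h3, by omega, h5⟩
      case vlx r rs hr =>
        obtain ⟨d, h1, h2⟩ := h
        refine ⟨d ++ [r], by simp [h1], fun r' hr' => ?_⟩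
        rcases List.mem_append.1 hr' with hr' | hr'
        · obtain ⟨x, h3, h4, h5⟩ := h2 r' hr'
          exact ⟨x, h3, by omega, h5⟩
        · cases List.mem_singleton.1 hr'
          exact ⟨s, hs, by omega, hr⟩
      case vlxFalse r rs hr =>
        obtain ⟨d, h1, h2⟩ := h
        exact ⟨r, by simp [h1], s, hs, by omega, hr⟩
      case ret => exact hret _ rfl
    · rcases e.table_succ s p with h1 | ⟨_, _, _, _, _, h1, _⟩
      · rw [h1, htab]
      · rw [h1] at h; exact h.elim

/-- The possible states of an `SCX` that created the SCX-record `u`. -/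
def ScxInv (u : ScxPtr) (pc : PC Val) : Prop :=
  pc.helping = some (u, .scx) ∨ ∃ b, pc = .ret (.bool b)

theorem scxInv {p l V R fld new} (hl : e.act l = .invoke p (.scx V R fld new)) :
    ∀ t, e.Running p l t → ScxInv (e.cfg l).nScx ((e.cfg t).procs p).pc := by
  intro t ht
  refine (e.running_induction hl (fun t pc => ScxInv (e.cfg l).nScx pc) ?_ ?_ ?_ t ht).1
  · exact .inl rfl
  · exact fun _ _ _ _ h => h
  · intro s hs hrun ha h hstep hret
    rcases h with h | ⟨b, h⟩
    · rcases hstep.helping h with h1 | ⟨_, _, h1⟩ | ⟨_, h1⟩ | ⟨_, h1⟩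
      · exact .inl h1
      all_goals exact .inr ⟨_, h1⟩
    · exact absurd h (hret _)

/-- The possible states of a read of `f` that was invoked by `p` at `l`. -/
def ReadInv (p : P) (r : RecId) (f : Field) (l t : ℕ) : PC Val → Prop
  | .read r' f' => r' = r ∧ f' = f
  | .ret resp => ∃ s, l < s ∧ s < t ∧ e.act s = .run p ∧ ((e.cfg s).procs p).pc = .read r f ∧
      resp = .value (((e.cfg s).fieldValue? r f).getD default)
  | _ => False

theorem readInv {p l r f} (hl : e.act l = .invoke p (.read r f)) :
    ∀ t, e.Running p l t → e.ReadInv p r f l t ((e.cfg t).procs p).pc := by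
  intro t ht
  refine (e.running_induction hl (e.ReadInv p r f l) ?_ ?_ ?_ t ht).1
  · exact ⟨rfl, rfl⟩
  · intro s hs hrun ha h
    generalize ((e.cfg s).procs p).pc = pc at h
    cases pc <;> simp only [ReadInv] at h ⊢
    · exact h
    · obtain ⟨x, h1, h2, h3⟩ := h
      exact ⟨x, h1, by omega, h3⟩
  · intro s hs hrun ha h hstep hret
    generalize hpc : ((e.cfg s).procs p).pc = pc at h hstep hret
    generalize ((e.cfg (s + 1)).procs p).pc = pc' at hstep
    cases hstep <;> simp only [ReadInv] at h ⊢
    case read =>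
      obtain ⟨rfl, rfl⟩ := h
      refine ⟨s, hs, by omega, ha, hpc, ?_⟩
      rfl
    case ret => exact hret _ rfl

/-! ### Linked operations -/

theorem op_of_llxReread {p l op t r m u ms} (hl : e.act l = .invoke p op) (ht : e.Running p l t)
    (h : ((e.cfg t).procs p).pc = .llxReread r m u ms) : op = .llx r := by
  cases op with
  | llx r' => have := e.llxInv hl t ht; rw [h] at this; rw [this.1]
  | scx V R fld new =>
    have := e.scxInv hl t ht; rw [h] at this
    simp [ScxInv, PC.helping] at this
  | vlx V => have := e.vlxInv hl t ht; rw [h] at this; exact this.elim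
  | read r' f => have := e.readInv hl t ht; rw [h] at this; exact this.elim

/-- An `LLX(r)` invoked by `p` at `l` that returns the snapshot `ms` at `t`, found `r.info = u`,
and rereads `r.info` at `d`. -/
structure IsSnapshot (p : P) (l t : ℕ) (r : RecId) (ms : List Val) (d : ℕ) (m : Bool) (u : ScxPtr) :
    Prop where
  invoke : e.act l = .invoke p (.llx r)
  lt_point : l < d
  point_lt : d < t
  run : e.act d = .run p
  pc : ((e.cfg d).procs p).pc = .llxReread r m u ms
  info : ((e.cfg d).recs r).info = u
  collected : e.Collected l d r m u ms
  noReread : e.NoReread p l d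
  after : ∀ s, d < s → s ≤ t → ((e.cfg s).procs p).pc = .ret (.snapshot ms)

theorem exists_isSnapshot {p l r t ms} (hl : e.act l = .invoke p (.llx r))
    (h : e.Returns l t (.snapshot ms)) : ∃ d m u, e.IsSnapshot p l t r ms d m u := by
  obtain ⟨h1, h2, h3⟩ := e.returns_running hl h
  have := e.llxInv hl t h1
  rw [h3] at this
  obtain ⟨d, m, u, h4, h5, h6, h7, h8, h9, h10, h11⟩ := this
  refine ⟨d, m, u, hl, h4, h5, h6, h7, h8, h9, h10, fun s hs hs' => ?_⟩
  rcases hs'.lt_or_eq with h | rfl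
  · exact h11 s hs h
  · exact h3

theorem snapshotPoint_iff {p l r t ms d m u} (h : e.IsSnapshot p l t r ms d m u)
    (hret : e.Returns l t (.snapshot ms)) (s : ℕ) : e.SnapshotPoint l s ↔ s = d := by
  constructor
  · rintro ⟨p', r', t', vals, h1, h2, h3, h4, h5, m', u', ms', h6⟩
    rw [h.invoke] at h1; cases h1
    obtain ⟨rfl, -⟩ := e.returns_unique h2 hret
    rcases lt_trichotomy s d with hlt | rfl | hlt
    · exact absurd h6 (h.noReread s h3 hlt h5 _ _ _ _)
    · rfl
    · rw [h.after s hlt h4.le] at h6; cases h6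
  · rintro rfl
    exact ⟨p, r, t, ms, h.invoke, hret, h.lt_point, h.point_lt, h.run, m, u, ms, h.pc⟩

theorem IsSnapshot.nRec {p l r t ms d m u} (h : e.IsSnapshot p l t r ms d m u) :
    r < (e.cfg l).nRec := e.invoke_ok h.invoke

/-- The collecting loop stops at an index without a field, so at least all fields were read.
Conversely each entry was read at an index that exists, and the number of fields of a record is
constant. -/
theorem IsSnapshot.length {p l r t ms d m u} (h : e.IsSnapshot p l t r ms d m u) :
    ms.length = ((e.cfg l).recs r).vals.length := by
  obtain ⟨⟨b, c, h1, h2, h3, h4, h5⟩, a, h6, h7, h8⟩ := h.collected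
  obtain ⟨a₀, a₁, h9, h10, h11, -⟩ := h1
  have hN := h.nRec
  have hle : ((e.cfg l).recs r).vals.length ≤ ms.length := by
    rw [← e.length_vals_eq h6.le hN]; exact List.getElem?_eq_none_iff.1 h8
  refine le_antisymm ?_ hle
  by_contra! hlt
  have : ms[((e.cfg l).recs r).vals.length]? = some ms[((e.cfg l).recs r).vals.length] := by simp [hlt]
  obtain ⟨x, hx, hx', hxx⟩ := h5 _ _ this
  have hle' := e.length_vals_eq (t := l) (t' := x) (by omega) hN
  obtain ⟨hi, -⟩ := List.getElem?_eq_some_iff.1 hxx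
  omega

/-- What an operation finds in the local table for a record in its sequence. -/
theorem Linked.isSnapshot {l t r} (h : e.Linked l t r) :
    ∃ p op d m u ms t', e.act t = .invoke p op ∧ r ∈ op.deps ∧ t' < t ∧
      e.Returns l t' (.snapshot ms) ∧ e.IsSnapshot p l t' r ms d m u ∧
      ((e.cfg t).procs p).table r = (u, ms) := by
  obtain ⟨hlt, p, op, hl, ht, hr, ⟨t', ms, hret⟩, hno⟩ := h
  obtain ⟨t'', ht'', resp, hret'⟩ := e.exists_returns_of_invoke hl hlt ht
  obtain ⟨rfl, -⟩ := e.returns_unique hret hret'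
  obtain ⟨d, m, u, hs⟩ := e.exists_isSnapshot hl hret
  refine ⟨p, op, d, m, u, ms, t', ht, hr, ht'', hret, hs, ?_⟩
  have key : ∀ s, d < s → s ≤ t → ((e.cfg s).procs p).table r = (u, ms) := by
    intro s hds
    induction s, hds using Nat.le_induction with
    | base =>
      intro _
      rw [e.next_run hs.run, Config.runStep_table_of_llxReread _ hs.pc hs.info]; simp
    | succ s hds ih =>
      intro hst
      have ih := ih (by omega)
      rcases e.table_succ s p with h1 | ⟨r', m', u', ms', h1, h2, h3⟩
      · rw [h1, ih]
      · rw [h3]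
        by_cases hrr : r = r'
        · subst hrr
          exfalso
          obtain ⟨l', op', hl', hrun⟩ := e.exists_running (p := p) (t := s) (by rw [h2]; simp)
          cases e.op_of_llxReread hl' hrun h2
          have hlrun := (e.returns_running hl hret).1
          -- Only a rereading step of an `LLX(r)` by `p` can overwrite the entry. A later such `LLX`
          -- is excluded by the link, the linked one is already past its rereading step, and an
          -- earlier one ended before `l`.
          rcases lt_trichotomy l l' with hlt' | rfl | hlt'
          · exact (hno l' hlt' (by have := hrun.1; omega)).1 hl'
          · rcases le_or_gt s t' with hle | hlt2
            · rw [hs.after s hds hle] at h2; cases h2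
            · exact hrun.2 t' hlrun.1 hlt2 _ ⟨(e.returns_running hl hret).2.1, (e.returns_running hl hret).2.2⟩
          · have := hs.lt_point
            exact (hrun.mono e hlt' (by omega)).not_idle e hl' (e.invoke_idle hl)
        · simp [hrr, ih]
  exact key t (hs.point_lt.trans ht'') le_rfl

end Execution

/-! ### Info fields only grow; SCX-records that can no longer be frozen. -/

namespace Execution

variable {P Val : Type*} [DecidableEq P] [DecidableEq Val] [Inhabited Val]
  {refs : Val → Set RecId} (e : Execution P refs)

/-! ### Validity of the pointers that processes hold -/

/-- The purpose is that `Help` is never called on the dummy. In `llxFail₂` the condition concerns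
`r.info` rather than `q`, because `Help` is applied to a second read of `r.info`; the first read
being nonzero suffices, as a nonzero info field never becomes zero again. -/
def PCValid (c : Config P Val) : PC Val → Prop
  | .idle | .vlx _ | .read _ _ | .ret _ => True
  | .llxMarked₁ r | .llxInfo r _ | .llxFail₁ r => r < c.nRec
  | .llxState r _ u | .llxMarked₂ r _ u _ | .llxCollect r _ u _ | .llxReread r _ u _
  | .llxTest₁ r _ u | .llxTest₂ r _ u => r < c.nRec ∧ u < c.nScx
  | .llxFail₂ r q => r < c.nRec ∧ (q ≠ 0 → (c.recs r).info ≠ 0)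
  | .llxFail₃ r => r < c.nRec ∧ (c.recs r).info ≠ 0
  | pc => ∃ u k, pc.helping = some (u, k) ∧ u ≠ 0 ∧ u < c.nScx ∧
      ∀ r m, k = .llxTest r m → r < c.nRec

theorem pcValid_of_helping {c : Config P Val} {pc : PC Val} {u k} (h : pc.helping = some (u, k)) :
    PCValid c pc ↔ u ≠ 0 ∧ u < c.nScx ∧ ∀ r m, k = .llxTest r m → r < c.nRec := by
  cases pc <;> simp [PC.helping] at h <;> obtain ⟨rfl, rfl⟩ := h <;> simp [PCValid, PC.helping]

theorem pcValid_retPC {c : Config P Val} {k : Cont} {b : Bool}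
    (h : ∀ r m, k = .llxTest r m → r < c.nRec) : PCValid c (k.retPC b : PC Val) := by
  rcases k.retPC_cases (Val := Val) b with ⟨_, h1⟩ | ⟨_, _, _, h1⟩ | ⟨r, m, h2, _, h1⟩ | ⟨_, h1⟩ <;>
    simp only [h1, PCValid]
  exact h r m h2

theorem PCValid.of_le {c c' : Config P Val} {pc : PC Val} (h : PCValid c pc)
    (h1 : c.nRec ≤ c'.nRec) (h2 : c.nScx ≤ c'.nScx)
    (h3 : ∀ r < c.nRec, (c.recs r).info ≠ 0 → (c'.recs r).info ≠ 0) : PCValid c' pc := by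
  cases hh : pc.helping with
  | some x =>
    obtain ⟨u, k⟩ := x
    rw [pcValid_of_helping hh] at h ⊢
    exact ⟨h.1, h.2.1.trans_le h2, fun r m hr => (h.2.2 r m hr).trans_le h1⟩
  | none =>
    cases pc <;> simp only [PC.helping, reduceCtorEq] at hh <;> simp only [PCValid] at h ⊢
    case llxFail₂ => exact ⟨h.1.trans_le h1, fun hq => h3 _ h.1 (h.2 hq)⟩
    case llxFail₃ => exact ⟨h.1.trans_le h1, h3 _ h.1 h.2⟩
    all_goals first | exact h.trans_le h1 | exact ⟨h.1.trans_le h1, h.2.trans_le h2⟩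

theorem PCValid.step {c : Config P Val} {tab pc pc'} (h : PCValid c pc)
    (hs : PCStep c tab pc pc') (h0 : (c.scxs 0).state = .aborted)
    (hinfo : ∀ r < c.nRec, (c.recs r).info < c.nScx) : PCValid c pc' := by
  cases hh : pc.helping with
  | some x =>
    obtain ⟨u, k⟩ := x
    rw [pcValid_of_helping hh] at h
    rcases hs.helping hh with h1 | ⟨_, _, h1⟩ | ⟨_, h1⟩ | ⟨_, h1⟩
    · rw [pcValid_of_helping h1]; exact h
    all_goals rw [h1]; exact pcValid_retPC h.2.2
  | none =>
    cases hs <;> simp only [PC.helping, reduceCtorEq] at hh <;> simp only [PCValid] at h ⊢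
    case llxInfo => exact ⟨h, hinfo _ h⟩
    case testHelp hu =>
      refine ⟨_, _, rfl, ?_, h.2, ?_⟩
      · rintro rfl; simp [h0] at hu
      · rintro r m ⟨⟩; exact h.1
    case llxFail₁ => exact ⟨h, id⟩
    case inProgress hq =>
      refine ⟨h.1, h.2 ?_⟩
      rintro rfl; simp [h0] at hq
    case failHelp => exact ⟨_, _, rfl, h.2, hinfo _ h.1, by simp⟩
    all_goals first | exact h | exact h.1

theorem valid_all (t : ℕ) : ((e.cfg t).scxs 0).state = .aborted ∧
    (∀ r < (e.cfg t).nRec, ((e.cfg t).recs r).info < (e.cfg t).nScx) ∧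
    ∀ p, PCValid (e.cfg t) ((e.cfg t).procs p).pc := by
  induction t with
  | zero =>
    refine ⟨e.initial.dummy_state, fun r hr => ?_, fun p => ?_⟩
    · rw [e.initial.info r hr]; exact e.nScx_pos 0
    · rw [e.initial.idle p]; trivial
  | succ t ih =>
    obtain ⟨ih1, ih2, ih3⟩ := ih
    have hX : (e.cfg t).nScx ≤ (e.cfg (t + 1)).nScx := e.nScx_mono (Nat.le_succ t)
    have hN : (e.cfg t).nRec ≤ (e.cfg (t + 1)).nRec := e.nRec_mono (Nat.le_succ t)
    -- An info field is overwritten only by an SCX-record that is being helped, and such a record is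
    -- not the dummy.
    have hnz : ∀ r < (e.cfg t).nRec, ((e.cfg t).recs r).info ≠ 0 →
        ((e.cfg (t + 1)).recs r).info ≠ 0 := by
      intro r hr h0
      rcases e.info_succ hr with h | ⟨p, u, rs, k, _, h1, _, h2⟩
      · rwa [h]
      · have := ih3 p
        rw [pcValid_of_helping (by rw [h1]; rfl)] at this
        rw [h2]; exact this.1
    refine ⟨?_, ?_, ?_⟩
    · rcases e.state_succ (e.nScx_pos t) with h | ⟨p, k, _, h1, _⟩ | ⟨p, k, _, h1, _⟩
      · rw [h, ih1]
      all_goals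
        have := ih3 p
        rw [pcValid_of_helping (by rw [h1]; rfl)] at this
        exact absurd rfl this.1
    · have old : ∀ r < (e.cfg t).nRec, ((e.cfg (t + 1)).recs r).info < (e.cfg (t + 1)).nScx := by
        intro r hr
        rcases e.info_succ hr with h | ⟨p, u, rs, k, _, h1, _, h2⟩
        · rw [h]; exact (ih2 r hr).trans_le hX
        · have := ih3 p
          rw [pcValid_of_helping (by rw [h1]; rfl)] at this
          rw [h2]; exact this.2.1.trans_le hX
      intro r hr
      by_cases hr' : r < (e.cfg t).nRec
      · exact old r hr'
      · rcases e.nRec_succ t with h | ⟨_, _, _, _, h1, h2⟩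
        · omega
        · obtain rfl : r = (e.cfg t).nRec := by omega
          rw [h2]; exact e.nScx_pos _
    · intro p
      rcases e.pc_succ t p with ⟨h1, _⟩ | ⟨_, _, h2⟩ | ⟨op, h0, _, h2, hok⟩
      · rw [h1]; exact (ih3 p).of_le hN hX hnz
      · exact ((ih3 p).step h2 ih1 ih2).of_le hN hX hnz
      · rw [h2]
        cases op with
        | llx r => exact lt_of_lt_of_le hok hN
        | scx V R fld new =>
          exact ⟨_, _, rfl, (e.nScx_pos t).ne', e.nScx_lt_of_invoke h0 (Nat.lt_succ_self t), by simp⟩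
        | vlx V => trivial
        | read r f => trivial

theorem dummy_aborted (t : ℕ) : ((e.cfg t).scxs 0).state = .aborted := (e.valid_all t).1

theorem info_lt_nScx {t r} (hr : r < (e.cfg t).nRec) : ((e.cfg t).recs r).info < (e.cfg t).nScx :=
  (e.valid_all t).2.1 r hr

theorem helping_valid {t p u k} (h : ((e.cfg t).procs p).pc.helping = some (u, k)) :
    u ≠ 0 ∧ u < (e.cfg t).nScx := by
  have := (e.valid_all t).2.2 p
  rw [pcValid_of_helping h] at this
  exact ⟨this.1, this.2.1⟩

/-- The lists of records that remain to be handled by `Help`. -/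
def HelpShape : PC Val → Prop
  | .helpFreeze u rs _ => rs <:+ (e.data u).V
  | .helpCheck u r rs _ => r :: rs <:+ (e.data u).V
  | .helpMark u rs _ => rs <:+ (e.data u).R
  | _ => True

theorem helpShape (t : ℕ) (p : P) : e.HelpShape ((e.cfg t).procs p).pc := by
  induction t with
  | zero => rw [e.initial.idle p]; trivial
  | succ t ih =>
    rcases e.pc_succ t p with ⟨h1, _⟩ | ⟨_, _, h2⟩ | ⟨op, h0, _, h2, hok⟩
    · rw [h1]; exact ih
    · have hv := (e.valid_all t).2.2 p
      have hv' := (e.valid_all (t + 1)).2.2 p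
      generalize ((e.cfg t).procs p).pc = pc at ih h2 hv
      generalize ((e.cfg (t + 1)).procs p).pc = pc' at h2 hv'
      have hret : ∀ (k : Cont) b, e.HelpShape (k.retPC b) := by
        intro k b
        rcases k.retPC_cases (Val := Val) b with ⟨_, h1⟩ | ⟨_, _, _, h1⟩ | ⟨r, m, h2, _, h1⟩ | ⟨_, h1⟩ <;>
          rw [h1] <;> trivial
      cases h2 <;> simp only [HelpShape] at ih ⊢ <;> try exact hret _ _
      case testHelp => rw [(e.sameData hv.2).V]
      case failHelp => rw [(e.sameData (e.info_lt_nScx hv.1)).V]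
      case freeze => exact (List.suffix_cons _ _).trans ih
      case freezeFail => exact ih
      case checkOK => exact (List.suffix_cons _ _).trans ih
      case helpFrozen =>
        rw [pcValid_of_helping rfl] at hv
        rw [(e.sameData hv.2.1).R]
      case helpMark => exact (List.suffix_cons _ _).trans ih
    · rw [h2]
      cases op with
      | scx V R fld new =>
        simp only [Op.startPC, HelpShape]
        rw [← (e.data_of_invoke h0).V]
      | llx r => trivial
      | vlx V => trivial
      | read r f => trivial

theorem mem_V_of_helpFreeze {t p u r rs k} (h : ((e.cfg t).procs p).pc = .helpFreeze u (r :: rs) k) :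
    r ∈ (e.data u).V := by
  have := e.helpShape t p
  rw [h] at this
  exact List.IsSuffix.subset this (by simp)

theorem mem_R_of_helpMark {t p u r rs k} (h : ((e.cfg t).procs p).pc = .helpMark u (r :: rs) k) :
    r ∈ (e.data u).R := by
  have := e.helpShape t p
  rw [h] at this
  exact List.IsSuffix.subset this (by simp)

theorem R_subset_V {t u} (h0 : u ≠ 0) (hu : u < (e.cfg t).nScx) :
    (e.data u).R.Sublist (e.data u).V := by
  obtain ⟨s, hs, p, V, R, fld, new, ha, rfl⟩ := e.exists_invoke h0 hu
  rw [← (e.data_of_invoke ha).V, ← (e.data_of_invoke ha).R]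
  exact (e.invoke_ok ha).1

theorem fld_mem_V {t u} (h0 : u ≠ 0) (hu : u < (e.cfg t).nScx) :
    (e.data u).fld.1 ∈ (e.data u).V := by
  obtain ⟨s, hs, p, V, R, fld, new, ha, rfl⟩ := e.exists_invoke h0 hu
  rw [← (e.data_of_invoke ha).V, ← (e.data_of_invoke ha).fld]
  exact (e.invoke_ok ha).2.1

/-! ### The info pointers that an `SCX` expects -/

theorem Linked.scx_isSnapshot {l t r p V R fld new} (h : e.Linked l t r)
    (ht : e.act t = .invoke p (.scx V R fld new)) :
    ∃ d m ms t', t' < t ∧ e.Returns l t' (.snapshot ms) ∧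
      e.IsSnapshot p l t' r ms d m ((e.data (e.cfg t).nScx).infoFields r) ∧
      ((e.cfg t).procs p).table r = ((e.data (e.cfg t).nScx).infoFields r, ms) := by
  obtain ⟨p', op, d, m, u, ms, t', h1, h2, h3, h4, h5, h6⟩ := h.isSnapshot
  rw [ht] at h1; cases h1
  have : (e.data (e.cfg t).nScx).infoFields r = u := by
    rw [← (e.data_of_invoke ht).infoFields]
    exact congrArg Prod.fst h6
  rw [this]
  exact ⟨d, m, ms, t', h3, h4, h5, h6⟩

variable {e} (hsetup : e.SetUp)

include hsetup

/-- Unpacks the set-up assumption: the pointer that `u` expects in `r.info` was observed by a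
snapshot of `r` that was completed before `u` was created. -/
theorem scx_facts {t u r} (h0 : u ≠ 0) (hu : u < (e.cfg t).nScx) (hr : r ∈ (e.data u).V) :
    ∃ s p V R fld new l d m ms t', s < t ∧ e.act s = .invoke p (.scx V R fld new) ∧
      (e.cfg s).nScx = u ∧ r ∈ V ∧ e.Linked l s r ∧ t' < s ∧ e.Returns l t' (.snapshot ms) ∧
      e.IsSnapshot p l t' r ms d m ((e.data u).infoFields r) := by
  obtain ⟨s, hs, p, V, R, fld, new, ha, rfl⟩ := e.exists_invoke h0 hu
  have hrV : r ∈ V := by rwa [← (e.data_of_invoke ha).V] at hr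
  obtain ⟨l, hl⟩ := hsetup s p _ ha r hrV
  obtain ⟨d, m, ms, t', h1, h2, h3, -⟩ := hl.scx_isSnapshot e ha
  exact ⟨s, p, V, R, fld, new, l, d, m, ms, t', hs, ha, rfl, hrV, hl, h1, h2, h3⟩

theorem mem_V_lt_nRec {t u r} (h0 : u ≠ 0) (hu : u < (e.cfg t).nScx) (hr : r ∈ (e.data u).V) :
    r < (e.cfg t).nRec := by
  obtain ⟨s, p, V, R, fld, new, l, d, m, ms, t', h1, h2, h3, h4, h5, h6, h7, h8⟩ :=
    scx_facts hsetup h0 hu hr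
  have h9 := h8.nRec
  have := h8.lt_point; have := h8.point_lt
  exact h9.trans_le (e.nRec_mono (by omega))

/-- The expected pointer was in `r.info` at the snapshot, hence allocated by then, and `u` was
allocated afterwards. This is the source of all monotonicity of info fields. -/
theorem infoFields_lt {t u r} (h0 : u ≠ 0) (hu : u < (e.cfg t).nScx) (hr : r ∈ (e.data u).V) :
    (e.data u).infoFields r < u := by
  obtain ⟨s, p, V, R, fld, new, l, d, m, ms, t', h1, h2, h3, h4, h5, h6, h7, h8⟩ :=
    scx_facts hsetup h0 hu hr
  have h9 := h8.nRec
  have := h8.lt_point; have := h8.point_lt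
  rw [← h8.info]
  calc _ < (e.cfg d).nScx := e.info_lt_nScx (h9.trans_le (e.nRec_mono (by omega)))
    _ ≤ (e.cfg s).nScx := e.nScx_mono (by omega)
    _ = u := h3

/-- Only a successful freezing CAS changes an info field, and it replaces `infoFields r` by the
larger address `u`. -/
theorem info_lt_of_change {t r} (hr : r < (e.cfg t).nRec)
    (h : ((e.cfg (t + 1)).recs r).info ≠ ((e.cfg t).recs r).info) :
    ∃ u, ((e.cfg (t + 1)).recs r).info = u ∧ u ≠ 0 ∧ u < (e.cfg t).nScx ∧ r ∈ (e.data u).V ∧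
      ((e.cfg t).recs r).info = (e.data u).infoFields r ∧ ((e.cfg t).recs r).info < u := by
  rcases e.info_succ hr with h1 | ⟨p, u, rs, k, _, h1, h2, h3⟩
  · exact absurd h1 h
  · obtain ⟨h4, h5⟩ := e.helping_valid (t := t) (p := p) (u := u) (k := k) (by rw [h1]; rfl)
    have h6 := e.mem_V_of_helpFreeze h1
    rw [(e.sameData h5).infoFields] at h2
    exact ⟨u, h3, h4, h5, h6, h2, h2 ▸ infoFields_lt hsetup h4 h5 h6⟩

theorem info_mono {t t' r} (h : t ≤ t') (hr : r < (e.cfg t).nRec) :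
    ((e.cfg t).recs r).info ≤ ((e.cfg t').recs r).info := by
  induction t', h using Nat.le_induction with
  | base => exact le_rfl
  | succ s hs ih =>
    refine ih.trans ?_
    by_cases hne : ((e.cfg (s + 1)).recs r).info = ((e.cfg s).recs r).info
    · exact hne.ge
    · obtain ⟨u, h1, _, _, _, _, h2⟩ := info_lt_of_change hsetup (hr.trans_le (e.nRec_mono hs)) hne
      rw [h1]; exact h2.le

/-- An info pointer between two times at which it has the same value. -/
theorem info_eq_of_mem_Icc {a s b r} (h1 : a ≤ s) (h2 : s ≤ b) (hr : r < (e.cfg a).nRec)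
    (h : ((e.cfg a).recs r).info = ((e.cfg b).recs r).info) :
    ((e.cfg s).recs r).info = ((e.cfg a).recs r).info := by
  exact le_antisymm (h ▸ info_mono hsetup h2 (hr.trans_le (e.nRec_mono h1)))
    (info_mono hsetup h1 hr)

omit hsetup in
/-- The SCX-record found in the info field by a snapshot is not in progress. -/
theorem IsSnapshot.done {p l t r ms d m u} (h : e.IsSnapshot p l t r ms d m u) {a s}
    (ha : l < a) (hs : d ≤ s) : ((e.cfg s).scxs u).state ≠ .inProgress := by
  obtain ⟨⟨b, c, h1, h2, h3, h4, h5⟩, -⟩ := h.collected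
  obtain ⟨a₀, a₁, h6, h7, h8, h9, h10⟩ := h1
  have hu : u < (e.cfg b).nScx := by
    rw [← h10]
    have := h.nRec
    exact (e.info_lt_nScx (this.trans_le (e.nRec_mono (by omega)))).trans_le (e.nScx_mono (by omega))
  refine e.done_mono (by omega) hu ?_
  rcases h4 with h4 | h4
  · rw [h4]; simp
  · rw [h4.1]; simp

/-- A snapshot is returned only if the SCX-record found in the info field was seen aborted or
committed, and leaving the state `inProgress` is irrevocable. -/
theorem infoFields_done {t u r} (h0 : u ≠ 0) (hu : u < (e.cfg t).nScx) (hr : r ∈ (e.data u).V) :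
    ((e.cfg t).scxs ((e.data u).infoFields r)).state ≠ .inProgress := by
  obtain ⟨s, p, V, R, fld, new, l, d, m, ms, t', h1, h2, h3, h4, h5, h6, h7, h8⟩ :=
    scx_facts hsetup h0 hu hr
  have := h8.lt_point; have := h8.point_lt
  exact h8.done (a := d) (by omega) (by omega)

theorem infoFields_le_info {t u r} (h0 : u ≠ 0) (hu : u < (e.cfg t).nScx) (hr : r ∈ (e.data u).V) :
    (e.data u).infoFields r ≤ ((e.cfg t).recs r).info := by
  obtain ⟨s, p, V, R, fld, new, l, d, m, ms, t', h1, h2, h3, h4, h5, h6, h7, h8⟩ :=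
    scx_facts hsetup h0 hu hr
  have := h8.lt_point; have := h8.point_lt
  have h9 := h8.nRec
  rw [← h8.info]
  exact info_mono hsetup (by omega) (h9.trans_le (e.nRec_mono (by omega)))

omit hsetup
variable (e)

/-- The info field of `r` has pointed to `u` at or before `t`. -/
def Reached (t : ℕ) (u : ScxPtr) (r : RecId) : Prop :=
  ∃ s ≤ t, r < (e.cfg s).nRec ∧ ((e.cfg s).recs r).info = u

/-- The info field of `r` has changed before it could be set to `u`. -/
def Passed (t : ℕ) (u : ScxPtr) (r : RecId) : Prop :=
  (e.data u).infoFields r < ((e.cfg t).recs r).info ∧ ¬ e.Reached t u r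

/-- The SCX-record `u` cannot be frozen for all records of its sequence. -/
def Blocked (t : ℕ) (u : ScxPtr) : Prop :=
  ∃ d r rs, (e.data u).V = d ++ r :: rs ∧ (∀ x ∈ d, e.Reached t u x) ∧ e.Passed t u r

variable {e}

theorem Reached.mono {t t' u r} (h : e.Reached t u r) (ht : t ≤ t') : e.Reached t' u r := by
  obtain ⟨s, h1, h2⟩ := h
  exact ⟨s, h1.trans ht, h2⟩

include hsetup

theorem Reached.le_info {t u r} (h : e.Reached t u r) : u ≤ ((e.cfg t).recs r).info := by
  obtain ⟨s, h1, h2, rfl⟩ := h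
  exact info_mono hsetup h1 h2

/-- To move `r.info` away from `u`, some `SCX` must expect `u` there, and expected SCX-records are
no longer in progress. So the freeze of `r` lasts at least as long as `u` is in progress. -/
theorem Reached.done {t u r} (h : e.Reached t u r) (hne : ((e.cfg t).recs r).info ≠ u) :
    ((e.cfg t).scxs u).state ≠ .inProgress := by
  obtain ⟨s, h1, h2, h3⟩ := h
  induction t, h1 using Nat.le_induction with
  | base => exact absurd h3 hne
  | succ t hst ih =>
    have hr := h2.trans_le (e.nRec_mono hst)
    have hu : u < (e.cfg t).nScx := by
      rw [← h3]
      exact (e.info_lt_nScx h2).trans_le (e.nScx_mono hst)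
    refine e.done_mono (Nat.le_succ t) hu ?_
    by_cases hc : ((e.cfg t).recs r).info = u
    · obtain ⟨w, h4, h5, h6, h7, h8, h9⟩ := info_lt_of_change hsetup hr (by rw [hc]; exact hne)
      have := infoFields_done hsetup h5 h6 h7
      rwa [← h8, hc] at this
    · exact ih hc

/-- Freezing `r` for `u` requires `r.info` to equal the expected pointer, but the info field is
already larger and never decreases. -/
theorem Passed.mono {t t' u r} (h : e.Passed t u r) (ht : t ≤ t') (h0 : u ≠ 0)
    (hu : u < (e.cfg t).nScx) (hr : r ∈ (e.data u).V) : e.Passed t' u r := by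
  induction t', ht using Nat.le_induction with
  | base => exact h
  | succ s hs ih =>
    have hrN := (mem_V_lt_nRec hsetup h0 hu hr).trans_le (e.nRec_mono hs)
    refine ⟨ih.1.trans_le (info_mono hsetup (Nat.le_succ s) hrN), ?_⟩
    rintro ⟨x, h1, h2, h3⟩
    rcases h1.lt_or_eq with h4 | rfl
    · exact ih.2 ⟨x, by omega, h2, h3⟩
    · have hne : ((e.cfg (s + 1)).recs r).info ≠ ((e.cfg s).recs r).info := fun heq =>
        ih.2 ⟨s, le_rfl, hrN, heq ▸ h3⟩
      obtain ⟨w, h5, _, _, _, h6, _⟩ := info_lt_of_change hsetup hrN hne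
      rw [h3] at h5; subst h5
      exact ih.1.ne' h6

theorem Blocked.mono {t t' u} (h : e.Blocked t u) (ht : t ≤ t') (h0 : u ≠ 0)
    (hu : u < (e.cfg t).nScx) : e.Blocked t' u := by
  obtain ⟨d, r, rs, h1, h2, h3⟩ := h
  exact ⟨d, r, rs, h1, fun x hx => (h2 x hx).mono ht, h3.mono hsetup ht h0 hu (by simp [h1])⟩

end Execution

/-! ### The safety invariant of `Help`, and the permanence of finalization. -/

namespace Execution

variable {P Val : Type*} [DecidableEq P] [DecidableEq Val] [Inhabited Val]
  {refs : Val → Set RecId} (e : Execution P refs)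

/-- An update CAS for the SCX-record `u` is performed at time `s`. -/
def UpdatedAt (s : ℕ) (u : ScxPtr) : Prop :=
  ∃ q k, e.act s = .run q ∧ ((e.cfg s).procs q).pc = .helpUpdate u k

/-- What is known about the SCX-record that a process is helping. -/
def HelpInv (t : ℕ) : PC Val → Prop
  | .helpFreeze u rs _ => ∃ d, (e.data u).V = d ++ rs ∧ ∀ x ∈ d, e.Reached t u x
  | .helpCheck u r rs _ => ∃ d, (e.data u).V = d ++ r :: rs ∧ (∀ x ∈ d, e.Reached t u x) ∧
      (e.data u).infoFields r < ((e.cfg t).recs r).info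
  | .helpFrozenCheck u _ => ((e.cfg t).scxs u).state ≠ .inProgress ∨ e.Blocked t u
  | .helpAbort u _ => e.Blocked t u
  | .helpFrozen u _ => ∀ x ∈ (e.data u).V, e.Reached t u x
  | .helpMark u rs _ => ((e.cfg t).scxs u).allFrozen = true ∧
      ∃ d, (e.data u).R = d ++ rs ∧ ∀ x ∈ d, ((e.cfg t).recs x).marked = true
  | .helpUpdate u _ => ((e.cfg t).scxs u).allFrozen = true ∧
      ∀ x ∈ (e.data u).R, ((e.cfg t).recs x).marked = true
  | .helpCommit u _ => ((e.cfg t).scxs u).allFrozen = true ∧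
      (∀ x ∈ (e.data u).R, ((e.cfg t).recs x).marked = true) ∧ ∃ s < t, e.UpdatedAt s u
  | _ => True

/-- What the fields of an SCX-record imply. -/
structure ScxStateInv (t : ℕ) (u : ScxPtr) : Prop where
  aborted : ((e.cfg t).scxs u).state = .aborted → e.Blocked t u
  committed : ((e.cfg t).scxs u).state = .committed → ((e.cfg t).scxs u).allFrozen = true ∧
      (∀ x ∈ (e.data u).R, ((e.cfg t).recs x).marked = true) ∧ ∃ s < t, e.UpdatedAt s u
  allFrozen : ((e.cfg t).scxs u).allFrozen = true → ∀ x ∈ (e.data u).V, e.Reached t u x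

variable {e} (hsetup : e.SetUp)
include hsetup

theorem Blocked.not_reached {t u} (h : e.Blocked t u) : ¬ ∀ x ∈ (e.data u).V, e.Reached t u x := by
  obtain ⟨d, r, rs, h1, h2, h3⟩ := h
  exact fun h => h3.2 (h r (by simp [h1]))

theorem marked_R_mono {t t' u} (h : t ≤ t') (h0 : u ≠ 0) (hu : u < (e.cfg t).nScx)
    (hm : ∀ x ∈ (e.data u).R, ((e.cfg t).recs x).marked = true) :
    ∀ x ∈ (e.data u).R, ((e.cfg t').recs x).marked = true := fun x hx =>
  e.marked_mono h (mem_V_lt_nRec hsetup h0 hu ((e.R_subset_V h0 hu).subset hx)) (hm x hx)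

theorem mem_R_lt_nRec {t u r} (h0 : u ≠ 0) (hu : u < (e.cfg t).nScx) (hr : r ∈ (e.data u).R) :
    r < (e.cfg t).nRec := mem_V_lt_nRec hsetup h0 hu ((e.R_subset_V h0 hu).subset hr)

theorem HelpInv.succ {t} {pc : PC Val} (h : e.HelpInv t pc)
    (hv : ∀ u k, pc.helping = some (u, k) → u ≠ 0 ∧ u < (e.cfg t).nScx)
    (hsh : e.HelpShape pc) : e.HelpInv (t + 1) pc := by
  have ht := Nat.le_succ t
  cases hh : pc.helping with
  | none => cases pc <;> simp only [PC.helping, reduceCtorEq] at hh <;> trivial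
  | some x =>
    obtain ⟨u, k⟩ := x
    obtain ⟨h0, hu⟩ := hv u k hh
    cases pc <;> simp [PC.helping] at hh <;> obtain ⟨rfl, rfl⟩ := hh <;>
      simp only [HelpInv, HelpShape] at h hsh ⊢
    case helpFreeze =>
      obtain ⟨d, h1, h2⟩ := h
      exact ⟨d, h1, fun x hx => (h2 x hx).mono ht⟩
    case helpCheck =>
      obtain ⟨d, h1, h2, h3⟩ := h
      exact ⟨d, h1, fun x hx => (h2 x hx).mono ht,
        h3.trans_le (info_mono hsetup ht (mem_V_lt_nRec hsetup h0 hu (by simp [h1])))⟩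
    case helpFrozenCheck => exact h.imp (e.done_mono ht hu) fun h => h.mono hsetup ht h0 hu
    case helpAbort => exact h.mono hsetup ht h0 hu
    case helpFrozen => exact fun x hx => (h x hx).mono ht
    case helpMark =>
      obtain ⟨h1, d, h2, h3⟩ := h
      exact ⟨e.allFrozen_mono ht hu h1, d, h2, fun x hx =>
        e.marked_mono ht (mem_R_lt_nRec hsetup h0 hu (by simp [h2, hx])) (h3 x hx)⟩
    case helpUpdate =>
      exact ⟨e.allFrozen_mono ht hu h.1, marked_R_mono hsetup ht h0 hu h.2⟩
    case helpCommit =>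
      obtain ⟨h1, h2, s, h3, h4⟩ := h
      exact ⟨e.allFrozen_mono ht hu h1, marked_R_mono hsetup ht h0 hu h2, s, by omega, h4⟩

/-- The two halves need each other: the words of an SCX-record are written by helpers, so their
meaning comes from the invariant of the helper that wrote them, while a helper at the abort decision
relies on what the state and `allFrozen` already mean. -/
theorem safety (t : ℕ) : (∀ u, u ≠ 0 → u < (e.cfg t).nScx → e.ScxStateInv t u) ∧
    ∀ p, e.HelpInv t ((e.cfg t).procs p).pc := by
  induction t with
  | zero =>
    refine ⟨fun u h0 hu => ?_, fun p => ?_⟩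
    · rw [e.initial.nScx] at hu; omega
    · rw [e.initial.idle p]; trivial
  | succ t ih =>
    obtain ⟨ih1, ih2⟩ := ih
    have ht := Nat.le_succ t
    refine ⟨fun u h0 hu => ?_, fun p => ?_⟩
    · by_cases hu' : u < (e.cfg t).nScx
      · have old := ih1 u h0 hu'
        have hcom : ((e.cfg t).scxs u).allFrozen = true ∧
            (∀ x ∈ (e.data u).R, ((e.cfg t).recs x).marked = true) ∧ (∃ s < t, e.UpdatedAt s u) →
            ((e.cfg (t + 1)).scxs u).allFrozen = true ∧
            (∀ x ∈ (e.data u).R, ((e.cfg (t + 1)).recs x).marked = true) ∧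
            ∃ s < t + 1, e.UpdatedAt s u := fun ⟨h1, h2, s, h3, h4⟩ =>
          ⟨e.allFrozen_mono ht hu' h1, marked_R_mono hsetup ht h0 hu' h2, s, by omega, h4⟩
        refine ⟨fun h => ?_, fun h => ?_, fun h => ?_⟩
        · rcases e.state_succ hu' with h1 | ⟨p, k, _, h1, _⟩ | ⟨p, k, _, _, h1⟩
          · exact (old.aborted (h1 ▸ h)).mono hsetup ht h0 hu'
          · have := ih2 p
            rw [h1] at this
            exact Blocked.mono hsetup this ht h0 hu'
          · rw [h] at h1; cases h1
        · rcases e.state_succ hu' with h1 | ⟨p, k, _, _, h1⟩ | ⟨p, k, _, h1, _⟩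
          · exact hcom (old.committed (h1 ▸ h))
          · rw [h] at h1; cases h1
          · have := ih2 p
            rw [h1] at this
            exact hcom this
        · rcases e.allFrozen_succ hu' with h1 | ⟨p, k, _, h1, _⟩
          · exact fun x hx => (old.allFrozen (h1 ▸ h) x hx).mono ht
          · have := ih2 p
            rw [h1] at this
            exact fun x hx => (this x hx).mono ht
      · rcases e.nScx_succ t with h | ⟨p, V, R, fld, new, _, h, h'⟩
        · omega
        · obtain rfl : u = (e.cfg t).nScx := by omega
          constructor <;> simp [h']
    · rcases e.pc_succ t p with ⟨h1, _⟩ | ⟨hrun, _, h2⟩ | ⟨op, ha, _, h2, hok⟩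
      · rw [h1]
        exact (ih2 p).succ hsetup (fun u k h => e.helping_valid h) (e.helpShape t p)
      · have hI := ih2 p
        have hS := e.helpShape t p
        have hv := fun u k => e.helping_valid (t := t) (p := p) (u := u) (k := k)
        have hI' := hI.succ hsetup hv hS
        have hv0 := (e.valid_all t).2.2 p
        have hS' := e.helpShape (t + 1) p
        have hnext := e.next_run hrun
        generalize hpc : ((e.cfg t).procs p).pc = pc at h2 hI hS hv hI' hv0
        generalize ((e.cfg (t + 1)).procs p).pc = pc' at h2 hS'
        have hret : ∀ (k : Cont) b, e.HelpInv (t + 1) (k.retPC b) := by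
          intro k b
          rcases k.retPC_cases (Val := Val) b with
              ⟨_, h1⟩ | ⟨_, _, _, h1⟩ | ⟨r, m, h2, _, h1⟩ | ⟨_, h1⟩ <;>
            rw [h1] <;> trivial
        cases h2 <;> try trivial
        case testHelp => exact ⟨[], by simp [(e.sameData hv0.2).V], by simp⟩
        case failHelp => exact ⟨[], by simp [(e.sameData (e.info_lt_nScx hv0.1)).V], by simp⟩
        case allFrozen u k =>
          obtain ⟨d, h1, h2⟩ := hI'
          simpa [HelpInv, h1] using h2
        case freeze u r rs k hr =>
          obtain ⟨h0, hu⟩ := hv u k rfl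
          obtain ⟨d, h1, h2⟩ := hI'
          refine ⟨d ++ [r], by simp [h1], fun x hx => ?_⟩
          rcases List.mem_append.1 hx with hx | hx
          · exact h2 x hx
          · cases List.mem_singleton.1 hx
            have hN := mem_V_lt_nRec hsetup h0 hu (show r ∈ (e.data u).V by simp [h1])
            refine ⟨t + 1, le_rfl, hN.trans_le (e.nRec_mono ht), ?_⟩
            rw [hnext, Config.runStep_info_of_helpFreeze _ hpc hr]
        case freezeFail u r rs k hr =>
          obtain ⟨h0, hu⟩ := hv u k rfl
          obtain ⟨d, h1, h2⟩ := hI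
          have hrV : r ∈ (e.data u).V := by simp [h1]
          refine ⟨d, h1, fun x hx => (h2 x hx).mono ht, ?_⟩
          rw [(e.sameData hu).infoFields] at hr
          exact (lt_of_le_of_ne (infoFields_le_info hsetup h0 hu hrV) (Ne.symm hr)).trans_le
            (info_mono hsetup ht (mem_V_lt_nRec hsetup h0 hu hrV))
        case checkOK u r rs k hr =>
          obtain ⟨h0, hu⟩ := hv u k rfl
          obtain ⟨d, h1, h2, h3⟩ := hI'
          refine ⟨d ++ [r], by simp [h1], fun x hx => ?_⟩
          rcases List.mem_append.1 hx with hx | hx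
          · exact h2 x hx
          · cases List.mem_singleton.1 hx
            exact ⟨t, ht, mem_V_lt_nRec hsetup h0 hu (by simp [h1]), hr⟩
        case checkFail u r rs k hr =>
          obtain ⟨h0, hu⟩ := hv u k rfl
          obtain ⟨d, h1, h2, h3⟩ := hI
          -- If `r` was once frozen for `u` and is so no longer, then `u` is finished. Otherwise `r`
          -- was passed before `u` reached it, and together with the frozen prefix this blocks `u`.
          by_cases hR : e.Reached t u r
          · exact .inl (e.done_mono ht hu (hR.done hsetup hr))
          · exact .inr (Blocked.mono hsetup ⟨d, r, rs, h1, h2, h3, hR⟩ ht h0 hu)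
        case frozenCheck => exact hret _ _
        case toAbort u k hf =>
          obtain ⟨h0, hu⟩ := hv u k rfl
          -- A finished `u` with `allFrozen` false cannot be committed, so it is aborted and hence
          -- blocked.
          have : e.Blocked t u := by
            rcases hI with h | h
            · have hi := ih1 u h0 hu
              cases hst : ((e.cfg t).scxs u).state with
              | inProgress => exact absurd hst h
              | committed => have := (hi.committed hst).1; simp [hf] at this
              | aborted => exact hi.aborted hst
            · exact h
          exact this.mono hsetup ht h0 hu
        case helpAbort => exact hret _ _
        case helpFrozen u k =>
          obtain ⟨h0, hu⟩ := hv u k rfl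
          refine ⟨?_, [], by simp [(e.sameData hu).R], by simp⟩
          rw [hnext, Config.runStep_allFrozen_of_helpFrozen _ hpc]
        case marked u k =>
          obtain ⟨h1, d, h2, h3⟩ := hI'
          exact ⟨h1, fun x hx => h3 x (by simpa [h2] using hx)⟩
        case helpMark u r rs k =>
          obtain ⟨h1, d, h2, h3⟩ := hI'
          refine ⟨h1, d ++ [r], by simp [h2], fun x hx => ?_⟩
          rcases List.mem_append.1 hx with hx | hx
          · exact h3 x hx
          · cases List.mem_singleton.1 hx
            rw [hnext, Config.runStep_marked_of_helpMark _ hpc]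
        case helpUpdate u k =>
          exact ⟨hI'.1, hI'.2, t, Nat.lt_succ_self t, p, k, hrun, hpc⟩
        case helpCommit => exact hret _ _
      · rw [h2]
        cases op with
        | scx V R fld new =>
          exact ⟨[], by simp [← (e.data_of_invoke ha).V], by simp⟩
        | llx r => trivial
        | vlx V => trivial
        | read r f => trivial

/-! ### Consequences for the states of SCX-records -/

theorem blocked_of_aborted {t u} (h0 : u ≠ 0) (hu : u < (e.cfg t).nScx)
    (h : ((e.cfg t).scxs u).state = .aborted) : e.Blocked t u :=
  ((safety hsetup t).1 u h0 hu).aborted h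

theorem reached_of_allFrozen {t u r} (h0 : u ≠ 0) (hu : u < (e.cfg t).nScx)
    (h : ((e.cfg t).scxs u).allFrozen = true) (hr : r ∈ (e.data u).V) : e.Reached t u r :=
  ((safety hsetup t).1 u h0 hu).allFrozen h r hr

theorem committed_facts {t u} (h0 : u ≠ 0) (hu : u < (e.cfg t).nScx)
    (h : ((e.cfg t).scxs u).state = .committed) : ((e.cfg t).scxs u).allFrozen = true ∧
      (∀ x ∈ (e.data u).R, ((e.cfg t).recs x).marked = true) ∧ ∃ s < t, e.UpdatedAt s u :=
  ((safety hsetup t).1 u h0 hu).committed h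

/-- Freezing and aborting exclude each other. -/
theorem not_blocked_of_allFrozen {s t u} (h0 : u ≠ 0) (hs : u < (e.cfg s).nScx)
    (ht : u < (e.cfg t).nScx) (h : ((e.cfg s).scxs u).allFrozen = true) : ¬ e.Blocked t u := by
  intro hb
  have h1 := hb.mono hsetup (le_max_right s t) h0 ht
  have h2 := e.allFrozen_mono (le_max_left s t) hs h
  exact h1.not_reached hsetup fun x hx =>
    reached_of_allFrozen hsetup h0 (hs.trans_le (e.nScx_mono (le_max_left s t))) h2 hx

theorem not_aborted_of_allFrozen {s t u} (h0 : u ≠ 0) (hs : u < (e.cfg s).nScx)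
    (ht : u < (e.cfg t).nScx) (h : ((e.cfg s).scxs u).allFrozen = true) :
    ((e.cfg t).scxs u).state ≠ .aborted := fun hb =>
  not_blocked_of_allFrozen hsetup h0 hs ht h (blocked_of_aborted hsetup h0 ht hb)

theorem committed_mono {t t' u} (h : t ≤ t') (h0 : u ≠ 0) (hu : u < (e.cfg t).nScx)
    (hc : ((e.cfg t).scxs u).state = .committed) : ((e.cfg t').scxs u).state = .committed := by
  have h1 := not_aborted_of_allFrozen hsetup h0 hu (hu.trans_le (e.nScx_mono h))
    (committed_facts hsetup h0 hu hc).1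
  have h2 := e.done_mono h hu (by rw [hc]; simp)
  cases hst : ((e.cfg t').scxs u).state <;> simp_all

theorem aborted_mono {t t' u} (h : t ≤ t') (h0 : u ≠ 0) (hu : u < (e.cfg t).nScx)
    (hc : ((e.cfg t).scxs u).state = .aborted) : ((e.cfg t').scxs u).state = .aborted := by
  have h2 := e.done_mono h hu (by rw [hc]; simp)
  have hu' := hu.trans_le (e.nScx_mono h)
  cases hst : ((e.cfg t').scxs u).state with
  | inProgress => exact absurd hst h2
  | aborted => rfl
  | committed =>
    exact absurd hc (not_aborted_of_allFrozen hsetup h0 hu' hu (committed_facts hsetup h0 hu' hst).1)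

omit hsetup in
theorem UpdatedAt.valid {s u} (h : e.UpdatedAt s u) : u ≠ 0 ∧ u < (e.cfg s).nScx := by
  obtain ⟨q, k, _, h⟩ := h
  exact e.helping_valid (t := s) (p := q) (u := u) (k := k) (by rw [h]; rfl)

theorem UpdatedAt.facts {s u} (h : e.UpdatedAt s u) : ((e.cfg s).scxs u).allFrozen = true ∧
    ∀ x ∈ (e.data u).R, ((e.cfg s).recs x).marked = true := by
  obtain ⟨q, k, _, h⟩ := h
  have := (safety hsetup s).2 q
  rwa [h] at this

/-! ### Finalized records -/

/-- No `SCX` can be set up on the basis of an SCX-record that finalizes the record. -/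
theorem infoFields_ne {s t u w r} (h0 : u ≠ 0) (hu : u < (e.cfg s).nScx)
    (haf : ((e.cfg s).scxs u).allFrozen = true) (hr : r ∈ (e.data u).R) (hw : w ≠ 0)
    (hwt : w < (e.cfg t).nScx) (hrw : r ∈ (e.data w).V) : (e.data w).infoFields r ≠ u := by
  intro heq
  obtain ⟨x, p, V, R, fld, new, l, d, m, ms, t', h1, h2, h3, h4, h5, h6, h7, h8⟩ :=
    scx_facts hsetup hw hwt hrw
  rw [heq] at h8
  obtain ⟨⟨b, c, ⟨a₀, a, ha1, ha2, ha3, ha4, ha5⟩, h10, h11, h12, -⟩, -⟩ := h8.collected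
  have hN : r < (e.cfg a).nRec := h8.nRec.trans_le (e.nRec_mono (by omega))
  have hub : u < (e.cfg b).nScx := by
    rw [← ha5]; exact (e.info_lt_nScx hN).trans_le (e.nScx_mono ha3.le)
  -- The snapshot saw `u` either aborted, which is impossible once all records are frozen, or
  -- committed; then `r` was already marked, and the later read of the mark would have been true.
  rcases h12 with h12 | ⟨h12, h13⟩
  · exact not_aborted_of_allFrozen hsetup h0 hu hub haf h12
  · have := (committed_facts hsetup h0 hub h12).2.1 r hr
    have := e.marked_mono h10.le (hN.trans_le (e.nRec_mono ha3.le)) this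
    rw [h13] at this; cases this

/-- The info field of a record never changes again after it has been frozen for an `SCX` that
finalizes it and that does not abort. -/
theorem info_eq_of_allFrozen {t u r} (h0 : u ≠ 0) (hu : u < (e.cfg t).nScx)
    (haf : ((e.cfg t).scxs u).allFrozen = true) (hr : r ∈ (e.data u).R) :
    ((e.cfg t).recs r).info = u := by
  obtain ⟨s, h1, h2, h3⟩ := reached_of_allFrozen hsetup h0 hu haf ((e.R_subset_V h0 hu).subset hr)
  have key : ∀ t' ≥ s, ((e.cfg t').recs r).info = u := by
    intro t' ht'
    induction t', ht' using Nat.le_induction with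
    | base => exact h3
    | succ x hx ih =>
      by_contra hne
      obtain ⟨w, h4, h5, h6, h7, h8, h9⟩ :=
        info_lt_of_change hsetup (h2.trans_le (e.nRec_mono hx)) (ih.symm ▸ hne)
      exact infoFields_ne hsetup h0 hu haf hr h5 h6 h7 (h8 ▸ ih)
  exact key t h1

/-- A record is only marked on behalf of an `SCX` that finalizes it. -/
theorem exists_of_marked {t r} (hr : r < (e.cfg t).nRec) (hm : ((e.cfg t).recs r).marked = true) :
    ∃ u, u ≠ 0 ∧ u < (e.cfg t).nScx ∧ r ∈ (e.data u).R ∧ ((e.cfg t).scxs u).allFrozen = true ∧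
      ((e.cfg t).recs r).info = u := by
  suffices ∃ u, u ≠ 0 ∧ u < (e.cfg t).nScx ∧ r ∈ (e.data u).R ∧
      ((e.cfg t).scxs u).allFrozen = true by
    obtain ⟨u, h0, h1, h2, h3⟩ := this
    exact ⟨u, h0, h1, h2, h3, info_eq_of_allFrozen hsetup h0 h1 h3 h2⟩
  induction t with
  | zero => rw [e.initial.unmarked r hr] at hm; cases hm
  | succ t ih =>
    by_cases hr' : r < (e.cfg t).nRec
    · rcases e.marked_succ hr' with h1 | ⟨p, u, rs, k, _, h1, _⟩
      · obtain ⟨u, h2, h3, h4, h5⟩ := ih hr' (h1 ▸ hm)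
        exact ⟨u, h2, h3.trans_le (e.nScx_mono (Nat.le_succ t)), h4,
          e.allFrozen_mono (Nat.le_succ t) h3 h5⟩
      · obtain ⟨h2, h3⟩ := e.helping_valid (t := t) (p := p) (u := u) (k := k) (by rw [h1]; rfl)
        have := (safety hsetup t).2 p
        rw [h1] at this
        exact ⟨u, h2, h3.trans_le (e.nScx_mono (Nat.le_succ t)), e.mem_R_of_helpMark h1,
          e.allFrozen_mono (Nat.le_succ t) h3 this.1⟩
    · rcases e.nRec_succ t with h | ⟨_, _, _, _, h1, h2⟩
      · omega
      · obtain rfl : r = (e.cfg t).nRec := by omega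
        rw [h2] at hm; cases hm

/-- No snapshot of a record is taken after the first update CAS of an `SCX` that finalizes it. -/
theorem IsSnapshot.not_updatedAt {p l t r ms d m u} (h : e.IsSnapshot p l t r ms d m u) {s w}
    (hs : e.UpdatedAt s w) (hsd : s ≤ d) (hr : r ∈ (e.data w).R) : False := by
  obtain ⟨h0, hw⟩ := hs.valid
  have haf := (hs.facts hsetup).1
  have hd := e.allFrozen_mono hsd hw haf
  have hwd := hw.trans_le (e.nScx_mono hsd)
  obtain rfl : u = w := by rw [← h.info]; exact info_eq_of_allFrozen hsetup h0 hwd hd hr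
  obtain ⟨⟨b, c, ⟨a₀, a, ha1, ha2, ha3, ha4, ha5⟩, h10, h11, h12, -⟩, -⟩ := h.collected
  have hN : r < (e.cfg a).nRec := h.nRec.trans_le (e.nRec_mono (by omega))
  have hub : u < (e.cfg b).nScx := by
    rw [← ha5]; exact (e.info_lt_nScx hN).trans_le (e.nScx_mono ha3.le)
  -- The info field is stuck at the finalizing SCX-record, so the snapshot was based on it, and the
  -- dichotomy of `infoFields_ne` applies again.
  rcases h12 with h12 | ⟨h12, h13⟩
  · exact not_aborted_of_allFrozen hsetup h0 hwd hub hd h12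
  · have := (committed_facts hsetup h0 hub h12).2.1 r hr
    have := e.marked_mono h10.le (hN.trans_le (e.nRec_mono ha3.le)) this
    rw [h13] at this; cases this

end Execution

/-! ### First update CASs and the values of the mutable fields. -/

namespace Execution

variable {P Val : Type*} [DecidableEq P] [DecidableEq Val] [Inhabited Val]
  {refs : Val → Set RecId} (e : Execution P refs)

/-- The first update CAS for the SCX-record `u` is performed at time `s`. -/
def FirstUpdate (s : ℕ) (u : ScxPtr) : Prop :=
  e.UpdatedAt s u ∧ ∀ s' < s, ¬ e.UpdatedAt s' u

variable {e}

theorem scxPoint_iff {t p V R fld new s} (h : e.act t = .invoke p (.scx V R fld new)) :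
    e.ScxPoint t s ↔ e.FirstUpdate s (e.cfg t).nScx :=
  ⟨fun h' => h'.2, fun h' => ⟨⟨p, V, R, fld, new, h⟩, h'⟩⟩

theorem UpdatedAt.unique {s u u'} (h : e.UpdatedAt s u) (h' : e.UpdatedAt s u') : u = u' := by
  obtain ⟨q, k, h1, h2⟩ := h
  obtain ⟨q', k', h1', h2'⟩ := h'
  rw [h1] at h1'; cases h1'
  rw [h2] at h2'; cases h2'; rfl

theorem FirstUpdate.unique {s s' u} (h : e.FirstUpdate s u) (h' : e.FirstUpdate s' u) : s = s' := by
  rcases lt_trichotomy s s' with hlt | heq | hlt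
  · exact absurd h.1 (h'.2 s hlt)
  · exact heq
  · exact absurd h'.1 (h.2 s' hlt)

theorem exists_firstUpdate {s u} (h : e.UpdatedAt s u) : ∃ s' ≤ s, e.FirstUpdate s' u := by
  classical
  have hex : ∃ s, e.UpdatedAt s u := ⟨s, h⟩
  exact ⟨Nat.find hex, Nat.find_min' hex h, Nat.find_spec hex, fun m hm => Nat.find_min hex hm⟩

variable (hsetup : e.SetUp)
include hsetup

/-- Committing happens only after an update CAS, and aborting is incompatible with `allFrozen`. -/
theorem FirstUpdate.inProgress {s u} (h : e.FirstUpdate s u) :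
    ((e.cfg s).scxs u).state = .inProgress := by
  obtain ⟨h0, hu⟩ := h.1.valid
  cases hst : ((e.cfg s).scxs u).state with
  | inProgress => rfl
  | committed =>
    obtain ⟨-, -, s', h1, h2⟩ := committed_facts hsetup h0 hu hst
    exact absurd h2 (h.2 s' h1)
  | aborted => exact absurd hst (not_aborted_of_allFrozen hsetup h0 hu hu (h.1.facts hsetup).1)

/-- When an `SCX` is linearized, all records of its sequence are frozen for it. -/
theorem FirstUpdate.info {s u r} (h : e.FirstUpdate s u) (hr : r ∈ (e.data u).V) :
    ((e.cfg s).recs r).info = u := by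
  obtain ⟨h0, hu⟩ := h.1.valid
  -- A record that was frozen for `u` and has been lost since would show that `u` is no longer in
  -- progress.
  by_contra hne
  exact (reached_of_allFrozen hsetup h0 hu (h.1.facts hsetup).1 hr).done hsetup hne
    (h.inProgress hsetup)

/-- The change that puts `w` into `r.info` starts from the expected pointer. Used with monotonicity
to bound the info field at earlier times. -/
theorem exists_info_eq_infoFields {x y r w} (hxy : x ≤ y) (hr : r < (e.cfg x).nRec)
    (hx : ((e.cfg x).recs r).info ≠ w) (hy : ((e.cfg y).recs r).info = w) :
    ∃ z, x ≤ z ∧ z < y ∧ ((e.cfg z).recs r).info = (e.data w).infoFields r := by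
  induction y, hxy using Nat.le_induction with
  | base => exact absurd hy hx
  | succ y hxy ih =>
    by_cases hc : ((e.cfg y).recs r).info = w
    · obtain ⟨z, h1, h2, h3⟩ := ih hc
      exact ⟨z, h1, by omega, h3⟩
    · obtain ⟨u, h4, _, _, _, h5, _⟩ :=
        info_lt_of_change hsetup (hr.trans_le (e.nRec_mono hxy)) (by rw [hy]; exact Ne.symm hc)
      rw [hy] at h4; subst h4
      exact ⟨y, hxy, Nat.lt_succ_self y, h5⟩

/-- A snapshot, seen from the `SCX`s that are linearized around it: nothing is linearized as long as
the info field is the same as in the snapshot. -/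
theorem IsSnapshot.exists_start {p l t r ms d m u} (h : e.IsSnapshot p l t r ms d m u) :
    ∃ c, l < c ∧ c < d ∧
      (∀ (i : ℕ) v, ms[i]? = some v → ∃ a, c < a ∧ a < d ∧ ((e.cfg a).recs r).vals[i]? = some v) ∧
      (∀ s, c ≤ s → u ≤ ((e.cfg s).recs r).info) ∧
      (∀ s, c ≤ s → s ≤ d → ((e.cfg s).recs r).info = u) ∧
      ∀ s w, c ≤ s → ((e.cfg s).recs r).info = u → e.FirstUpdate s w → r ∉ (e.data w).V := by
  obtain ⟨⟨b, c, ⟨a₀, a, h1, h2, h3, h4, h5⟩, h6, h7, h8, h9⟩, -⟩ := h.collected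
  have hN : r < (e.cfg a).nRec := h.nRec.trans_le (e.nRec_mono (by omega))
  refine ⟨c, by omega, h7, h9, fun s hs => ?_, fun s hs hs' => ?_, fun s w hs hsu hw hr => ?_⟩
  · rw [← h5]; exact info_mono hsetup (by omega) hN
  · rw [← h5]
    exact info_eq_of_mem_Icc hsetup (by omega) hs' hN (h5.trans h.info.symm)
  -- An `SCX` on `r` linearized while `r.info` is `u` would have to be that of `u` itself, but `u`
  -- was seen finished before `c`.
  · have hwu : w = u := by rw [← hsu]; exact (hw.info hsetup hr).symm
    subst hwu
    have hu : w < (e.cfg b).nScx := by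
      rw [← h5]; exact (e.info_lt_nScx hN).trans_le (e.nScx_mono h3.le)
    refine e.done_mono (t' := s) (by omega) hu ?_ (hw.inProgress hsetup)
    rcases h8 with h8 | h8
    · rw [h8]; simp
    · rw [h8.1]; simp

/-- No `SCX` on `r` is linearized between the reads of the `LLX(r)` linked to an `SCX` and this
`SCX`. -/
theorem no_firstUpdate_between {p l t r ms d m u s} (h0 : u ≠ 0) (hr : r ∈ (e.data u).V)
    (hs : e.FirstUpdate s u)
    (h : e.IsSnapshot p l t r ms d m ((e.data u).infoFields r)) :
    ∃ c, l < c ∧ c < d ∧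
      (∀ (i : ℕ) v, ms[i]? = some v → ∃ a, c < a ∧ a < d ∧ ((e.cfg a).recs r).vals[i]? = some v) ∧
      ∀ s' w, c ≤ s' → s' < s → e.FirstUpdate s' w → r ∉ (e.data w).V := by
  obtain ⟨c, h1, h2, h3, h4, -, h5⟩ := h.exists_start hsetup
  refine ⟨c, h1, h2, h3, fun s' w hc hs' hw hrw => ?_⟩
  have hN : r < (e.cfg s').nRec := h.nRec.trans_le (e.nRec_mono (by omega))
  by_cases hu : ((e.cfg s').recs r).info = u
  · have : w = u := by rw [← hu]; exact (hw.info hsetup hrw).symm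
    subst this
    exact hs'.ne (hw.unique hs)
  -- Before `r.info` becomes `u` it still equals the expected pointer at some `z ≥ s'`. By
  -- monotonicity it has that value at `s'` too, where the snapshot rules out linearizations on `r`.
  · obtain ⟨z, h6, h7, h8⟩ := exists_info_eq_infoFields hsetup hs'.le hN hu (hs.info hsetup hr)
    refine h5 s' w hc (le_antisymm ?_ (h4 s' hc)) hw hrw
    rw [← h8]; exact info_mono hsetup h6 hN

omit hsetup

/-! ### Values of the mutable fields -/

variable (e)

/-- An `SCX` that stores `v` in the field `f` is linearized at `s`. -/
def Written (f : RecId × ℕ) (s : ℕ) (v : Val) : Prop :=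
  ∃ u, e.FirstUpdate s u ∧ (e.data u).fld = f ∧ (e.data u).new = v

/-- `v` is the last value written to `f` before `t`, or the initial value if there is none. -/
def LastWritten (f : RecId × ℕ) (t : ℕ) (v : Val) : Prop :=
  (∃ s < t, e.Written f s v ∧ ∀ s' v', s < s' → s' < t → ¬ e.Written f s' v') ∨
    ((∀ s v', s < t → ¬ e.Written f s v') ∧ ((e.cfg t).recs f.1).initVals[f.2]? = some v)

variable {e}

theorem Written.unique {f f' s v v'} (h : e.Written f s v) (h' : e.Written f' s v') :
    f = f' ∧ v = v' := by
  obtain ⟨u, h1, rfl, rfl⟩ := h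
  obtain ⟨u', h1', rfl, rfl⟩ := h'
  cases h1.1.unique h1'.1
  exact ⟨rfl, rfl⟩

theorem LastWritten.unique {f t v v'} (h : e.LastWritten f t v) (h' : e.LastWritten f t v') :
    v = v' := by
  rcases h with ⟨s, h1, h2, h3⟩ | ⟨h1, h2⟩ <;> rcases h' with ⟨s', h1', h2', h3'⟩ | ⟨h1', h2'⟩
  · rcases lt_trichotomy s s' with hlt | rfl | hlt
    · exact absurd h2' (h3 s' v' hlt h1')
    · exact (h2.unique h2').2
    · exact absurd h2 (h3' s v hlt h1)
  · exact absurd h2 (h1' s v h1)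
  · exact absurd h2' (h1 s' v' h1')
  · rw [h2] at h2'; exact Option.some_injective _ h2'

theorem LastWritten.of_no_write {f t t' v} (h : e.LastWritten f t v) (ht : t ≤ t')
    (hf : f.1 < (e.cfg t).nRec) (hno : ∀ s v', t ≤ s → s < t' → ¬ e.Written f s v') :
    e.LastWritten f t' v := by
  rcases h with ⟨s, h1, h2, h3⟩ | ⟨h1, h2⟩
  · refine .inl ⟨s, by omega, h2, fun s' v' hs hs' => ?_⟩
    rcases lt_or_ge s' t with h4 | h4
    · exact h3 s' v' hs h4
    · exact hno s' v' h4 hs'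
  · refine .inr ⟨fun s v' hs => ?_, by rw [e.initVals_eq ht hf, h2]⟩
    rcases lt_or_ge s t with h4 | h4
    · exact h1 s v' h4
    · exact hno s v' h4 hs

variable (hABA : e.NoABA)
include hsetup hABA

/-- The value stored by an `SCX` is new. -/
theorem FirstUpdate.new_fresh {s u} (h : e.FirstUpdate s u) :
    ((e.cfg s).recs (e.data u).fld.1).initVals[(e.data u).fld.2]? ≠ some (e.data u).new ∧
      ∀ s' < s, ¬ e.Written (e.data u).fld s' (e.data u).new := by
  obtain ⟨h0, hu⟩ := h.1.valid
  have hV := e.fld_mem_V h0 hu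
  obtain ⟨τ, p, V, R, fld, new, l, d, m, ms, t', h1, h2, rfl, h4, h5, h6, h7, h8⟩ :=
    scx_facts hsetup h0 hu hV
  have hd := e.data_of_invoke h2
  have hfld : (e.data (e.cfg τ).nScx).fld = fld := hd.fld.symm
  have hnew : (e.data (e.cfg τ).nScx).new = new := hd.new.symm
  have hN : fld.1 < (e.cfg τ).nRec := by
    have := h8.nRec; have := h8.lt_point; have := h8.point_lt
    rw [← hfld]
    exact h8.nRec.trans_le (e.nRec_mono (by omega))
  obtain ⟨hA1, hA2⟩ := hABA τ s p V R fld new h2 ((scxPoint_iff h2).2 h)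
  obtain ⟨c, hc1, hc2, -, hc3⟩ := no_firstUpdate_between hsetup h0 hV h h8
  rw [hnew]
  refine ⟨by rw [hfld, e.initVals_eq h1.le hN]; exact hA1, ?_⟩
  rintro s' hs' ⟨u', hu'1, hu'2, hu'3⟩
  obtain ⟨h0', hu'⟩ := hu'1.1.valid
  obtain ⟨τ', hτ', p', V', R', fld', new', ha', rfl⟩ := e.exists_invoke h0' hu'
  have hd' := e.data_of_invoke ha'
  have hf' : fld' = fld := hd'.fld.trans (hu'2.trans hfld)
  have hn' : new' = new := hd'.new.trans hu'3
  subst hf' hn'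
  have hpt := (e.snapshotPoint_iff h8 h7 d).2 rfl
  -- Constraint A excludes an equal write before the rereading step `d`. A write from `d` on lies
  -- after `c < d` and is excluded by freezing.
  have := hA2 l d (by rwa [hfld] at h5) hpt τ' p' V' R' s' ha' ((scxPoint_iff ha').2 hu'1)
  refine hc3 s' _ (by omega) hs' hu'1 ?_
  rw [← hu'2]; exact e.fld_mem_V h0' hu'

omit hABA in
/-- The value that an `SCX` expects is the last value written to the field before the `SCX`, provided
that this is how the values of fields have evolved so far. -/
theorem FirstUpdate.lastWritten_old {s u} (h : e.FirstUpdate s u)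
    (hval : ∀ t < s, ∀ r < (e.cfg t).nRec, ∀ i v, ((e.cfg t).recs r).vals[i]? = some v →
      e.LastWritten (r, i) t v) :
    e.LastWritten (e.data u).fld s (e.data u).old := by
  obtain ⟨h0, hu⟩ := h.1.valid
  have hV := e.fld_mem_V h0 hu
  obtain ⟨τ, hτ, p, V, R, fld, new, ha, rfl⟩ := e.exists_invoke h0 hu
  have hd := e.data_of_invoke ha
  have hfld : (e.data (e.cfg τ).nScx).fld = fld := hd.fld.symm
  rw [hfld] at hV ⊢
  obtain ⟨l, hl⟩ := hsetup τ p _ ha fld.1 (e.invoke_ok ha).2.1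
  obtain ⟨d, m, ms, t', h1, h2, h3, h4⟩ := hl.scx_isSnapshot e ha
  obtain ⟨c, hc1, hc2, hc3, hc4⟩ := no_firstUpdate_between hsetup h0 hV h h3
  have hN := h3.nRec
  have hlt := h3.point_lt
  have hi : fld.2 < ms.length := by
    rw [h3.length, ← e.length_vals_eq (t' := τ) (by omega) hN]
    exact (e.invoke_ok ha).2.2.1
  have hold : ms[fld.2]? = some (e.data (e.cfg τ).nScx).old := by
    rw [← hd.old]
    simp [h4, hi]
  -- The old value was read at `a`, and no `SCX` on this record is linearized between `a` and `s`,
  -- so the last written value at `a` is still the last one at `s`.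
  obtain ⟨a, ha1, ha2, ha3⟩ := hc3 _ _ hold
  have hNa : fld.1 < (e.cfg a).nRec := hN.trans_le (e.nRec_mono (by omega))
  refine (hval a (by omega) fld.1 hNa _ _ ha3).of_no_write (by omega) hNa ?_
  rintro s' v' hs hs' ⟨w, hw1, hw2, hw3⟩
  refine hc4 s' w (by omega) hs' hw1 ?_
  obtain ⟨h0', hu'⟩ := hw1.1.valid
  have := e.fld_mem_V h0' hu'
  rwa [hw2] at this

omit hABA in
theorem fld_lt {t u} (h0 : u ≠ 0) (hu : u < (e.cfg t).nScx) :
    (e.data u).fld.1 < (e.cfg t).nRec ∧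
      (e.data u).fld.2 < ((e.cfg t).recs (e.data u).fld.1).vals.length := by
  obtain ⟨τ, hτ, p, V, R, fld, new, ha, rfl⟩ := e.exists_invoke h0 hu
  have hfld : (e.data (e.cfg τ).nScx).fld = fld := (e.data_of_invoke ha).fld.symm
  obtain ⟨l, hl⟩ := hsetup τ p _ ha fld.1 (e.invoke_ok ha).2.1
  obtain ⟨d, m, ms, t', h1, h2, h3, h4⟩ := hl.scx_isSnapshot e ha
  have hN : fld.1 < (e.cfg τ).nRec := h3.nRec.trans_le (e.nRec_mono hl.1.le)
  rw [hfld, e.length_vals_eq hτ.le hN]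
  exact ⟨hN.trans_le (e.nRec_mono hτ.le), (e.invoke_ok ha).2.2.1⟩

/-- The mutable fields contain the last values written to them. -/
theorem lastWritten (t : ℕ) : ∀ r < (e.cfg t).nRec, ∀ i v, ((e.cfg t).recs r).vals[i]? = some v →
    e.LastWritten (r, i) t v := by
  induction t using Nat.strong_induction_on with
  | _ t ih =>
  rcases t with _ | t
  · intro r hr i v hv
    exact .inr ⟨fun s v' hs => by omega, by rwa [← e.initial.vals r hr]⟩
  intro r hr i v hv
  have ih' : ∀ s ≤ t, ∀ r < (e.cfg s).nRec, ∀ i v, ((e.cfg s).recs r).vals[i]? = some v →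
    e.LastWritten (r, i) s v := fun s hs => ih s (by omega)
  by_cases hr' : r < (e.cfg t).nRec
  · by_cases hw : ∃ v', e.Written (r, i) t v'
    · obtain ⟨v', hw⟩ := hw
      obtain ⟨u, hu1, hu2, hu3⟩ := id hw
      obtain ⟨h0, hu⟩ := hu1.1.valid
      have hold := hu1.lastWritten_old hsetup fun s hs => ih' s hs.le
      have hi := (fld_lt hsetup h0 hu).2
      -- At a first update CAS, the current value and the expected value are both the last written
      -- one; hence the CAS succeeds.
      have hcur : ((e.cfg t).recs r).vals[i]? = some (e.data u).old := by
        rw [hu2] at hi hold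
        obtain ⟨x, hx⟩ : ∃ x, ((e.cfg t).recs r).vals[i]? = some x :=
          ⟨_, List.getElem?_eq_getElem hi⟩
        rw [hx, (ih' t le_rfl r hr' i x hx).unique hold]
      obtain ⟨q, k, hrun, hpc⟩ := hu1.1
      have hsd := e.sameData hu
      have := (e.cfg t).runStep_vals_of_helpUpdate hpc
        (by rw [hsd.fld, hsd.old, hu2]; exact hcur)
      rw [← e.next_run hrun, hsd.fld, hsd.new, hu2, hu3] at this
      rw [hu2] at hi
      simp only at this hi
      rw [this, List.getElem?_set_self hi] at hv
      cases hv
      exact .inl ⟨t, Nat.lt_succ_self t, hw, fun s' v' h1 h2 => by omega⟩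
    · have hval : ((e.cfg (t + 1)).recs r).vals[i]? = ((e.cfg t).recs r).vals[i]? := by
        rcases e.vals_succ hr' with h1 | ⟨p, u, k, h1, h2, h3, h4, h5⟩
        · rw [h1]
        · obtain ⟨h0, hu⟩ := e.helping_valid (t := t) (p := p) (u := u) (k := k) (by rw [h2]; rfl)
          have hsd := e.sameData hu
          rw [hsd.fld] at h3 h4 h5
          rw [hsd.old] at h4
          by_cases hi : (e.data u).fld.2 = i
          -- A repeated update CAS for `u` would succeed here. With `s` its first one, the expected
          -- value was already initial or written before `s`, yet it would also be the value of the
          -- last write `s' ≥ s`, which must be fresh.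
          · exfalso
            have hf : (e.data u).fld = (r, i) := Prod.ext h3 hi
            obtain ⟨s, hs1, hs2⟩ := exists_firstUpdate (e := e) ⟨p, k, h1, h2⟩
            have hst : s < t := lt_of_le_of_ne hs1 fun heq =>
              hw ⟨_, u, heq ▸ hs2, hf, rfl⟩
            have hold := hs2.lastWritten_old hsetup fun x hx => ih' x (by omega)
            have hcur := ih' t le_rfl r hr' _ _ h4
            rw [hi] at hcur
            rw [hf] at hold
            rcases hcur with ⟨s', h6, h7, h8⟩ | ⟨h6, -⟩
            · have hss : s ≤ s' := by
                by_contra! hlt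
                exact h8 s (e.data u).new hlt hst ⟨u, hs2, hf, rfl⟩
              obtain ⟨u', hu'1, hu'2, hu'3⟩ := h7
              have hfresh := hu'1.new_fresh hsetup hABA
              rw [hu'2, hu'3] at hfresh
              rcases hold with ⟨x, hx1, hx2, -⟩ | ⟨-, hx⟩
              · exact hfresh.2 x (by omega) hx2
              · refine hfresh.1 ?_
                rw [← hx]
                simp only
                rw [e.initVals_eq hss]
                obtain ⟨h0s, hus⟩ := hs2.1.valid
                have := (fld_lt hsetup h0s hus).1
                rwa [hf] at this
            · exact h6 s _ hst ⟨u, hs2, hf, rfl⟩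
          · rw [h5, List.getElem?_set_ne hi]
      rw [hval] at hv
      refine (ih' t le_rfl r hr' i v hv).of_no_write (Nat.le_succ t) hr' fun s v' hs hs' hh => ?_
      obtain rfl : s = t := by omega
      exact hw ⟨v', hh⟩
  · rcases e.nRec_succ t with h | ⟨_, _, _, _, h1, h2⟩
    · omega
    · obtain rfl : r = (e.cfg t).nRec := by omega
      -- A new record has no earlier writes, because an `SCX` only writes to records that were
      -- allocated before.
      refine .inr ⟨?_, by rw [h2] at hv ⊢; exact hv⟩
      rintro s v' hs ⟨u, hu1, hu2, hu3⟩
      obtain ⟨h0, hu⟩ := hu1.1.valid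
      have := (fld_lt hsetup h0 hu).1
      rw [hu2] at this
      exact absurd (this.trans_le (e.nRec_mono (show s ≤ t by omega))) (lt_irrefl _)

end Execution

/-! ### Results of operations, the linearization, C1 to C4 and P1. -/

namespace Execution

variable {P Val : Type*} [DecidableEq P] [DecidableEq Val] [Inhabited Val]
  {refs : Val → Set RecId} (e : Execution P refs)

variable {e} (hsetup : e.SetUp)
include hsetup

/-! ### Results of operations -/

/-- A helper at the frozen check knows that `u` is finished or blocked. If `allFrozen` holds, then
`u` is neither blocked nor aborted, so some helper has already committed it. -/
theorem committed_of_helpReturn {t p u k} (hrun : e.act t = .run p)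
    (h : (((e.cfg t).procs p).pc = .helpFrozenCheck u k ∧ ((e.cfg t).scxs u).allFrozen = true) ∨
      ((e.cfg t).procs p).pc = .helpCommit u k) :
    ((e.cfg (t + 1)).scxs u).state = .committed := by
  rcases h with ⟨hpc, haf⟩ | hpc
  · obtain ⟨h0, hu⟩ := e.helping_valid (t := t) (p := p) (u := u) (k := k) (by rw [hpc]; rfl)
    have hI := (safety hsetup t).2 p
    rw [hpc] at hI
    have hc : ((e.cfg t).scxs u).state = .committed := by
      rcases hI with h1 | h1
      · have := not_aborted_of_allFrozen hsetup h0 hu hu haf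
        cases hst : ((e.cfg t).scxs u).state <;> simp_all
      · exact absurd h1 (not_blocked_of_allFrozen hsetup h0 hu hu haf)
    exact committed_mono hsetup (Nat.le_succ t) h0 hu hc
  · rw [e.next_run hrun, Config.runStep_state_of_helpCommit _ hpc]

/-- The state of an SCX-record after its `SCX` has returned. -/
theorem state_of_returns_scx {p l V R fld new t b} (hl : e.act l = .invoke p (.scx V R fld new))
    (h : e.Returns l t (.bool b)) :
    ((e.cfg t).scxs (e.cfg l).nScx).state = if b then .committed else .aborted := by
  obtain ⟨h1, h2, h3⟩ := e.returns_running hl h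
  have hX : ∀ s, l < s → (e.cfg l).nScx < (e.cfg s).nScx := fun s hs => e.nScx_lt_of_invoke hl hs
  have h0 := (e.nScx_pos l).ne'
  refine (e.running_induction hl (fun s pc => ∀ b, pc = .ret (.bool b) →
    ((e.cfg s).scxs (e.cfg l).nScx).state = if b then .committed else .aborted) ?_ ?_ ?_ t h1).1 b h3
  · intro b hb; simp [Op.startPC] at hb
  · intro s hs hrun ha hI b hb
    have := hI b hb
    cases b
    · exact aborted_mono hsetup (Nat.le_succ s) h0 (hX s hs) (by simpa using this)
    · exact committed_mono hsetup (Nat.le_succ s) h0 (hX s hs) (by simpa using this)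
  · intro s hs hrun ha hI hstep hret b hb
    rcases e.scxInv hl s hrun with h4 | ⟨b', h4⟩
    · rcases hstep.helping h4 with h5 | ⟨h5, h6, h7⟩ | ⟨h5, h7⟩ | ⟨h5, h7⟩
      · rw [hb] at h5; simp [PC.helping] at h5
      · rw [hb] at h7; simp only [Cont.retPC, PC.ret.injEq, Resp.bool.injEq] at h7; subst h7
        exact committed_of_helpReturn hsetup ha (.inl ⟨h5, h6⟩)
      · rw [hb] at h7; simp only [Cont.retPC, PC.ret.injEq, Resp.bool.injEq] at h7; subst h7
        exact committed_of_helpReturn hsetup ha (.inr h5)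
      · rw [hb] at h7; simp only [Cont.retPC, PC.ret.injEq, Resp.bool.injEq] at h7; subst h7
        rw [e.next_run ha, Config.runStep_state_of_helpAbort _ h5]; simp
    · exact absurd h4 (hret _)

/-- At time `t`, the record `r` has been finalized by a committed `SCX`. -/
def Finalized (e : Execution P refs) (t : ℕ) (r : RecId) : Prop :=
  ∃ u, u ≠ 0 ∧ u < (e.cfg t).nScx ∧ r ∈ (e.data u).R ∧ ((e.cfg t).scxs u).state = .committed

theorem Finalized.mono {t t' r} (h : e.Finalized t r) (ht : t ≤ t') : e.Finalized t' r := by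
  obtain ⟨u, h0, hu, h1, h2⟩ := h
  exact ⟨u, h0, hu.trans_le (e.nScx_mono ht), h1, committed_mono hsetup ht h0 hu h2⟩

/-- This uses that the mark is read before the info pointer: once `r` is marked, its info field is
fixed at the finalizing SCX-record, so the pointer read afterwards is that record. -/
theorem InfoRead.mem_R {l t r u} (h : e.InfoRead l t r true u) (hr : r < (e.cfg l).nRec) :
    r ∈ (e.data u).R := by
  obtain ⟨a₀, a, h1, h2, h3, h4, h5⟩ := h
  obtain ⟨w, h6, h7, h8, h9, h10⟩ :=
    exists_of_marked hsetup (hr.trans_le (e.nRec_mono h1.le)) h4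
  have := info_eq_of_allFrozen hsetup h6 (h7.trans_le (e.nScx_mono h2.le))
    (e.allFrozen_mono h2.le h7 h9) h8
  rwa [h5.symm.trans this]

/-- `FINALIZED` is returned only with a true first mark, which identifies the SCX-record as a
finalizing one, and only once that record is committed, seen directly or through `Help`. -/
theorem finalized_of_returns {p l r t} (hl : e.act l = .invoke p (.llx r))
    (h : e.Returns l t .finalized) : e.Finalized t r := by
  obtain ⟨h1, h2, h3⟩ := e.returns_running hl h
  refine (e.running_induction hl (fun s pc => pc = .ret .finalized → e.Finalized s r) ?_ ?_ ?_ t h1).1 h3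
  · intro hb; simp [Op.startPC] at hb
  · intro s hs hrun ha hI hb
    exact (hI hb).mono hsetup (Nat.le_succ s)
  · intro s hs hrun ha hI hstep hret hb
    have hinv := e.llxInv hl s hrun
    have hv := (e.valid_all s).2.2 p
    have hN : r < (e.cfg l).nRec := e.invoke_ok hl
    have hns := e.nScx_mono (Nat.le_succ s)
    cases hh : ((e.cfg s).procs p).pc.helping with
    | some x =>
      obtain ⟨u, k⟩ := x
      obtain ⟨h0, hu⟩ := e.helping_valid hh
      rw [e.llxInv_of_helping hh] at hinv
      have key : ∀ b, ((e.cfg (s + 1)).procs p).pc = k.retPC b → b = true ∧ r ∈ (e.data u).R := by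
        intro b hb'
        rcases hinv with rfl | ⟨m, rfl, hir⟩
        · rw [hb] at hb'; simp [Cont.retPC] at hb'
        · rw [hb] at hb'
          cases b <;> cases m <;> simp [Cont.retPC] at hb'
          exact ⟨rfl, hir.mem_R hsetup hN⟩
      rcases hstep.helping hh with h5 | ⟨h5, h6, h7⟩ | ⟨h5, h7⟩ | ⟨h5, h7⟩
      · rw [hb] at h5; simp [PC.helping] at h5
      · exact ⟨u, h0, hu.trans_le hns, (key _ h7).2,
          committed_of_helpReturn hsetup ha (.inl ⟨h5, h6⟩)⟩
      · exact ⟨u, h0, hu.trans_le hns, (key _ h7).2, committed_of_helpReturn hsetup ha (.inr h5)⟩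
      · exact absurd (key _ h7).1 (by simp)
    | none =>
      generalize hpc : ((e.cfg s).procs p).pc = pc at hinv hv hstep hh
      generalize ((e.cfg (s + 1)).procs p).pc = pc' at hstep hb
      cases hstep <;> simp only [PC.helping, reduceCtorEq, PC.ret.injEq] at hh hb
      case finalized u hu =>
        have hR := hinv.2.mem_R hsetup hN
        have h0 : u ≠ 0 := by
          rintro rfl; rw [e.dummy_aborted] at hu; cases hu
        exact ⟨u, h0, hv.2.trans_le hns, hR,
          committed_mono hsetup (Nat.le_succ s) h0 hv.2 hu⟩

/-- An `LLX(r)` that begins after `r` has been finalized can only return `FINALIZED`. -/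
theorem returns_finalized {p l r t resp} (hl : e.act l = .invoke p (.llx r))
    (hfin : e.Finalized l r) (h : e.Returns l t resp) : resp = .finalized := by
  obtain ⟨h1, h2, h3⟩ := e.returns_running hl h
  obtain ⟨u, h0, hu, hr, hc⟩ := hfin
  have hN : r < (e.cfg l).nRec := e.invoke_ok hl
  obtain ⟨haf, hm, -⟩ := committed_facts hsetup h0 hu hc
  -- The mark, the info pointer and the committed state are all fixed, which leaves a single path
  -- through the `LLX`; every state off this path is declared impossible.
  let Q : ℕ → PC Val → Prop := fun _ pc => match pc with
    | .llxMarked₁ r' => r' = r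
    | .llxInfo r' m => r' = r ∧ m = true
    | .llxState r' m u' => r' = r ∧ m = true ∧ u' = u
    | .llxMarked₂ r' m u' st => r' = r ∧ m = true ∧ u' = u ∧ st = .committed
    | .llxTest₁ r' m u' => r' = r ∧ m = true ∧ u' = u
    | .ret resp => resp = .finalized
    | _ => False
  have : Q t _ := (e.running_induction hl Q rfl (fun _ _ _ _ h => h) ?_ t h1).1
  · rw [h3] at this; exact this
  · intro s hs hrun ha hI hstep hret
    have hms : ((e.cfg s).recs r).marked = true := e.marked_mono hs.le hN (hm r hr)
    have hus := hu.trans_le (e.nScx_mono hs.le)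
    have his : ((e.cfg s).recs r).info = u :=
      info_eq_of_allFrozen hsetup h0 hus (e.allFrozen_mono hs.le hu haf) hr
    have hcs := committed_mono hsetup hs.le h0 hu hc
    generalize ((e.cfg s).procs p).pc = pc at hI hstep hret
    generalize ((e.cfg (s + 1)).procs p).pc = pc' at hstep
    cases hstep <;> simp only [Q] at hI ⊢ <;> simp_all

/-! ### The linearization -/

omit hsetup
variable (e)

/-- The operation invoked at time `t` may be linearized at `s`. -/
inductive LinPoint (t s : ℕ) : Prop
  | scx (p V R fld new) (h : e.act t = .invoke p (.scx V R fld new)) (hs : e.ScxPoint t s)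
  | snapshot (h : e.SnapshotPoint t s)
  | finalized (p r) (h : e.act t = .invoke p (.llx r)) (hs : e.Returns t s .finalized)
  | vlx (p V t') (h : e.act t = .invoke p (.vlx V)) (hr : e.Returns t t' (.bool true)) (hs : s = t)
  | read (p r f t') (h : e.act t = .invoke p (.read r f)) (hts : t < s) (hst : s < t')
      (hrun : e.act s = .run p) (hpc : ((e.cfg s).procs p).pc = .read r f)
      (hr : e.Returns t t' (.value (((e.cfg s).fieldValue? r f).getD default)))

open Classical in
/-- The linearization: `SCX`s at their first update CAS, snapshots at the second read of the info
field, `LLX`s that return `FINALIZED` when they return, successful `VLX`s at their start, and reads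
at the step that accesses the field. -/
noncomputable def lin (t : ℕ) : Option ℕ :=
  if h : ∃ s, e.LinPoint t s then some h.choose else none

variable {e}

theorem linPoint_of_lin {t s} (h : e.lin t = some s) : e.LinPoint t s := by
  unfold lin at h
  split at h
  · rename_i hex
    cases h
    exact hex.choose_spec
  · cases h

theorem LinPoint.isSome {t s} (h : e.LinPoint t s) : (e.lin t).isSome := by
  have : ∃ s, e.LinPoint t s := ⟨s, h⟩
  simp [lin, this]

theorem lin_eq_of_scxPoint {t s} (h : e.ScxPoint t s) : e.lin t = some s := by
  obtain ⟨p, V, R, fld, new, ha⟩ := h.1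
  have hp : e.LinPoint t s := .scx p V R fld new ha h
  obtain ⟨s', hs'⟩ := Option.isSome_iff_exists.1 hp.isSome
  rw [hs']
  cases linPoint_of_lin hs' with
  | scx _ _ _ _ _ h1 h2 => rw [((scxPoint_iff ha).1 h).unique ((scxPoint_iff ha).1 h2)]
  | snapshot h1 => obtain ⟨_, _, _, _, h1, _⟩ := h1; rw [ha] at h1; cases h1
  | finalized _ _ h1 => rw [ha] at h1; cases h1
  | vlx _ _ _ h1 => rw [ha] at h1; cases h1
  | read _ _ _ _ h1 => rw [ha] at h1; cases h1

theorem SnapshotPoint.returns {t s p r} (h : e.SnapshotPoint t s)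
    (ha : e.act t = .invoke p (.llx r)) :
    ∃ t' ms m u, e.Returns t t' (.snapshot ms) ∧ e.IsSnapshot p t t' r ms s m u := by
  obtain ⟨p', r', t', ms, h1, h2, -⟩ := id h
  rw [ha] at h1; cases h1
  obtain ⟨d, m, u, h3⟩ := e.exists_isSnapshot ha h2
  rw [(e.snapshotPoint_iff h3 h2 s).1 h]
  exact ⟨t', ms, m, u, h2, h3⟩

theorem lin_eq_of_snapshotPoint {t s} (h : e.SnapshotPoint t s) : e.lin t = some s := by
  obtain ⟨p, r, -, -, ha, -⟩ := id h
  have hp : e.LinPoint t s := .snapshot h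
  obtain ⟨t', ms, m, u, hret, hsn⟩ := h.returns ha
  obtain ⟨s', hs'⟩ := Option.isSome_iff_exists.1 hp.isSome
  rw [hs']
  cases linPoint_of_lin hs' with
  | scx _ _ _ _ _ h1 => rw [ha] at h1; cases h1
  | snapshot h1 => rw [(e.snapshotPoint_iff hsn hret s').1 h1, (e.snapshotPoint_iff hsn hret s).1 h]
  | finalized _ _ _ h1 => have := (e.returns_unique h1 hret).2; cases this
  | vlx _ _ _ h1 => rw [ha] at h1; cases h1
  | read _ _ _ _ h1 => rw [ha] at h1; cases h1

/-- The process step or invocation at which an operation is linearized. -/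
theorem LinPoint.owner {t s} (h : e.LinPoint t s) : ∃ p op, e.act t = .invoke p op ∧
    ((e.act s = .run p ∧ e.Running p t s ∧ ∀ u k, ((e.cfg s).procs p).pc ≠ .helpUpdate u k) ∨
      s = t ∨ (∃ V R fld new, op = .scx V R fld new) ∧ e.FirstUpdate s (e.cfg t).nScx) := by
  cases h with
  | scx p V R fld new ha hs => exact ⟨p, _, ha, .inr (.inr ⟨⟨V, R, fld, new, rfl⟩, (scxPoint_iff ha).1 hs⟩)⟩
  | snapshot h =>
    obtain ⟨p, r, t', ms, ha, hret, h1, h2, h3, m, u, ms', h4⟩ := h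
    refine ⟨p, _, ha, .inl ⟨h3, (e.returns_running ha hret).1.mono e h1 h2.le, ?_⟩⟩
    rw [h4]; simp
  | finalized p r ha hret =>
    obtain ⟨h1, h2, h3⟩ := e.returns_running ha hret
    refine ⟨p, _, ha, .inl ⟨h2, h1, ?_⟩⟩
    rw [h3]; simp
  | vlx p V t' ha hret hs => exact ⟨p, _, ha, .inr (.inl hs)⟩
  | read p r f t' ha h1 h2 hrun hpc hret =>
    refine ⟨p, _, ha, .inl ⟨hrun, (e.returns_running ha hret).1.mono e h1 h2.le, ?_⟩⟩
    rw [hpc]; simp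

theorem FirstUpdate.lt {p V R fld new t s} (ha : e.act t = .invoke p (.scx V R fld new))
    (h : e.FirstUpdate s (e.cfg t).nScx) : t < s := by
  by_contra! hle
  exact absurd (h.1.valid.2.trans_le (e.nScx_mono hle)) (lt_irrefl _)

/-- One step belongs to one process. A process executes one operation at a time, a step that is an
update CAS belongs to one SCX-record, and neither an invocation nor a process's own linearization
step of another kind is an update CAS. -/
theorem LinPoint.inj {t t' s} (h : e.LinPoint t s) (h' : e.LinPoint t' s) : t = t' := by
  obtain ⟨p, op, ha, hc⟩ := h.owner
  obtain ⟨p', op', ha', hc'⟩ := h'.owner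
  rcases hc with ⟨h1, h2, h3⟩ | rfl | ⟨⟨V, R, fld, new, rfl⟩, h1⟩ <;>
    rcases hc' with ⟨h1', h2', h3'⟩ | rfl | ⟨⟨V', R', fld', new', rfl⟩, h1'⟩
  · rw [h1] at h1'; cases h1'
    exact e.running_unique ha ha' h2 h2'
  · rw [h1] at ha'; cases ha'
  · obtain ⟨⟨q, k, h4, h5⟩, -⟩ := h1'
    rw [h1] at h4; cases h4
    exact absurd h5 (h3 _ _)
  · rw [h1'] at ha; cases ha
  · rfl
  · obtain ⟨⟨q, k, h4, h5⟩, -⟩ := h1'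
    rw [ha] at h4; cases h4
  · obtain ⟨⟨q, k, h4, h5⟩, -⟩ := h1
    rw [h1'] at h4; cases h4
    exact absurd h5 (h3' _ _)
  · obtain ⟨⟨q, k, h4, h5⟩, -⟩ := h1
    rw [ha'] at h4; cases h4
  · exact e.invoke_scx_unique ha ha' (h1.1.unique h1'.1)

/-- The possible results of the operations. -/
theorem Returns.resp_llx {p t r t' resp} (h : e.Returns t t' resp)
    (ha : e.act t = .invoke p (.llx r)) :
    (∃ ms, resp = .snapshot ms) ∨ resp = .finalized ∨ resp = .fail := by
  obtain ⟨h1, h2, h3⟩ := e.returns_running ha h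
  have := e.llxInv ha t' h1
  rw [h3] at this
  cases resp <;> simp [LlxInv, PC.helping] at this ⊢

theorem Returns.resp_scx {p t V R fld new t' resp} (h : e.Returns t t' resp)
    (ha : e.act t = .invoke p (.scx V R fld new)) : ∃ b, resp = .bool b := by
  obtain ⟨h1, h2, h3⟩ := e.returns_running ha h
  rcases e.scxInv ha t' h1 with h4 | ⟨b, h4⟩
  · rw [h3] at h4; simp [PC.helping] at h4
  · rw [h3] at h4; cases h4; exact ⟨b, rfl⟩

theorem Returns.resp_vlx {p t V t' resp} (h : e.Returns t t' resp)
    (ha : e.act t = .invoke p (.vlx V)) : ∃ b, resp = .bool b := by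
  obtain ⟨h1, h2, h3⟩ := e.returns_running ha h
  have := e.vlxInv ha t' h1
  rw [h3] at this
  cases resp <;> simp [VlxInv] at this ⊢

theorem Returns.linPoint_read {p t r f t' resp} (h : e.Returns t t' resp)
    (ha : e.act t = .invoke p (.read r f)) : ∃ s, e.LinPoint t s := by
  obtain ⟨h1, h2, h3⟩ := e.returns_running ha h
  have := e.readInv ha t' h1
  rw [h3] at this
  obtain ⟨s, h4, h5, h6, h7, rfl⟩ := this
  exact ⟨s, .read p r f t' ha h4 h5 h6 h7 h⟩

include hsetup

/-- A linearized `SCX` does not return `FALSE`, and it is linearized before it returns. -/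
theorem FirstUpdate.of_returns {p V R fld new t t' s resp}
    (ha : e.act t = .invoke p (.scx V R fld new)) (h : e.FirstUpdate s (e.cfg t).nScx)
    (hret : e.Returns t t' resp) : resp = .bool true ∧ s < t' := by
  obtain ⟨b, rfl⟩ := hret.resp_scx ha
  have hst := state_of_returns_scx hsetup ha hret
  obtain ⟨h0, hu⟩ := h.1.valid
  have hu' := e.nScx_lt_of_invoke ha (e.returns_running ha hret).1.1
  cases b
  · exact absurd hst (not_aborted_of_allFrozen hsetup h0 hu hu' (h.1.facts hsetup).1)
  · obtain ⟨-, -, x, h1, h2⟩ := committed_facts hsetup h0 hu' hst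
    refine ⟨rfl, lt_of_le_of_lt ?_ h1⟩
    by_contra! hlt
    exact h.2 x hlt h2

theorem exists_firstUpdate_of_returns {p V R fld new t t'}
    (ha : e.act t = .invoke p (.scx V R fld new)) (hret : e.Returns t t' (.bool true)) :
    ∃ s, e.FirstUpdate s (e.cfg t).nScx := by
  have hst := state_of_returns_scx hsetup ha hret
  have hu' := e.nScx_lt_of_invoke ha (e.returns_running ha hret).1.1
  obtain ⟨-, -, x, h1, h2⟩ := committed_facts hsetup (e.nScx_pos t).ne' hu' hst
  obtain ⟨s, -, hs⟩ := exists_firstUpdate h2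
  exact ⟨s, hs⟩

theorem isLinearization : e.IsLinearization e.lin where
  invoked t s h := by
    obtain ⟨p, op, ha, -⟩ := (linPoint_of_lin h).owner
    exact ⟨p, op, ha⟩
  after_start t s h := by
    obtain ⟨p, op, ha, ⟨-, h1, -⟩ | rfl | ⟨⟨V, R, fld, new, rfl⟩, h1⟩⟩ := (linPoint_of_lin h).owner
    · exact h1.1.le
    · exact le_rfl
    · exact (h1.lt ha).le
  before_end t s h t' resp hret := by
    obtain ⟨p, op, ha, ⟨-, h1, -⟩ | rfl | ⟨⟨V, R, fld, new, rfl⟩, h1⟩⟩ := (linPoint_of_lin h).owner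
    · by_contra! hlt
      obtain ⟨h2, h3, h4⟩ := e.returns_running ha hret
      exact h1.2 t' h2.1 hlt _ ⟨h3, h4⟩
    · exact (e.returns_running ha hret).1.1.le
    · exact (h1.of_returns hsetup ha hret).2.le
  inj t t' s h h' := (linPoint_of_lin h).inj (linPoint_of_lin h')
  complete t h := by
    obtain ⟨t', resp, hret, hs⟩ := h
    obtain ⟨p, op, ha, -⟩ := id hret
    suffices ∃ s, e.LinPoint t s by
      obtain ⟨s, hs⟩ := this
      exact hs.isSome
    cases op with
    | llx r =>
      rcases hret.resp_llx ha with ⟨ms, rfl⟩ | rfl | rfl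
      · obtain ⟨d, m, u, h1⟩ := e.exists_isSnapshot ha hret
        exact ⟨d, .snapshot ((e.snapshotPoint_iff h1 hret d).2 rfl)⟩
      · exact ⟨t', .finalized p r ha hret⟩
      · exact hs.elim
    | scx V R fld new =>
      obtain ⟨b, rfl⟩ := hret.resp_scx ha
      cases b
      · exact hs.elim
      · obtain ⟨s, hs⟩ := exists_firstUpdate_of_returns hsetup ha hret
        exact ⟨s, .scx p V R fld new ha ((scxPoint_iff ha).2 hs)⟩
    | vlx V =>
      obtain ⟨b, rfl⟩ := hret.resp_vlx ha
      cases b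
      · exact hs.elim
      · exact ⟨t, .vlx p V t' ha hret rfl⟩
    | read r f => exact hret.linPoint_read ha
  sound t h := by
    obtain ⟨s, hs⟩ := Option.isSome_iff_exists.1 h
    cases linPoint_of_lin hs with
    | scx p V R fld new ha hs =>
      by_cases ht : e.Terminates t
      · obtain ⟨t', resp, hret⟩ := ht
        obtain ⟨rfl, -⟩ := ((scxPoint_iff ha).1 hs).of_returns hsetup ha hret
        exact .inl ⟨t', _, hret, trivial⟩
      · exact .inr ⟨ht, p, V, R, fld, new, ha⟩
    | snapshot h =>
      obtain ⟨p, r, t', ms, ha, hret, -⟩ := h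
      exact .inl ⟨t', _, hret, trivial⟩
    | finalized p r ha hret => exact .inl ⟨_, _, hret, trivial⟩
    | vlx p V t' ha hret hs => exact .inl ⟨_, _, hret, trivial⟩
    | read p r f t' ha h1 h2 hrun hpc hret => exact .inl ⟨_, _, hret, trivial⟩
  scx t p V R fld new ha s := by
    refine ⟨fun h => ?_, lin_eq_of_scxPoint⟩
    cases linPoint_of_lin h with
    | scx _ _ _ _ _ _ h1 => exact h1
    | snapshot h1 => obtain ⟨_, _, _, _, h1, _⟩ := h1; rw [ha] at h1; cases h1
    | finalized _ _ h1 => rw [ha] at h1; cases h1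
    | vlx _ _ _ h1 => rw [ha] at h1; cases h1
    | read _ _ _ _ h1 => rw [ha] at h1; cases h1
  snapshot t s h := lin_eq_of_snapshotPoint h

/-! ### Conditions C1 to C4 and P1 -/

omit hsetup

theorem lin_scx {p V R fld new t s} (ha : e.act t = .invoke p (.scx V R fld new)) :
    e.lin t = some s ↔ e.FirstUpdate s (e.cfg t).nScx := by
  rw [← scxPoint_iff ha]
  refine ⟨fun h => ?_, lin_eq_of_scxPoint⟩
  cases linPoint_of_lin h with
  | scx _ _ _ _ _ _ h1 => exact h1
  | snapshot h1 => obtain ⟨_, _, _, _, h1, _⟩ := h1; rw [ha] at h1; cases h1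
  | finalized _ _ h1 => rw [ha] at h1; cases h1
  | vlx _ _ _ h1 => rw [ha] at h1; cases h1
  | read _ _ _ _ h1 => rw [ha] at h1; cases h1

theorem LinWrite.written {f v t s} (h : e.LinWrite e.lin f v t s) : e.Written f s v := by
  obtain ⟨h1, p, V, R, ha⟩ := h
  exact ⟨_, (lin_scx ha).1 h1, (e.data_of_invoke ha).fld.symm, (e.data_of_invoke ha).new.symm⟩

theorem Written.linWrite {f v s} (h : e.Written f s v) : ∃ t, e.LinWrite e.lin f v t s := by
  obtain ⟨u, h1, h2, h3⟩ := h
  obtain ⟨h0, hu⟩ := h1.1.valid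
  obtain ⟨t, ht, p, V, R, fld, new, ha, rfl⟩ := e.exists_invoke h0 hu
  have hd := e.data_of_invoke ha
  obtain rfl : fld = f := hd.fld.trans h2
  obtain rfl : new = v := hd.new.trans h3
  exact ⟨t, (lin_scx ha).2 h1, p, V, R, ha⟩

theorem LastWritten.lastValue {f t v} (h : e.LastWritten f t v) : e.LastValue e.lin f t v := by
  rcases h with ⟨s, h1, h2, h3⟩ | ⟨h1, h2⟩
  · obtain ⟨t', ht'⟩ := h2.linWrite
    exact .inl ⟨t', s, h1, ht', fun t'' s'' v' h4 h5 h6 => h3 s'' v' h4 h5 h6.written⟩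
  · exact .inr ⟨fun t' s' v' h3 h4 => h1 s' v' h3 h4.written, h2⟩

include hsetup

theorem c1 (hABA : e.NoABA) : e.C1 e.lin := by
  intro t p r f s t' v ha hlin hret
  cases linPoint_of_lin hlin with
  | scx _ _ _ _ _ h1 => rw [ha] at h1; cases h1
  | snapshot h1 => obtain ⟨_, _, _, _, h1, _⟩ := h1; rw [ha] at h1; cases h1
  | finalized _ _ h1 => rw [ha] at h1; cases h1
  | vlx _ _ _ h1 => rw [ha] at h1; cases h1
  | read p' r' f' t'' h1 h2 h3 h4 h5 h6 =>
    rw [ha] at h1; cases h1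
    have := (e.returns_unique hret h6).2
    cases this
    obtain ⟨hN, hsome⟩ := e.invoke_ok ha
    have hNs := hN.trans_le (e.nRec_mono h2.le)
    cases f with
    | mutable i =>
      refine (lastWritten hsetup hABA s r hNs i _ ?_).lastValue
      have hi : i < ((e.cfg s).recs r).vals.length := by
        rw [e.length_vals_eq h2.le hN]
        simpa [Config.fieldValue?] using hsome
      simp [Config.fieldValue?, hi]
    | immutable i =>
      have hi : i < ((e.cfg t).recs r).consts.length := by
        simpa [Config.fieldValue?] using hsome
      simp [Config.fieldValue?, e.consts_eq h2.le hN, hi]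

/-- Each value was current when it was read, and no `SCX` on the record is linearized from then
until the rereading step, since the info field stays at one finished SCX-record. -/
theorem c2 (hABA : e.NoABA) : e.C2 e.lin := by
  intro t p r s t' resp ha hlin hret hnf
  cases linPoint_of_lin hlin with
  | scx _ _ _ _ _ h1 => rw [ha] at h1; cases h1
  | finalized _ _ h1 h2 => exact absurd (e.returns_unique hret h2).2 hnf
  | vlx _ _ _ h1 => rw [ha] at h1; cases h1
  | read _ _ _ _ h1 => rw [ha] at h1; cases h1
  | snapshot h =>
    obtain ⟨t'', ms, m, u, h1, h2⟩ := h.returns ha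
    obtain ⟨rfl, rfl⟩ := e.returns_unique hret h1
    refine ⟨ms, rfl, h2.length, fun i v hv => ?_⟩
    obtain ⟨c, h3, h4, h5, -, h6, h7⟩ := h2.exists_start hsetup
    obtain ⟨a, h8, h9, h10⟩ := h5 i v hv
    have hN : r < (e.cfg a).nRec := h2.nRec.trans_le (e.nRec_mono (by omega))
    refine ((lastWritten hsetup hABA a r hN i v h10).of_no_write h9.le hN ?_).lastValue
    rintro x v' hx hx' ⟨w, hw1, hw2, hw3⟩
    refine h7 x w (by omega) (h6 x (by omega) (by omega)) hw1 ?_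
    obtain ⟨h0', hu'⟩ := hw1.1.valid
    have := e.fld_mem_V h0' hu'
    rwa [hw2] at this

theorem c3 : e.C3 e.lin := by
  intro t p r s t' resp ha hlin hret
  constructor
  · rintro rfl
    cases linPoint_of_lin hlin with
    | scx _ _ _ _ _ h1 => rw [ha] at h1; cases h1
    | vlx _ _ _ h1 => rw [ha] at h1; cases h1
    | read _ _ _ _ h1 => rw [ha] at h1; cases h1
    | snapshot h =>
      obtain ⟨t'', ms, m, u, h1, h2⟩ := h.returns ha
      have := (e.returns_unique hret h1).2
      cases this
    | finalized _ _ h1 h2 =>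
      obtain ⟨u, h0, hu, hr, hc⟩ := finalized_of_returns hsetup ha h2
      obtain ⟨-, -, x, hx, hx'⟩ := committed_facts hsetup h0 hu hc
      obtain ⟨s', hs', hs''⟩ := exists_firstUpdate hx'
      obtain ⟨τ, hτ, q, V, R, fld, new, hq, rfl⟩ := e.exists_invoke h0 hu
      refine ⟨τ, s', q, V, R, fld, new, hq, ?_, (lin_scx hq).2 hs'', by omega⟩
      rwa [← (e.data_of_invoke hq).R] at hr
  · rintro ⟨τ, s', q, V, R, fld, new, hq, hr, hs', hlt⟩
    cases linPoint_of_lin hlin with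
    | scx _ _ _ _ _ h1 => rw [ha] at h1; cases h1
    | vlx _ _ _ h1 => rw [ha] at h1; cases h1
    | read _ _ _ _ h1 => rw [ha] at h1; cases h1
    | finalized _ _ h1 h2 => exact (e.returns_unique hret h2).2
    | snapshot h =>
      obtain ⟨t'', ms, m, u, h1, h2⟩ := h.returns ha
      refine (h2.not_updatedAt hsetup ((lin_scx hq).1 hs').1 hlt.le ?_).elim
      rwa [← (e.data_of_invoke hq).R]

/-- For an `SCX` this is the exclusion by freezing. A `VLX` is linearized at its start: each later
successful comparison shows that the info field has been constant since the snapshot, so no `SCX` on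
the record was linearized meanwhile. -/
theorem c4 : e.C4 e.lin := by
  intro t p op s ha hlin r hr l hl
  obtain ⟨p', op', d, m, u, ms, t', h1, h2, h3, h4, h5, h6⟩ := hl.isSnapshot
  rw [ha] at h1; cases h1
  refine ⟨d, lin_eq_of_snapshotPoint ((e.snapshotPoint_iff h5 h4 d).2 rfl), ?_⟩
  have hdt := h5.point_lt
  cases op with
  | llx r => simp [Op.deps] at hr
  | read r f => simp [Op.deps] at hr
  | scx V R fld new =>
    have hs := (lin_scx ha).1 hlin
    have hts := hs.lt ha
    refine ⟨by omega, fun τ q V' R' fld' new' s' hq hrV hs' hlt => ?_⟩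
    have hs' := (lin_scx hq).1 hs'
    have hV : (e.data (e.cfg t).nScx).V = V := (e.data_of_invoke ha).V.symm
    obtain ⟨d', m', ms', t'', h7, h8, h9, h10⟩ := hl.scx_isSnapshot e ha
    obtain ⟨rfl, hms⟩ := e.returns_unique h4 h8
    cases hms
    obtain rfl := (e.snapshotPoint_iff h9 h8 d).1 ((e.snapshotPoint_iff h5 h4 d).2 rfl)
    obtain ⟨c, h11, h12, -, h13⟩ := no_firstUpdate_between hsetup (e.nScx_pos t).ne'
      (hV.symm ▸ hr) hs h9
    refine h13 s' _ (by omega) hlt.2 hs' ?_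
    rwa [← (e.data_of_invoke hq).V]
  | vlx V =>
    cases linPoint_of_lin hlin with
    | scx _ _ _ _ _ h1 => rw [ha] at h1; cases h1
    | snapshot h1 => obtain ⟨_, _, _, _, h1, _⟩ := h1; rw [ha] at h1; cases h1
    | finalized _ _ h1 => rw [ha] at h1; cases h1
    | read _ _ _ _ h1 => rw [ha] at h1; cases h1
    | vlx _ _ t'' h7 h8 h9 =>
      subst h9
      refine ⟨by omega, fun τ q V' R' fld' new' s' hq hrV hs' hlt => ?_⟩
      have hs' := (lin_scx hq).1 hs'
      obtain ⟨hrun, -, hpc⟩ := e.returns_running ha h8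
      have hinv := e.vlxInv ha t'' hrun
      rw [hpc] at hinv
      obtain ⟨x, hx1, hx2, hx3⟩ := hinv r hr
      rw [h6] at hx3
      obtain ⟨c, h11, h12, -, -, -, h14⟩ := h5.exists_start hsetup
      refine h14 s' _ (by omega) ?_ hs' (by rwa [← (e.data_of_invoke hq).V])
      have hN : r < (e.cfg d).nRec := h5.nRec.trans_le (e.nRec_mono (by omega))
      rw [← h5.info]
      exact info_eq_of_mem_Icc hsetup hlt.1.le (by omega) hN (h5.info.trans hx3)

theorem p1 : e.P1 := by
  intro t p r t' resp ha hret h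
  refine returns_finalized hsetup ha ?_ hret
  rcases h with ⟨l, l', q, V, R, fld, new, hq, hr, hret', hlt⟩ | ⟨l, l', q, hq, hret', hlt⟩
  · have hst := state_of_returns_scx hsetup hq hret'
    have hu := e.nScx_lt_of_invoke hq (e.returns_running hq hret').1.1
    exact Finalized.mono hsetup ⟨_, (e.nScx_pos l).ne', hu, by rwa [← (e.data_of_invoke hq).R], hst⟩ hlt.le
  · exact (finalized_of_returns hsetup hq hret').mono hsetup hlt.le

end Execution

/-! ### Progress when only finitely many `SCX`s are invoked. -/

namespace Execution

variable {P Val : Type*} [DecidableEq P] [DecidableEq Val] [Inhabited Val]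
  {refs : Val → Set RecId} (e : Execution P refs)

open Filter

/-! ### Counting operations -/

/-- A process invokes its next operation only after the previous one has returned, so it has at most
one operation that does not terminate. -/
theorem finite_not_terminates [Finite P] :
    {t | (∃ p op, e.act t = .invoke p op) ∧ ¬ e.Terminates t}.Finite := by
  let f : ℕ → Option P := fun t => match e.act t with
    | .invoke p _ => some p
    | _ => none
  refine Set.Finite.of_finite_image (f := f) (Set.toFinite _) ?_
  have key : ∀ t t' p op p' op', e.act t = .invoke p op → e.act t' = .invoke p' op' →
      ¬ e.Terminates t → f t = f t' → ¬ t < t' := by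
    intro t t' p op p' op' h h' hnt hf hlt
    simp only [f, h, h', Option.some.injEq] at hf
    subst hf
    obtain ⟨s, -, resp, hs⟩ := e.exists_returns_of_invoke h hlt h'
    exact hnt ⟨s, resp, hs⟩
  rintro t ⟨⟨p, op, h⟩, hnt⟩ t' ⟨⟨p', op', h'⟩, hnt'⟩ hf
  exact le_antisymm (not_lt.1 (key _ _ _ _ _ _ h' h hnt' hf.symm))
    (not_lt.1 (key _ _ _ _ _ _ h h' hnt hf))

/-- The operations to which an `LLX` can be linked at most once. -/
def Consumes (t : ℕ) : Prop :=
  (∃ p V R fld new, e.act t = .invoke p (.scx V R fld new)) ∨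
    ∃ p V t', e.act t = .invoke p (.vlx V) ∧ e.Returns t t' (.bool false)

variable {e}

/-- The earlier operation is an `SCX` or failing `VLX` on the record of the `LLX`, and this breaks
the link to any later operation. -/
theorem Linked.not_lt {l t t' r r'} (h : e.Linked l t r) (h' : e.Linked l t' r')
    (hc : e.Consumes t) : ¬ t < t' := by
  intro hlt
  obtain ⟨h1, p, op, h2, h3, h4, -⟩ := h
  obtain ⟨h1', p', op', h2', h3', h4', -, h5'⟩ := h'
  rw [h2] at h2'; cases h2'
  obtain ⟨-, h6, h7⟩ := h5' t h1 hlt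
  rcases hc with ⟨q, V, R, fld, new, hq⟩ | ⟨q, V, s, hq, hs⟩
  · rw [h3] at hq; cases hq
    exact h6 V R fld new h4 h3
  · rw [h3] at hq; cases hq
    exact h7 V h4 h3 s hs

/-- Choosing a linked `LLX` is injective on consuming operations. Used in contrapositive form: if
all the chosen `LLX`s lie in a finite set, the operations are finite in number. -/
theorem infinite_of_linked {B S : Set ℕ} (hB : B.Infinite) (hc : ∀ t ∈ B, e.Consumes t)
    (hl : ∀ t ∈ B, ∃ r, ∃ l ∈ S, e.Linked l t r) : S.Infinite := by
  classical
  choose! r L hL hL' using hl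
  refine Set.infinite_of_injOn_mapsTo (f := L) (fun t ht t' ht' heq => ?_) hL hB
  have h1 := hL' t ht
  have h2 := hL' t' ht'
  rw [← heq] at h2
  exact le_antisymm (not_lt.1 (h2.not_lt h1 (hc t' ht'))) (not_lt.1 (h1.not_lt h2 (hc t ht)))

theorem Linked.succeeds {l t r} (h : e.Linked l t r) :
    (∃ p, e.act l = .invoke p (.llx r)) ∧ e.Succeeds l := by
  obtain ⟨-, p, op, h2, -, -, ⟨t', ms, h3⟩, -⟩ := h
  exact ⟨⟨p, h2⟩, t', _, h3, trivial⟩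

variable (e)

def scxTimes : Set ℕ := {t | ∃ p op, e.act t = .invoke p op ∧ op.IsScx}

def failedVlxTimes : Set ℕ := {t | ∃ p V t', e.act t = .invoke p (.vlx V) ∧ e.Returns t t' (.bool false)}

variable {e}

theorem mem_scxTimes {t} (h : t ∈ e.scxTimes) :
    ∃ p V R fld new, e.act t = .invoke p (.scx V R fld new) := by
  obtain ⟨p, op, h1, h2⟩ := h
  cases op <;> simp [Op.IsScx] at h2
  exact ⟨_, _, _, _, _, h1⟩

theorem exists_of_failed_vlx {p V t t'} (ha : e.act t = .invoke p (.vlx V))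
    (hr : e.Returns t t' (.bool false)) : ∃ r ∈ V, ∃ s, t < s ∧ s < t' ∧
      (((e.cfg t).procs p).table r).1 ≠ ((e.cfg s).recs r).info := by
  obtain ⟨h1, h2, h3⟩ := e.returns_running ha hr
  have := e.vlxInv ha t' h1
  rw [h3] at this
  exact this

/-- All but finitely many `VLX`s succeed or return `FALSE`. -/
theorem finite_vlx_of_finite [Finite P] {S : Set ℕ} (hS : S.Finite)
    (hsucc : ∀ t p V, e.act t = .invoke p (.vlx V) → e.Succeeds t → t ∈ S)
    (hfail : e.failedVlxTimes.Finite) : {t | ∃ p V, e.act t = .invoke p (.vlx V)}.Finite := by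
  refine ((hS.union hfail).union e.finite_not_terminates).subset ?_
  rintro t ⟨p, V, ha⟩
  by_cases ht : e.Terminates t
  · left
    obtain ⟨t', resp, hr⟩ := ht
    obtain ⟨b, rfl⟩ := hr.resp_vlx ha
    cases b
    · exact .inr ⟨p, V, t', ha, hr⟩
    · exact .inl (hsucc t p V ha ⟨t', _, hr, trivial⟩)
  · exact .inr ⟨⟨p, _, ha⟩, ht⟩

/-! ### Executions with finitely many `SCX`s -/

theorem exists_nScx_le (h : e.scxTimes.Finite) : ∃ B, ∀ t, (e.cfg t).nScx ≤ B := by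
  obtain ⟨T, hT⟩ := h.bddAbove
  refine ⟨(e.cfg (T + 1)).nScx, fun t => ?_⟩
  rcases le_total t (T + 1) with hle | hle
  · exact e.nScx_mono hle
  · induction t, hle using Nat.le_induction with
    | base => exact le_rfl
    | succ s hs ih =>
      rcases e.nScx_succ s with h1 | ⟨p, V, R, fld, new, h1, -⟩
      · rwa [h1]
      · have : s ≤ T := hT ⟨p, _, h1, trivial⟩
        omega

/-- A property that never becomes false again has reached its final truth value from some time on.
Finitely many such properties stabilize together. -/
theorem eventually_stable {Q : ℕ → Prop} (h : ∀ s t, s ≤ t → Q s → Q t) :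
    ∀ᶠ T in atTop, ∀ s ≥ T, Q s → Q T := by
  by_cases hQ : ∃ t, Q t
  · obtain ⟨t, ht⟩ := hQ
    filter_upwards [eventually_ge_atTop t] with T hT s hs _
    exact h t T hT ht
  · push Not at hQ
    exact .of_forall fun T s _ hs => absurd hs (hQ s)

variable (e) in
/-- After `T`, the info and marked fields of existing records and the states of existing
SCX-records do not change. -/
structure Static (T : ℕ) : Prop where
  info : ∀ s ≥ T, ∀ r < (e.cfg s).nRec, ((e.cfg (s + 1)).recs r).info = ((e.cfg s).recs r).info
  marked : ∀ s ≥ T, ∀ s' ≥ s, ∀ r < (e.cfg s).nRec,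
    ((e.cfg s').recs r).marked = ((e.cfg s).recs r).marked
  done : ∀ s ≥ T, ∀ s' ≥ s, ∀ u < (e.cfg s).nScx, ((e.cfg s').scxs u).state ≠ .inProgress →
    ((e.cfg s).scxs u).state ≠ .inProgress

theorem Static.info_eq {T} (h : e.Static T) {s s' r} (hs : T ≤ s) (hs' : s ≤ s')
    (hr : r < (e.cfg s).nRec) : ((e.cfg s').recs r).info = ((e.cfg s).recs r).info := by
  induction s', hs' using Nat.le_induction with
  | base => rfl
  | succ x hx ih => rw [h.info x (hs.trans hx) r (hr.trans_le (e.nRec_mono hx)), ih]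

variable (hsetup : e.SetUp)
include hsetup

/-- With finitely many SCX-records, each with finite `V` and `R`, there are finitely many freezes,
marks and terminations to wait for. A later change of an info field would be a freeze reached for
the first time. -/
theorem exists_static (h : e.scxTimes.Finite) : ∃ T, e.Static T := by
  obtain ⟨B, hB⟩ := exists_nScx_le h
  have hd : ∀ᶠ T in atTop, ∀ u ∈ Finset.range B, ∀ s ≥ T,
      (u < (e.cfg s).nScx ∧ ((e.cfg s).scxs u).state ≠ .inProgress) →
      (u < (e.cfg T).nScx ∧ ((e.cfg T).scxs u).state ≠ .inProgress) := by
    rw [Filter.eventually_all_finset]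
    exact fun u _ => eventually_stable fun s t hst ⟨h1, h2⟩ =>
      ⟨h1.trans_le (e.nScx_mono hst), e.done_mono hst h1 h2⟩
  have hi : ∀ᶠ T in atTop, ∀ u ∈ Finset.range B, ∀ r ∈ (e.data u).V.toFinset, ∀ s ≥ T,
      e.Reached s u r → e.Reached T u r := by
    rw [Filter.eventually_all_finset]
    intro u _
    rw [Filter.eventually_all_finset]
    exact fun r _ => eventually_stable fun s t hst h => h.mono hst
  have hm : ∀ᶠ T in atTop, ∀ u ∈ Finset.range B, ∀ r ∈ (e.data u).R.toFinset, ∀ s ≥ T,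
      (r < (e.cfg s).nRec ∧ ((e.cfg s).recs r).marked = true) →
      (r < (e.cfg T).nRec ∧ ((e.cfg T).recs r).marked = true) := by
    rw [Filter.eventually_all_finset]
    intro u _
    rw [Filter.eventually_all_finset]
    exact fun r _ => eventually_stable fun s t hst ⟨h1, h2⟩ =>
      ⟨h1.trans_le (e.nRec_mono hst), e.marked_mono hst h1 h2⟩
  obtain ⟨T, hd, hi, hm⟩ := (hd.and (hi.and hm)).exists
  refine ⟨T, fun s hs r hr => ?_, fun s hs s' hs' r hr => ?_, fun s hs s' hs' u hu hdone => ?_⟩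
  · by_contra hne
    obtain ⟨u, h1, h2, h3, h4, h5, h6⟩ := info_lt_of_change hsetup hr hne
    have hR : e.Reached (s + 1) u r := ⟨s + 1, le_rfl, hr.trans_le (e.nRec_mono (Nat.le_succ s)), h1⟩
    have := hi u (by simpa using h3.trans_le (hB s)) r (by simpa using h4) (s + 1) (by omega) hR
    exact absurd ((this.mono hs).le_info hsetup) (not_le.2 h6)
  · have hr' : r < (e.cfg s').nRec := hr.trans_le (e.nRec_mono hs')
    rw [Bool.eq_iff_iff]
    refine ⟨fun hmk => ?_, e.marked_mono hs' hr⟩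
    obtain ⟨u, h1, h2, h3, -⟩ := exists_of_marked hsetup hr' hmk
    obtain ⟨h4, h5⟩ := hm u (by simpa using h2.trans_le (hB s')) r (by simpa using h3) s'
      (by omega) ⟨hr', hmk⟩
    exact e.marked_mono hs h4 h5
  · obtain ⟨h4, h5⟩ := hd u (by simpa using hu.trans_le (hB s)) s' (by omega)
      ⟨hu.trans_le (e.nScx_mono hs'), hdone⟩
    exact e.done_mono hs h4 h5

/-- The `LLX` sees constant mark, info pointer and state, so either the snapshot succeeds, or the
record is committed and marked, or the SCX-record is in progress forever. In the last case the `LLX`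
calls `Help`, whose return would end that state. -/
theorem Static.not_fail {T} (hT : e.Static T) {p l r t resp} (hl : e.act l = .invoke p (.llx r))
    (hTl : T ≤ l) (h : e.Returns l t resp) : resp ≠ .fail := by
  obtain ⟨h1, h2, h3⟩ := e.returns_running hl h
  have hN : r < (e.cfg l).nRec := e.invoke_ok hl
  obtain ⟨m₀, hm₀⟩ : ∃ m, ((e.cfg l).recs r).marked = m := ⟨_, rfl⟩
  obtain ⟨u₀, hu₀⟩ : ∃ u, ((e.cfg l).recs r).info = u := ⟨_, rfl⟩
  obtain ⟨st₀, hst₀⟩ : ∃ st, ((e.cfg l).scxs u₀).state = st := ⟨_, rfl⟩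
  have hX : u₀ < (e.cfg l).nScx := hu₀ ▸ e.info_lt_nScx hN
  have hm : ∀ s, l < s → ((e.cfg s).recs r).marked = m₀ := fun s hs =>
    (hT.marked l hTl s hs.le r hN).trans hm₀
  have hi : ∀ s, l < s → ((e.cfg s).recs r).info = u₀ := fun s hs =>
    (hT.info_eq hTl hs.le hN).trans hu₀
  have hst : ∀ s, l < s → ((e.cfg s).scxs u₀).state = st₀ := by
    intro s hs
    rcases eq_or_ne u₀ 0 with h0 | h0
    · rw [← hst₀, h0, e.dummy_aborted, e.dummy_aborted]
    cases st₀ with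
    | inProgress => by_contra hne; exact hT.done l hTl s hs.le u₀ hX hne hst₀
    | committed => exact committed_mono hsetup hs.le h0 hX hst₀
    | aborted => exact aborted_mono hsetup hs.le h0 hX hst₀
  let Q : PC Val → Prop := fun pc => match pc with
    | .llxMarked₁ r' => r' = r
    | .llxInfo r' m => r' = r ∧ m = m₀
    | .llxState r' m u => r' = r ∧ m = m₀ ∧ u = u₀
    | .llxMarked₂ r' m u st => r' = r ∧ m = m₀ ∧ u = u₀ ∧ st = st₀
    | .llxCollect r' m u _ | .llxReread r' m u _ => r' = r ∧ m = m₀ ∧ u = u₀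
    | .llxTest₁ r' m u => r' = r ∧ m = m₀ ∧ u = u₀ ∧
        ¬ (st₀ = .aborted ∨ (st₀ = .committed ∧ m₀ = false))
    | .llxTest₂ r' m u => r' = r ∧ m = m₀ ∧ u = u₀ ∧ st₀ = .inProgress
    | .ret resp => resp ≠ .fail
    | pc => st₀ = .inProgress ∧ ∃ k, pc.helping = some (u₀, k)
  have hQhelp : ∀ (pc : PC Val) k, pc.helping = some (u₀, k) → (Q pc ↔ st₀ = .inProgress) := by
    intro pc k hk
    cases pc <;> simp [PC.helping] at hk <;> obtain ⟨rfl, rfl⟩ := hk <;> simp [Q, PC.helping]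
  have hQhelp' : ∀ (pc : PC Val) u k, pc.helping = some (u, k) → Q pc → u = u₀ := by
    intro pc u k hk
    cases pc <;> simp [PC.helping] at hk <;> obtain ⟨rfl, rfl⟩ := hk <;> simp [Q, PC.helping]
  have : Q _ := (e.running_induction hl (fun _ => Q) rfl (fun _ _ _ _ h => h) ?_ t h1).1
  · rw [h3] at this; exact this
  · intro s hs hrun ha hI hstep hret
    have hms := hm s hs
    have his := hi s hs
    have hss := hst s hs
    have hss' := hst (s + 1) (by omega)
    cases hh : ((e.cfg s).procs p).pc.helping with
    | some x =>
      obtain ⟨u, k⟩ := x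
      obtain rfl := hQhelp' _ _ _ hh hI
      rw [hQhelp _ _ hh] at hI
      -- Every way of returning from `Help` leaves the SCX-record committed or aborted, contrary to
      -- its constant state.
      rcases hstep.helping hh with h5 | ⟨h5, h6, h7⟩ | ⟨h5, h7⟩ | ⟨h5, h7⟩
      · rw [hQhelp _ _ h5]; exact hI
      · rw [committed_of_helpReturn hsetup ha (.inl ⟨h5, h6⟩), hI] at hss'; cases hss'
      · rw [committed_of_helpReturn hsetup ha (.inr h5), hI] at hss'; cases hss'
      · rw [e.next_run ha, Config.runStep_state_of_helpAbort _ h5, hI] at hss'; cases hss'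
    | none =>
      generalize ((e.cfg s).procs p).pc = pc at hI hstep hret hh
      generalize ((e.cfg (s + 1)).procs p).pc = pc' at hstep
      have hI' := hI
      clear hQhelp hQhelp' hm hi hst h3 hrun hI
      cases hstep <;> simp only [PC.helping, reduceCtorEq] at hh <;> simp only [Q] at hI' ⊢ <;>
        clear Q <;> rename' hI' => hI
      case unmarked => obtain ⟨rfl, rfl, rfl, h4⟩ := hI; simp_all
      case uncommitted => obtain ⟨rfl, rfl, rfl, h4⟩ := hI; cases st₀ <;> simp_all
      case testHelp => obtain ⟨rfl, rfl, rfl, h4⟩ := hI; exact ⟨h4, _, rfl⟩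
      all_goals simp_all [PC.helping]

/-- If finitely many operations succeed, then finitely many `LLX`s can be linked, so there are
finitely many `SCX`s and failing `VLX`s. After the memory has become static no `LLX` fails either,
and only finitely many operations remain unfinished. -/
theorem p2 [Finite P] : e.P2 := by
  intro hinf hfin
  refine hinf ?_
  set S := {t | (∃ p op, e.act t = .invoke p op ∧ op.IsPrimitive) ∧ e.Succeeds t} with hS
  have hS : S.Finite := by
    by_contra h; exact h hfin
  have key : ∀ B : Set ℕ, (∀ t ∈ B, e.Consumes t) → (∀ t ∈ B, ∃ r l, e.Linked l t r) →
      B.Finite := by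
    intro B hc hl
    by_contra hB
    refine infinite_of_linked hB hc (S := S) (fun t ht => ?_) hS
    obtain ⟨r, l, h⟩ := hl t ht
    obtain ⟨⟨p, h1⟩, h2⟩ := h.succeeds
    exact ⟨r, l, ⟨⟨p, _, h1, trivial⟩, h2⟩, h⟩
  have hscx : e.scxTimes.Finite := by
    refine key _ (fun t ht => .inl (mem_scxTimes ht)) fun t ht => ?_
    obtain ⟨p, V, R, fld, new, ha⟩ := mem_scxTimes ht
    obtain ⟨l, hl⟩ := hsetup t p _ ha fld.1 (e.invoke_ok ha).2.1
    exact ⟨_, l, hl⟩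
  have hvlx : e.failedVlxTimes.Finite := by
    refine key _ (fun t ht => .inr ht) ?_
    rintro t ⟨p, V, t', ha, hr⟩
    obtain ⟨r, hrV, -⟩ := exists_of_failed_vlx ha hr
    obtain ⟨l, hl⟩ := hsetup t p _ ha r hrV
    exact ⟨_, l, hl⟩
  have hvlx' := finite_vlx_of_finite hS (fun t p V ha hs => ⟨⟨p, _, ha, trivial⟩, hs⟩) hvlx
  obtain ⟨T, hT⟩ := exists_static hsetup hscx
  refine ((((hS.union hscx).union hvlx').union e.finite_not_terminates).union
    (Set.finite_lt_nat T)).subset ?_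
  rintro t ⟨p, op, ha, hop⟩
  simp only [Set.mem_union]
  by_cases htT : t < T
  · exact .inr htT
  left
  by_cases hterm : e.Terminates t
  · left
    cases op with
    | llx r =>
      obtain ⟨t', resp, hr⟩ := hterm
      have := hT.not_fail hsetup ha (not_lt.1 htT) hr
      refine .inl (.inl ⟨⟨p, _, ha, trivial⟩, t', resp, hr, ?_⟩)
      rcases hr.resp_llx ha with ⟨ms, rfl⟩ | rfl | rfl
      · trivial
      · trivial
      · exact absurd rfl this
    | scx V R fld new => exact .inl (.inr ⟨p, _, ha, trivial⟩)
    | vlx V => exact .inr ⟨p, V, ha⟩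
    | read r f => exact hop.elim
  · exact .inr ⟨⟨p, op, ha⟩, hterm⟩

/-- Once info fields are constant, a `VLX` fails only if its linked `LLX` for the offending record
began earlier, and each of these finitely many `LLX`s serves one failing `VLX`. -/
theorem p3_of_finite_scx [Finite P] (hscx : e.scxTimes.Finite)
    (hS : {t | (∃ p op, e.act t = .invoke p op ∧ op.IsScxOrVlx) ∧ e.Succeeds t}.Finite) :
    {t | ∃ p op, e.act t = .invoke p op ∧ op.IsScxOrVlx}.Finite := by
  obtain ⟨T, hT⟩ := exists_static hsetup hscx
  have hvlx : e.failedVlxTimes.Finite := by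
    by_contra hB
    refine infinite_of_linked hB (fun t ht => .inr ht) (S := {l | l < T}) ?_ (Set.finite_lt_nat T)
    rintro t ⟨p, V, t', ha, hr⟩
    obtain ⟨r, hrV, s, h1, h2, h3⟩ := exists_of_failed_vlx ha hr
    obtain ⟨l, hl⟩ := hsetup t p _ ha r hrV
    refine ⟨r, l, ?_, hl⟩
    by_contra! hlT
    obtain ⟨p', op', d, m, u, ms, x, h4, h5, h6, h7, h8, h9⟩ := hl.isSnapshot
    rw [ha] at h4; cases h4
    have := h8.lt_point; have := h8.point_lt
    simp only [Set.mem_ofPred_eq, not_lt] at hlT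
    refine h3 ?_
    rw [h9, hT.info_eq (s := d) (by omega) (by omega) (h8.nRec.trans_le (e.nRec_mono (by omega))),
      h8.info]
  have hvlx' := finite_vlx_of_finite hS (fun t p V ha hs => ⟨⟨p, _, ha, trivial⟩, hs⟩) hvlx
  refine (hscx.union hvlx').subset ?_
  rintro t ⟨p, op, ha, hop⟩
  cases op with
  | scx V R fld new => exact .inl ⟨p, _, ha, trivial⟩
  | vlx V => exact .inr ⟨p, V, ha⟩
  | llx r => exact hop.elim
  | read r f => exact hop.elim

end Execution

/-! ### Progress of `SCX`s: freezing in order, visibility, and P3 and P4. -/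

namespace Execution

variable {P Val : Type*} [DecidableEq P] [DecidableEq Val] [Inhabited Val]
  {refs : Val → Set RecId} (e : Execution P refs)

/-! ### Freezing in the order of the sequence -/

theorem _root_.List.eq_or_mem_of_append_cons_eq {α : Type*} {d d' rs rs' : List α} {r r' : α}
    (h : d ++ r :: rs = d' ++ r' :: rs') : r = r' ∨ r ∈ d' ∨ r' ∈ d := by
  rcases List.append_eq_append_iff.1 h with ⟨a, h1, h2⟩ | ⟨a, h1, h2⟩
  · cases a with
    | nil => simp at h2; exact .inl h2.1
    | cons x a => simp at h2; subst h1; simp [h2.1]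
  · cases a with
    | nil => simp at h2; exact .inl h2.1.symm
    | cons x a => simp at h2; subst h1; simp [h2.1]

variable {e} (hsetup : e.SetUp)
include hsetup

/-- No record is frozen for an `SCX` that is not in progress anymore. -/
theorem inProgress_of_freeze {t r} (hr : r < (e.cfg t).nRec)
    (h : ((e.cfg (t + 1)).recs r).info ≠ ((e.cfg t).recs r).info) :
    ((e.cfg t).scxs ((e.cfg (t + 1)).recs r).info).state = .inProgress := by
  rcases e.info_succ hr with h1 | ⟨p, u, rs, k, -, h1, h2, h3⟩
  · exact absurd h1 h
  rw [h3] at h ⊢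
  obtain ⟨h0, hu⟩ := e.helping_valid (t := t) (p := p) (u := u) (k := k) (by rw [h1]; rfl)
  obtain ⟨_, h4, -, -, hV, h5, h6⟩ := info_lt_of_change hsetup hr (by rwa [h3])
  rw [h3] at h4; subst h4
  have hnr : ¬ e.Reached t u r := fun hR => absurd (hR.le_info hsetup) (not_le.2 h6)
  have hI := (safety hsetup t).2 p
  rw [h1] at hI
  obtain ⟨d, h7, h8⟩ := hI
  cases hst : ((e.cfg t).scxs u).state with
  | inProgress => rfl
  | committed =>
    exact absurd (reached_of_allFrozen hsetup h0 hu (committed_facts hsetup h0 hu hst).1 hV) hnr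
  | aborted =>
    obtain ⟨d', r', rs', h9, h10, h11⟩ := blocked_of_aborted hsetup h0 hu hst
    -- Compare the record `r` being frozen with the record `r'` at which `u` is blocked. Whichever
    -- comes first in `V`, or if they coincide, one of them would have to be both frozen and not
    -- frozen, or `r.info` would already have moved past the expected pointer.
    rcases List.eq_or_mem_of_append_cons_eq (h7.symm.trans h9) with rfl | h12 | h12
    · exact absurd h5 h11.1.ne'
    · exact absurd (h10 r h12) hnr
    · exact absurd (h8 r' h12) h11.2

/-- Records are frozen in the order of the sequence. -/
theorem Reached.prefix {t u r} (h : e.Reached t u r) (h0 : u ≠ 0) :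
    ∃ d rs, (e.data u).V = d ++ r :: rs ∧ ∀ x ∈ d, e.Reached t u x := by
  induction t with
  | zero =>
    obtain ⟨s, h1, h2, h3⟩ := h
    obtain rfl : s = 0 := by omega
    rw [e.initial.info r h2] at h3
    exact absurd h3.symm h0
  | succ t ih =>
    by_cases hR : e.Reached t u r
    · obtain ⟨d, rs, h1, h2⟩ := ih hR
      exact ⟨d, rs, h1, fun x hx => (h2 x hx).mono (Nat.le_succ t)⟩
    obtain ⟨s, h1, h2, h3⟩ := h
    rcases h1.lt_or_eq with h4 | rfl
    · exact absurd ⟨s, by omega, h2, h3⟩ hR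
    by_cases hr : r < (e.cfg t).nRec
    · rcases e.info_succ hr with h1 | ⟨p, w, rs, k, -, h1, -, h5⟩
      · exact absurd ⟨t, le_rfl, hr, h1 ▸ h3⟩ hR
      · rw [h3] at h5; subst h5
        have hI := (safety hsetup t).2 p
        rw [h1] at hI
        obtain ⟨d, h7, h8⟩ := hI
        exact ⟨d, rs, h7, fun x hx => (h8 x hx).mono (Nat.le_succ t)⟩
    · rcases e.nRec_succ t with h | ⟨_, _, _, _, h4, h5⟩
      · exact absurd (h ▸ h2) hr
      · rw [h4] at h2
        obtain rfl : r = (e.cfg t).nRec := le_antisymm (Nat.lt_succ_iff.1 h2) (not_lt.1 hr)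
        rw [h5] at h3
        exact absurd h3.symm h0

omit hsetup

/-! ### Visible records -/

/-- Pointers in fields come from initial values or from the `new` of an `SCX`, so both must be
followed together. Consequently a pointer to a record created later requires a field to change or a
new record to hold it. -/
theorem refs_lt (t : ℕ) :
    (∀ r < (e.cfg t).nRec, ∀ v ∈ ((e.cfg t).recs r).vals ++ ((e.cfg t).recs r).consts,
      ∀ r' ∈ refs v, r' < (e.cfg t).nRec) ∧
    ∀ u, u ≠ 0 → u < (e.cfg t).nScx → ∀ r' ∈ refs (e.data u).new, r' < (e.cfg t).nRec := by
  induction t with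
  | zero =>
    refine ⟨e.initial.refs_lt, fun u h0 hu => ?_⟩
    rw [e.initial.nScx] at hu; omega
  | succ t ih =>
    obtain ⟨ih1, ih2⟩ := ih
    have hN : (e.cfg t).nRec ≤ (e.cfg (t + 1)).nRec := e.nRec_mono (Nat.le_succ t)
    refine ⟨fun r hr v hv r' hr' => ?_, fun u h0 hu r' hr' => ?_⟩
    · by_cases hrt : r < (e.cfg t).nRec
      · refine lt_of_lt_of_le ?_ hN
        rw [e.consts_succ hrt] at hv
        rcases e.vals_succ hrt with h1 | ⟨p, u, k, -, h2, -, -, h3⟩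
        · rw [h1] at hv; exact ih1 r hrt v hv r' hr'
        · obtain ⟨h0, hu⟩ := e.helping_valid (t := t) (p := p) (u := u) (k := k) (by rw [h2]; rfl)
          rw [h3, (e.sameData hu).new] at hv
          rcases List.mem_append.1 hv with hv | hv
          · rcases List.mem_or_eq_of_mem_set hv with hv | rfl
            · exact ih1 r hrt v (List.mem_append_left _ hv) r' hr'
            · exact ih2 u h0 hu r' hr'
          · exact ih1 r hrt v (List.mem_append_right _ hv) r' hr'
      · rcases e.nRec_succ t with h | ⟨p, vals, consts, ha, h1, h2⟩
        · omega
        · obtain rfl : r = (e.cfg t).nRec := by omega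
          rw [h2] at hv
          have hen := e.enabled t
          rw [ha] at hen
          -- A new record may point to itself, hence the weak inequality from the enabling
          -- condition.
          exact lt_of_le_of_lt (hen.2 v hv r' hr') hr
    · refine lt_of_lt_of_le ?_ hN
      by_cases hut : u < (e.cfg t).nScx
      · exact ih2 u h0 hut r' hr'
      · rcases e.nScx_succ t with h | ⟨p, V, R, fld, new, ha, h, -⟩
        · omega
        · obtain rfl : u = (e.cfg t).nScx := by omega
          rw [← (e.data_of_invoke ha).new] at hr'
          exact (e.invoke_ok ha).2.2.2 r' hr'

theorem NoChangeAfter.fields_eq {C t r} (h : e.NoChangeAfter C) (ht : C ≤ t)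
    (hr : r < (e.cfg C).nRec) : ((e.cfg t).recs r).vals = ((e.cfg C).recs r).vals ∧
      ((e.cfg t).recs r).consts = ((e.cfg C).recs r).consts := by
  induction t, ht using Nat.le_induction with
  | base => exact ⟨rfl, rfl⟩
  | succ s hs ih =>
    obtain ⟨h1, h2⟩ := h s hs r (hr.trans_le (e.nRec_mono hs))
    exact ⟨h1.trans ih.1, h2.trans ih.2⟩

/-- If the fields do not change anymore, no further records become visible. -/
theorem Visible.lt_nRec {C t r} (h : e.NoChangeAfter C) (hv : e.Visible t r) :
    r < (e.cfg t).nRec ∧ r < (e.cfg C).nRec := by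
  induction hv with
  | initial t r hr =>
    exact ⟨hr.trans_le (e.nRec_mono (Nat.zero_le t)), hr.trans_le (e.nRec_mono (Nat.zero_le C))⟩
  | step s t r r' v hst hv hmem hr ih =>
    have hs := (refs_lt s).1 r' ih.1 v hmem r hr
    refine ⟨hs.trans_le (e.nRec_mono hst), ?_⟩
    rcases le_total s C with hle | hle
    · exact hs.trans_le (e.nRec_mono hle)
    · rw [(h.fields_eq hle ih.2).1, (h.fields_eq hle ih.2).2] at hmem
      exact (refs_lt C).1 r' ih.2 v hmem r hr

/-- A record that never becomes visible is used by only one process. -/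
theorem llx_process_unique {C r l l' p p'} (hacc : e.LlxAccessible) (h : e.NoChangeAfter C)
    (hr : (e.cfg C).nRec ≤ r) (hl : e.act l = .invoke p (.llx r))
    (hl' : e.act l' = .invoke p' (.llx r)) : p = p' := by
  have key : ∀ l p, e.act l = .invoke p (.llx r) →
      ∃ s, ∃ vals consts, e.act s = .create p vals consts ∧ (e.cfg s).nRec = r := by
    intro l p hl
    rcases hacc l p r hl with hv | ⟨s, -, hs⟩
    · exact absurd (hv.lt_nRec h).2 (not_lt.2 hr)
    · exact ⟨s, hs⟩
  have hlt : ∀ s s' p vals consts, e.act s = .create p vals consts → s < s' →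
      (e.cfg s).nRec < (e.cfg s').nRec := by
    intro s s' p vals consts ha hlt
    have h1 : (e.cfg (s + 1)).nRec ≤ (e.cfg s').nRec := e.nRec_mono hlt
    rw [e.next_create ha] at h1
    exact h1
  obtain ⟨s, vals, consts, ha, hs⟩ := key l p hl
  obtain ⟨s', vals', consts', ha', hs'⟩ := key l' p' hl'
  rcases lt_trichotomy s s' with hss | rfl | hss
  · have := hlt _ _ _ _ _ ha hss; omega
  · rw [ha] at ha'; cases ha'; rfl
  · have := hlt _ _ _ _ _ ha' hss; omega

include hsetup

/-- If finitely many `SCX`s succeed, the fields stop changing. -/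
theorem exists_noChangeAfter [Finite P] (hABA : e.NoABA)
    (hS : {t | (∃ p op, e.act t = .invoke p op ∧ op.IsScx) ∧ e.Succeeds t}.Finite) :
    ∃ C, e.NoChangeAfter C := by
  have hlin : {t | ∃ s p V R fld new, e.act t = .invoke p (.scx V R fld new) ∧
      e.FirstUpdate s (e.cfg t).nScx}.Finite := by
    refine (hS.union e.finite_not_terminates).subset ?_
    rintro t ⟨s, p, V, R, fld, new, ha, hs⟩
    by_cases ht : e.Terminates t
    · obtain ⟨t', resp, hr⟩ := ht
      obtain ⟨rfl, -⟩ := hs.of_returns hsetup ha hr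
      exact .inl ⟨⟨p, _, ha, trivial⟩, t', _, hr, trivial⟩
    · exact .inr ⟨⟨p, _, ha⟩, ht⟩
  have hfin : {s | ∃ u, e.FirstUpdate s u}.Finite := by
    have : ∀ s ∈ {s | ∃ u, e.FirstUpdate s u}, ∃ t p V R fld new,
        e.act t = .invoke p (.scx V R fld new) ∧ e.FirstUpdate s (e.cfg t).nScx := by
      rintro s ⟨u, hs⟩
      obtain ⟨h0, hu⟩ := hs.1.valid
      obtain ⟨t, ht, p, V, R, fld, new, ha, rfl⟩ := e.exists_invoke h0 hu
      exact ⟨t, p, V, R, fld, new, ha, hs⟩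
    choose! τ hτ using this
    refine Set.Finite.of_injOn (f := τ) (t := {t | ∃ s p V R fld new,
      e.act t = .invoke p (.scx V R fld new) ∧ e.FirstUpdate s (e.cfg t).nScx}) ?_ ?_ hlin
    · exact fun s hs => ⟨s, hτ s hs⟩
    intro s hs s' hs' heq
    obtain ⟨_, _, _, _, _, _, h1⟩ := hτ s hs
    obtain ⟨_, _, _, _, _, _, h2⟩ := hτ s' hs'
    rw [← heq] at h2
    exact h1.unique h2
  obtain ⟨B, hB⟩ := hfin.bddAbove
  refine ⟨B + 1, fun t ht r hr => ⟨?_, e.consts_succ hr⟩⟩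
  rcases e.vals_succ hr with h1 | ⟨p, u, k, h1, h2, h3, h4, h5⟩
  · exact h1
  -- No first update CAS happens after `B`, so the last written value is the same before and after
  -- this CAS. The CAS therefore stores the value that is already there.
  · have hw := lastWritten hsetup hABA t r hr _ _ h4
    have hi := (List.getElem?_eq_some_iff.1 h4).1
    have hw' := lastWritten hsetup hABA (t + 1) r (hr.trans_le (e.nRec_mono (Nat.le_succ t)))
      ((e.cfg t).scxs u).fld.2 ((e.cfg t).scxs u).new (by rw [h5, List.getElem?_set_self hi])
    have hw'' := hw.of_no_write (Nat.le_succ t) hr fun s v' hs hs' ⟨w, hw1, _⟩ => by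
      have : s ≤ B := hB ⟨w, hw1⟩
      omega
    rw [h5, hw'.unique hw'', ← (List.getElem?_eq_some_iff.1 h4).2, List.set_getElem_self]

/-! ### Failing `SCX`s -/

omit hsetup
variable (e)

/-- The `SCX` invoked at `t` returns `FALSE` because the info field of `r` had changed. -/
def BlockedAt (t : ℕ) (r : RecId) : Prop :=
  ∃ t' d rs, e.Returns t t' (.bool false) ∧ (e.data (e.cfg t).nScx).V = d ++ r :: rs ∧
    (∀ x ∈ d, e.Reached t' (e.cfg t).nScx x) ∧ e.Passed t' (e.cfg t).nScx r

/-- The info field of `r` changes infinitely often. -/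
def ChangesOften (r : RecId) : Prop :=
  ∀ T, ∃ s ≥ T, r < (e.cfg s).nRec ∧ ((e.cfg (s + 1)).recs r).info ≠ ((e.cfg s).recs r).info

variable {e}

include hsetup

theorem exists_blockedAt {t p V R fld new} (ha : e.act t = .invoke p (.scx V R fld new))
    (ht : e.Terminates t) (hs : ¬ e.Succeeds t) : ∃ r, e.BlockedAt t r := by
  obtain ⟨t', resp, hr⟩ := ht
  obtain ⟨b, rfl⟩ := hr.resp_scx ha
  cases b
  · have hst := state_of_returns_scx hsetup ha hr
    obtain ⟨d, r, rs, h1, h2, h3⟩ := blocked_of_aborted hsetup (e.nScx_pos t).ne'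
      (e.nScx_lt_of_invoke ha (e.returns_running ha hr).1.1) hst
    exact ⟨r, t', d, rs, hr, h1, h2, h3⟩
  · exact absurd ⟨t', _, hr, trivial⟩ hs

/-- A record blocks infinitely many `SCX`s only if its info field changes infinitely often. -/
theorem changesOften_of_infinite {r} {B : Set ℕ} (hB : B.Infinite)
    (h : ∀ t ∈ B, t ∈ e.scxTimes ∧ e.BlockedAt t r) : e.ChangesOften r := by
  by_contra hne
  simp only [ChangesOften, not_forall, not_exists, not_and, not_not] at hne
  obtain ⟨T, hT⟩ := hne
  refine infinite_of_linked hB (fun t ht => .inl (mem_scxTimes (h t ht).1)) (S := {l | l < T}) ?_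
    (Set.finite_lt_nat T)
  intro t ht
  obtain ⟨hts, t', d, rs, hr, hV, -, hp⟩ := h t ht
  obtain ⟨p, V, R, fld, new, ha⟩ := mem_scxTimes hts
  have hrV : r ∈ V := by
    have : (e.data (e.cfg t).nScx).V = V := (e.data_of_invoke ha).V.symm
    rw [← this, hV]; simp
  obtain ⟨l, hl⟩ := hsetup t p _ ha r hrV
  refine ⟨r, l, ?_, hl⟩
  -- A linked `LLX` that begins after `T` would have read the final info pointer, and the record
  -- could not have been passed afterwards.
  by_contra! hlT
  simp only [Set.mem_ofPred_eq, not_lt] at hlT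
  obtain ⟨x, m, ms, t'', h1, h2, h3, -⟩ := hl.scx_isSnapshot e ha
  have h4 := h3.lt_point
  have h5 := h3.point_lt
  have h6 := (e.returns_running ha hr).1.1
  have hN : r < (e.cfg x).nRec := h3.nRec.trans_le (e.nRec_mono h4.le)
  have key : ∀ s ≥ x, ((e.cfg s).recs r).info = ((e.cfg x).recs r).info := by
    intro s hs
    induction s, hs using Nat.le_induction with
    | base => rfl
    | succ s hs ih => rw [hT s (by omega) (hN.trans_le (e.nRec_mono hs)), ih]
  have := hp.1
  rw [key t' (by omega), h3.info] at this
  exact lt_irrefl _ this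

theorem ChangesOften.exists_info_ge {r} (h : e.ChangesOften r) (n : ℕ) :
    ∃ s, r < (e.cfg s).nRec ∧ n ≤ ((e.cfg s).recs r).info := by
  induction n with
  | zero =>
    obtain ⟨s, -, h1, -⟩ := h 0
    exact ⟨s, h1, Nat.zero_le _⟩
  | succ n ih =>
    obtain ⟨s, h1, h2⟩ := ih
    obtain ⟨x, h3, h4, h5⟩ := h s
    obtain ⟨u, h6, -, -, -, -, h7⟩ := info_lt_of_change hsetup h4 h5
    refine ⟨x + 1, h4.trans_le (e.nRec_mono (Nat.le_succ x)), ?_⟩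
    rw [h6]
    exact Nat.succ_le_of_lt ((h2.trans (info_mono hsetup h3 h1)).trans_lt h7)

/-- The info field takes arbitrarily large addresses, and each of them is an SCX-record whose
invocation has frozen `r`; large addresses were allocated late. -/
theorem ChangesOften.infinite {r} (h : e.ChangesOften r) :
    {t | t ∈ e.scxTimes ∧ ∃ s, e.Reached s (e.cfg t).nScx r}.Infinite := by
  refine Set.infinite_of_forall_exists_gt fun n => ?_
  obtain ⟨s, h1, h2⟩ := h.exists_info_ge hsetup (e.cfg n).nScx
  obtain ⟨x, h3, h4, h5⟩ := h s
  obtain ⟨u, h6, h0, hu, -, -, h7⟩ := info_lt_of_change hsetup h4 h5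
  obtain ⟨τ, hτ, p, V, R, fld, new, ha, rfl⟩ := e.exists_invoke h0 hu
  refine ⟨τ, ⟨⟨p, _, ha, trivial⟩, x + 1, x + 1, le_rfl,
    h4.trans_le (e.nRec_mono (Nat.le_succ x)), h6⟩, ?_⟩
  by_contra! hle
  exact absurd ((h2.trans (info_mono hsetup h3 h1)).trans_lt h7) (not_lt.2 (e.nScx_mono hle))

/-- A record that blocks an `SCX` has become visible before the fields stop changing. -/
theorem BlockedAt.lt_nRec {C t r} (h : e.BlockedAt t r) (ht : t ∈ e.scxTimes)
    (hacc : e.LlxAccessible) (hC : e.NoChangeAfter C) : r < (e.cfg C).nRec := by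
  by_contra! hrC
  obtain ⟨t', d, rs, hr, hV, -, hp⟩ := h
  obtain ⟨p, V, R, fld, new, ha⟩ := mem_scxTimes ht
  have hrV : r ∈ V := by
    have : (e.data (e.cfg t).nScx).V = V := (e.data_of_invoke ha).V.symm
    rw [← this, hV]; simp
  obtain ⟨l, hl⟩ := hsetup t p _ ha r hrV
  obtain ⟨x, m, ms, t'', h1, h2, h3, -⟩ := hl.scx_isSnapshot e ha
  have h4 := h3.lt_point
  have h5 := h3.point_lt
  have h6 := (e.returns_running ha hr).1.1
  have hN : r < (e.cfg x).nRec := h3.nRec.trans_le (e.nRec_mono h4.le)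
  have hchange : ∃ z, x ≤ z ∧ z < t' ∧
      ((e.cfg (z + 1)).recs r).info ≠ ((e.cfg z).recs r).info := by
    by_contra! hno
    have key : ∀ s ≥ x, s ≤ t' → ((e.cfg s).recs r).info = ((e.cfg x).recs r).info := by
      intro s hs
      induction s, hs using Nat.le_induction with
      | base => exact fun _ => rfl
      | succ s hs ih => exact fun hst => (hno s hs (by omega)).trans (ih (by omega))
    have := hp.1
    rw [key t' (by omega) le_rfl, h3.info] at this
    exact lt_irrefl _ this
  obtain ⟨z, hz1, hz2, hz3⟩ := hchange
  have hNz := hN.trans_le (e.nRec_mono hz1)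
  have hprog := inProgress_of_freeze hsetup hNz hz3
  obtain ⟨w, hw1, hw0, hw2, hw3, -, hw4⟩ := info_lt_of_change hsetup hNz hz3
  rw [hw1] at hprog
  obtain ⟨τ, hτ, q, V', R', fld', new', hq, rfl⟩ := e.exists_invoke hw0 hw2
  have hrV' : r ∈ V' := by
    have : (e.data (e.cfg τ).nScx).V = V' := (e.data_of_invoke hq).V.symm
    rwa [this] at hw3
  obtain ⟨lw, hlw⟩ := hsetup τ q _ hq r hrV'
  obtain ⟨-, p₁, op₁, hl1, hl2, -, -, hl3⟩ := hl
  rw [ha] at hl2; cases hl2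
  obtain ⟨-, q₁, op₂, hlw1, hlw2, -⟩ := hlw
  rw [hq] at hlw2; cases hlw2
  obtain rfl := llx_process_unique hacc hC hrC hl1 hlw1
  -- The change of `r.info` is due to an `SCX` of the same process, still in progress at `z`. If
  -- invoked before the linked `LLX` it has finished; between the `LLX` and `t` it breaks the link;
  -- at `t` it is the blocked `SCX` itself, which never froze `r`; after `t` it comes after the
  -- failure.
  rcases lt_trichotomy τ t with hτt | rfl | hτt
  · rcases lt_trichotomy τ l with hτl | rfl | hτl
    · obtain ⟨y, hy, resp, hyr⟩ := e.exists_returns_of_invoke hq hτl hl1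
      obtain ⟨b, rfl⟩ := hyr.resp_scx hq
      have hst := state_of_returns_scx hsetup hq hyr
      refine e.done_mono (t := y) (t' := z) (by omega)
        (e.nScx_lt_of_invoke hq (e.returns_running hq hyr).1.1) ?_ hprog
      rw [hst]; cases b <;> simp
    · rw [hl1] at hq; cases hq
    · exact (hl3 τ hτl hτt).2.1 V' R' fld' new' hrV' hq
  · exact hp.2 ⟨z + 1, by omega, hNz.trans_le (e.nRec_mono (Nat.le_succ z)), hw1⟩
  · obtain ⟨y, hy, resp, hyr⟩ := e.exists_returns_of_invoke ha hτt hq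
    obtain ⟨rfl, -⟩ := e.returns_unique hr hyr
    omega

/-- Assume that infinitely many `SCX`s are invoked and finitely many succeed. All but finitely many
then fail at one of the records present at `C`, with `V` sorted. Each record that changes often
leads to a strictly larger one that also does, which a finite set does not allow. -/
theorem p4 [Finite P] (hABA : e.NoABA) (hord : e.EventuallyOrdered) (hacc : e.LlxAccessible) :
    e.P4 := by
  intro hinf hfin
  refine hinf ?_
  change e.scxTimes.Finite
  have hS : {t | (∃ p op, e.act t = .invoke p op ∧ op.IsScx) ∧ e.Succeeds t}.Finite := by
    by_contra h; exact h hfin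
  obtain ⟨C, hC⟩ := exists_noChangeAfter hsetup hABA hS
  obtain ⟨lt, hlt, hsorted⟩ := hord C hC
  set Early := {t | t ∈ e.scxTimes ∧ ∃ r l, l < C ∧ e.Linked l t r} with hEarly
  -- Each of the finitely many `LLX`s that began before `C` is linked to at most one `SCX`.
  have hEarly : Early.Finite := by
    by_contra hB
    refine infinite_of_linked hB (fun t ht => .inl (mem_scxTimes ht.1)) (S := {l | l < C}) ?_
      (Set.finite_lt_nat C)
    rintro t ⟨-, r, l, h1, h2⟩
    exact ⟨r, l, h1, h2⟩
  set Bad := (Early ∪ {t | (∃ p op, e.act t = .invoke p op ∧ op.IsScx) ∧ e.Succeeds t}) ∪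
    {t | (∃ p op, e.act t = .invoke p op) ∧ ¬ e.Terminates t}
  have hBad : Bad.Finite := (hEarly.union hS).union e.finite_not_terminates
  have hgood : ∀ t ∈ e.scxTimes, t ∉ Bad → (∃ r < (e.cfg C).nRec, e.BlockedAt t r) ∧
      (e.data (e.cfg t).nScx).V.Pairwise lt := by
    intro t ht hb
    simp only [Bad, Set.mem_union, not_or] at hb
    obtain ⟨⟨hb1, hb2⟩, hb3⟩ := hb
    obtain ⟨p, V, R, fld, new, ha⟩ := mem_scxTimes ht
    have hterm : e.Terminates t := by
      by_contra h; exact hb3 ⟨⟨p, _, ha⟩, h⟩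
    have hns : ¬ e.Succeeds t := fun h => hb2 ⟨⟨p, _, ha, trivial⟩, h⟩
    obtain ⟨r, hr⟩ := exists_blockedAt hsetup ha hterm hns
    refine ⟨⟨r, hr.lt_nRec hsetup ht hacc hC, hr⟩, ?_⟩
    rw [← (e.data_of_invoke ha).V]
    refine hsorted t p V R fld new ha fun r hr l hl => ?_
    by_contra! hlC
    exact hb1 ⟨ht, r, l, hlC, hl⟩
  have pigeonhole : ∀ B : Set ℕ, B.Infinite → ∀ Q : RecId → Prop,
      (∀ t ∈ B, t ∈ e.scxTimes ∧ ∃ r < (e.cfg C).nRec, Q r ∧ e.BlockedAt t r) →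
      ∃ r < (e.cfg C).nRec, Q r ∧ e.ChangesOften r := by
    intro B hB Q hQ
    by_contra! hno
    refine hB ((Set.Finite.biUnion (Set.finite_lt_nat (e.cfg C).nRec)
      (t := fun r => {t | t ∈ B ∧ Q r ∧ e.BlockedAt t r}) fun r hr => ?_).subset ?_)
    · by_contra hi
      obtain ⟨t, ht⟩ := Set.Infinite.nonempty hi
      exact hno r hr ht.2.1 (changesOften_of_infinite hsetup hi fun t ht => ⟨(hQ t ht.1).1, ht.2.2⟩)
    · intro t ht
      obtain ⟨-, r, hr, hq, hb⟩ := hQ t ht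
      exact Set.mem_biUnion (show r ∈ {r | r < (e.cfg C).nRec} from hr) ⟨ht, hq, hb⟩
  by_contra hinf'
  obtain ⟨r₀, hr₀, -, hch₀⟩ := pigeonhole _ (Set.Infinite.sdiff hinf' hBad) (fun _ => True) fun t ht => by
    obtain ⟨⟨r, hr, hb⟩, -⟩ := hgood t ht.1 ht.2
    exact ⟨ht.1, r, hr, trivial, hb⟩
  have hnext : ∀ r, e.ChangesOften r → ∃ r' < (e.cfg C).nRec, lt r r' ∧ e.ChangesOften r' := by
    intro r hch
    refine pigeonhole _ (Set.Infinite.sdiff (hch.infinite hsetup) hBad) (lt r) ?_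
    rintro t ⟨⟨ht, s, hs⟩, hb⟩
    obtain ⟨⟨r', hr', hblock⟩, hpair⟩ := hgood t ht hb
    refine ⟨ht, r', hr', ?_, hblock⟩
    obtain ⟨t', d, rs, hret, hV, -, hp⟩ := hblock
    obtain ⟨p, V, R, fld, new, ha⟩ := mem_scxTimes ht
    have h0 := (e.nScx_pos t).ne'
    have hu := e.nScx_lt_of_invoke ha (e.returns_running ha hret).1.1
    have hnr : ∀ x, ¬ e.Reached x (e.cfg t).nScx r' := fun x hx =>
      (hp.mono hsetup (le_max_left t' x) h0 hu (by simp [hV])).2 (hx.mono (le_max_right t' x))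
    obtain ⟨d₂, rs₂, hV₂, hd₂⟩ := hs.prefix hsetup h0
    rw [hV] at hpair
    -- The record `r` was frozen and the blocking record `r'` never is. As freezing follows the
    -- sequence, `r'` must come after `r`, so it is larger in the order.
    rcases List.eq_or_mem_of_append_cons_eq (hV₂.symm.trans hV) with rfl | h1 | h1
    · exact absurd hs (hnr s)
    · exact (List.pairwise_append.1 hpair).2.2 r h1 r' (by simp)
    · exact absurd (hd₂ r' h1) (hnr s)
  -- On a finite set the reversed order is well founded, so there is a maximal record that changes
  -- often.
  let F := {r : Fin (e.cfg C).nRec // e.ChangesOften r}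
  have : IsTrans F fun a b => lt b.1 a.1 := ⟨fun a b c h1 h2 => hlt.toIsStrictOrder.toIsTrans.trans _ _ _ h2 h1⟩
  have : Std.Irrefl fun a b : F => lt b.1 a.1 := ⟨fun a h => hlt.toIsStrictOrder.toIrrefl.irrefl _ h⟩
  have hwf := Finite.wellFounded_of_trans_of_irrefl fun a b : F => lt b.1 a.1
  obtain ⟨m, -, hm⟩ := hwf.has_min Set.univ ⟨⟨⟨r₀, hr₀⟩, hch₀⟩, trivial⟩
  obtain ⟨r', hr', hlt', hch'⟩ := hnext m.1 m.2
  exact hm ⟨⟨r', hr'⟩, hch'⟩ trivial hlt'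

/-- With infinitely many `SCX`s the statement follows from P4; with finitely many, the memory
becomes static. -/
theorem p3 [Finite P] (hABA : e.NoABA) (hord : e.EventuallyOrdered) (hacc : e.LlxAccessible) :
    e.P3 := by
  intro hinf hfin
  have hS : {t | (∃ p op, e.act t = .invoke p op ∧ op.IsScxOrVlx) ∧ e.Succeeds t}.Finite := by
    by_contra h; exact h hfin
  refine hinf (p3_of_finite_scx hsetup ?_ hS)
  by_contra hscx
  refine p4 hsetup hABA hord hacc hscx (hS.subset ?_)
  rintro t ⟨⟨p, op, ha, hop⟩, hs⟩
  refine ⟨⟨p, op, ha, ?_⟩, hs⟩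
  cases op <;> simp_all [Op.IsScx, Op.IsScxOrVlx]

end Execution

end LLXSCX

theorem theorem1 {P Val : Type*} [Finite P] [DecidableEq P] [DecidableEq Val] [Inhabited Val]
    (refs : Val → Set RecId) (e : Execution P refs)
    (hsetup : e.SetUp) (hABA : e.NoABA) :
    (∃ lin : ℕ → Option ℕ, e.IsLinearization lin ∧ e.C1 lin ∧ e.C2 lin ∧ e.C3 lin ∧ e.C4 lin) ∧
    e.P1 ∧
    (e.EventuallyOrdered → e.LlxAccessible → e.P2 ∧ e.P3 ∧ e.P4) :=
  ⟨⟨e.lin, Execution.isLinearization hsetup, Execution.c1 hsetup hABA, Execution.c2 hsetup hABA,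
    Execution.c3 hsetup, Execution.c4 hsetup⟩, Execution.p1 hsetup,
    fun hord hacc => ⟨Execution.p2 hsetup, Execution.p3 hsetup hABA hord hacc,
      Execution.p4 hsetup hABA hord hacc⟩⟩
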